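/- Let $R$ be an integral domain of characteristic different from $2$, let $q\in R^\times$ with $q+q^{-1}\in R^\times$, put $\epsilon=q-q^{-1}$, and let $m,n\ge 0$ and $Q=(Q_1,\dots,Q_m)\in(R^\times)^m$. For $\iota\in R^\times$ put $\mathtt q(\iota)=2\,\frac{q\iota+(q\iota)^{-1}}{q+q^{-1}}$. The affine Hecke–Clifford algebra $\mathcal H_c(n)$ is the $R$-superalgebra with even generators $T_1,\dots,T_{n-1},X_1^{\pm1},\dots,X_n^{\pm1}$ and odd generators $C_1,\dots,C_n$, subject to $$T_i^2=\epsilon T_i+1,\quad T_iT_j=T_jT_i\ (|i-j|>1),\quad T_iT_{i+1}T_i=T_{i+1}T_iT_{i+1},$$ $$X_iX_j=X_jX_i,\quad X_iX_i^{-1}=X_i^{-1}X_i=1,\quad C_i^2=1,\quad C_iC_j=-C_jC_i\ (i\ne j),$$ $$T_iX_i=X_{i+1}T_i-\epsilon(X_{i+1}+C_iC_{i+1}X_i),\quad T_iX_{i+1}=X_iT_i+\epsilon(1-C_iC_{i+1})X_{i+1},\quad T_iX_j=X_jT_i\ (j\ne i,i+1),$$ $$T_iC_i=C_{i+1}T_i,\quad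 T_iC_{i+1}=C_iT_i-\epsilon(C_i-C_{i+1}),\quad T_iC_j=C_jT_i\ (j\ne i,i+1),$$ $$X_iC_i=C_iX_i^{-1},\quad X_iC_j=C_jX_i\ (i\ne j).$$ Let $$f^{(\mathsf 0)}_Q=\prod_{i=1}^m\bigl(X_1+X_1^{-1}-\mathtt q(Q_i)\bigr),\qquad f^{(\mathsf s)}_Q=(X_1-1)\prod_{i=1}^m\bigl(X_1+X_1^{-1}-\mathtt q(Q_i)\bigr).$$ For $f\in\{f^{(\mathsf 0)}_Q,f^{(\mathsf s)}_Q\}$ the cyclotomic Hecke–Clifford algebra $\mathcal H^f_c(n)$ is the quotient of $\mathcal H_c(n)$ by the two-sided ideal generated by $f$ (so $\mathcal H^f_c(0)=R$), and its level is $r=2m$ for $f=f^{(\mathsf 0)}_Q$ and $r=2m+1$ for $f=f^{(\mathsf s)}_Q$. For every $k\ge 1$ (and both choices of $f$), every $h\in\mathcal H^f_c(k)$ has a Mackey decomposition $$h\in \mathcal H^f_c(k-1)\,T_{k-1}\,\mathcal H^f_c(k-1)+\sum_{0\le j<r,\ a\in\{0,1\}}X_k^jC_k^a\,p_{j,a}(h),\qquad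 p_{j,a}(h)\in\mathcal H^f_c(k-1),$$ with unique coefficients $p_{j,a}(h)$ (the first summand is $0$ for $k=1$, and elements of $\mathcal H^f_c(k-1)$ are mapped to $\mathcal H^f_c(k)$ in the natural way). Put $\varepsilon_k(h)=p_{0,0}(h)$ (read as $0$ if $r=0$) and let $\tau_{r,n}=\varepsilon_1\circ\cdots\circ\varepsilon_n:\mathcal H^f_c(n)\to R$ be the standard Frobenius form. Let $A=A_{\bar 0}\oplus A_{\bar 1}$ be an $R$-superalgebra and $t:A\to R$ an $R$-linear map. $t$ is a symmetrizing form on $A$ if $A$ is a finitely generated projective $R$-module, $t(A_{\bar1})=0$, $t(xy)=t(yx)$ for all $x,y$, and $a\mapsto t(-\cdot a)$ is an isomorphism of $(A,A)$-superbimodules from $A$ to $\mathrm{Hom}_R(A,R)$ with the actions $(g\cdot a)(b)=g(ab)$, $(a\cdot g)(b)=g(ba)$. $t$ is a supersymmetrizing form on $A$ if $A$ is a finitely generated projective $R$-module, $t(A_{\bar1})=0$, $t(xy)=(-1)^{|x||y|}t(yx)$ for all homogeneous $x,y$, and $a\mapsto(-1)^{|a||-|}t(-\cdot a)$ is an isomorphism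 of $(A,A)$-superbimodules from $A$ to $\mathrm{Hom}_R(A,R)$ with the actions $(g\cdot a)(b)=g(ab)$, $(a\cdot g)(b)=(-1)^{|a||g|+|a||b|}g(ba)$. The superalgebra $A$ is called symmetric (supersymmetric) if it has a symmetrizing (supersymmetrizing) form. **Theorem.** (i) If $f=f^{(\mathsf 0)}_Q$, then $\mathcal H^f_c(n)$ is supersymmetric, with supersymmetrizing form $$t_{r,n}=\tau_{r,n}\bigl(-\cdot(X_1X_2\cdots X_n)^m\bigr).$$ (ii) If $f=f^{(\mathsf s)}_Q$, then the map $$t_{r,n}=\tau_{r,n}\bigl(-\cdot(X_1X_2\cdots X_n)^m(1+X_1)(1+X_2)\cdots(1+X_n)\bigr)$$ is $R$-linear and satisfies $t_{r,n}(xy)=t_{r,n}(yx)$ for all $x,y\in\mathcal H^f_c(n)$. If moreover $(1+X_1)(1+X_2)\cdots(1+X_n)$ is invertible in $\mathcal H^f_c(n)$, then $\mathcal H^f_c(n)$ is symmetric, with symmetrizing form $t_{r,n}$. -/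

import Mathlib

open scoped DirectSum

noncomputable section

/-! ## Superalgebras presented by homogeneous generators and relations -/

namespace SuperPres

variable {R : Type*} [CommRing R] {G : Type*}

/-- The part of parity `i` of the free algebra on generators `G` with parities `par`: the span of
the words whose letters have total parity `i`. -/
def freePart (R : Type*) [CommRing R] {G : Type*} (par : G → ZMod 2) (i : ZMod 2) :
    Submodule R (FreeAlgebra R G) :=
  Submodule.span R {x | ∃ l : List G, (l.map par).sum = i ∧ x = (l.map (FreeAlgebra.ι R)).prod}

/-- The part of parity `i` of the algebra presented by generators `G` and relations `rel`. -/
def part (par : G → ZMod 2) (rel : FreeAlgebra R G → FreeAlgebra R G → Prop) (i : ZMod 2) :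
    Submodule R (RingQuot rel) :=
  (freePart R par i).map (RingQuot.mkAlgHom R rel).toLinearMap

/-- Both sides of every relation are homogeneous of the same parity. -/
def Homogeneous (par : G → ZMod 2) (rel : FreeAlgebra R G → FreeAlgebra R G → Prop) : Prop :=
  ∀ a b, rel a b → ∃ i, a ∈ freePart R par i ∧ b ∈ freePart R par i

variable (par : G → ZMod 2) (rel : FreeAlgebra R G → FreeAlgebra R G → Prop)

theorem free_one : (1 : FreeAlgebra R G) ∈ freePart R par 0 :=
  Submodule.subset_span ⟨[], by simp⟩

theorem free_gen (g : G) : FreeAlgebra.ι R g ∈ freePart R par (par g) :=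
  Submodule.subset_span ⟨[g], by simp⟩

theorem free_mul {i j : ZMod 2} {x y : FreeAlgebra R G} (hx : x ∈ freePart R par i)
    (hy : y ∈ freePart R par j) : x * y ∈ freePart R par (i + j) := by
  have h : freePart R par i * freePart R par j ≤ freePart R par (i + j) := by
    unfold freePart
    rw [Submodule.span_mul_span, Submodule.span_le]
    rintro _ ⟨_, ⟨l, rfl, rfl⟩, _, ⟨l', rfl, rfl⟩, rfl⟩
    exact Submodule.subset_span ⟨l ++ l', by simp, by simp⟩
  exact h (Submodule.mul_mem_mul hx hy)

instance part_gradedMonoid : SetLike.GradedMonoid (part par rel) where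
  one_mem := ⟨1, free_one par, map_one (RingQuot.mkAlgHom R rel)⟩
  mul_mem := by
    rintro i j _ _ ⟨x, hx, rfl⟩ ⟨y, hy, rfl⟩
    exact ⟨x * y, free_mul par hx hy, map_mul (RingQuot.mkAlgHom R rel) _ _⟩

/-- The map from the free algebra to the direct sum of the two parts. -/
def toSum : FreeAlgebra R G →ₐ[R] ⨁ i, part par rel i :=
  FreeAlgebra.lift R fun g =>
    DirectSum.of (fun i => part par rel i) (par g)
      ⟨RingQuot.mkAlgHom R rel (FreeAlgebra.ι R g), ⟨_, free_gen par g, rfl⟩⟩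

theorem toSum_apply {i : ZMod 2} {x : FreeAlgebra R G} (hx : x ∈ freePart R par i) :
    toSum par rel x =
      DirectSum.lof R _ (fun i => part par rel i) i ⟨RingQuot.mkAlgHom R rel x, ⟨x, hx, rfl⟩⟩ := by
  induction hx using Submodule.span_induction with
  | mem x h =>
    obtain ⟨l, rfl, rfl⟩ := h
    induction l with
    | nil =>
      rw [DirectSum.lof_eq_of]
      simp only [List.map_nil, List.prod_nil, map_one]
      rfl
    | cons g l ih =>
      simp only [List.map_cons, List.prod_cons, map_mul, ih]
      rw [toSum, FreeAlgebra.lift_ι_apply, DirectSum.lof_eq_of, DirectSum.of_mul_of]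
      rfl
  | zero =>
    rw [map_zero, ← map_zero (DirectSum.lof R _ (fun i => part par rel i) i)]
    congr 1
    ext
    simp
  | add x y hx hy ihx ihy =>
    rw [map_add, ihx, ihy, ← map_add]
    congr 1
    ext
    simp
  | smul r x hx ih =>
    rw [map_smul, ih, ← map_smul]
    congr 1
    ext
    simp

/-- A presentation with homogeneous relations defines a superalgebra. -/
@[reducible] def gradedAlgebra (hrel : Homogeneous par rel) : GradedAlgebra (part par rel) :=
  GradedAlgebra.ofAlgHom (part par rel)
    (RingQuot.liftAlgHom R ⟨toSum par rel, fun a b hab => by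
      obtain ⟨i, ha, hb⟩ := hrel a b hab
      rw [toSum_apply par rel ha, toSum_apply par rel hb]
      congr 2
      exact RingQuot.mkAlgHom_rel R hab⟩)
    (by
      ext g
      simp [toSum])
    (by
      rintro i ⟨_, x, hx, rfl⟩
      change RingQuot.liftAlgHom R _ (RingQuot.mkAlgHom R rel x) = _
      rw [RingQuot.liftAlgHom_mkAlgHom_apply, toSum_apply par rel hx]
      rfl)

end SuperPres

/-! ## Symmetrizing and supersymmetrizing forms -/

namespace Superalgebra

variable {R : Type*} [CommRing R] {A : Type*} [Ring A] [Algebra R A]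

/-- The sign `(-1)^(i j)` for parities `i`, `j`. -/
def sgn (R : Type*) [CommRing R] (i j : ZMod 2) : R := (-1) ^ (i.val * j.val)

/-- The component of parity `i` of an element of a superalgebra. -/
def comp (𝒜 : ZMod 2 → Submodule R A) [GradedAlgebra 𝒜] (i : ZMod 2) : A →ₗ[R] A :=
  GradedAlgebra.proj 𝒜 i

/-- The linear forms of parity `i` (the ground ring being even): those that vanish on the
homogeneous elements of the other parity. -/
def dualPart (𝒜 : ZMod 2 → Submodule R A) (i : ZMod 2) : Submodule R (A →ₗ[R] R) where
  carrier := {f | ∀ j, j ≠ i → ∀ x ∈ 𝒜 j, f x = 0}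
  zero_mem' := by intro j _ x _; simp
  add_mem' := by
    intro f g hf hg j hj x hx
    simp [hf j hj x hx, hg j hj x hx]
  smul_mem' := by
    intro r f hf j hj x hx
    simp [hf j hj x hx]

/-- The right action `(f · a)(b) = f (a b)` on linear forms. -/
def rightAct (f : A →ₗ[R] R) (a : A) : A →ₗ[R] R := f ∘ₗ LinearMap.mulLeft R a

/-- The left action `(a · f)(b) = f (b a)` on linear forms. -/
def leftAct (a : A) (f : A →ₗ[R] R) : A →ₗ[R] R := f ∘ₗ LinearMap.mulRight R a

/-- The signed left action on linear forms: `(a · f)(b) = (-1)^(|a||f| + |a||b|) f (b a)` for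
homogeneous `a`, `f`, `b`, extended linearly; the component of parity `j` of `f` is
`f ∘ comp 𝒜 j`. -/
def superLeftAct (𝒜 : ZMod 2 → Submodule R A) [GradedAlgebra 𝒜] (a : A) (f : A →ₗ[R] R) :
    A →ₗ[R] R :=
  ∑ i : ZMod 2, ∑ j : ZMod 2, ∑ k : ZMod 2, (sgn R i j * sgn R i k) •
    ((f ∘ₗ comp 𝒜 j) ∘ₗ LinearMap.mulRight R (comp 𝒜 i a) ∘ₗ comp 𝒜 k)

/-- The map `a ↦ t (- · a)`. -/
def hat (t : A →ₗ[R] R) : A →ₗ[R] (A →ₗ[R] R) := (LinearMap.mul R A).flip.compr₂ t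

/-- The map `a ↦ (-1)^(|a||-|) t (- · a)`, defined for homogeneous elements and extended
linearly. -/
def superHat (𝒜 : ZMod 2 → Submodule R A) [GradedAlgebra 𝒜] (t : A →ₗ[R] R) :
    A →ₗ[R] (A →ₗ[R] R) :=
  ∑ i : ZMod 2, ∑ j : ZMod 2, sgn R i j • (hat t).compl₁₂ (comp 𝒜 i) (comp 𝒜 j)

/-- `t` is a symmetrizing form on the superalgebra `A`, and `A` is thereby a symmetric
superalgebra: `A` is finitely generated projective, `t` vanishes on odd elements and is a trace
form, and `hat t` is an isomorphism of superbimodules from `A` to its dual. -/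
structure IsSymmetrizingForm (𝒜 : ZMod 2 → Submodule R A) [GradedAlgebra 𝒜] (t : A →ₗ[R] R) :
    Prop where
  finite : Module.Finite R A
  projective : Module.Projective R A
  odd : ∀ x ∈ 𝒜 1, t x = 0
  symm : ∀ x y, t (x * y) = t (y * x)
  hat_parity : ∀ i, ∀ a ∈ 𝒜 i, hat t a ∈ dualPart 𝒜 i
  hat_left : ∀ a' a, hat t (a' * a) = leftAct a' (hat t a)
  hat_right : ∀ a a', hat t (a * a') = rightAct (hat t a) a'
  hat_bijective : Function.Bijective (hat t)

/-- `t` is a supersymmetrizing form on the superalgebra `A`, and `A` is thereby a supersymmetric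
superalgebra: `A` is finitely generated projective, `t` vanishes on odd elements and satisfies
`t (x y) = (-1)^(|x||y|) t (y x)`, and `superHat t` is an isomorphism of superbimodules from `A`
to its dual with the signed left action. -/
structure IsSupersymmetrizingForm (𝒜 : ZMod 2 → Submodule R A) [GradedAlgebra 𝒜]
    (t : A →ₗ[R] R) : Prop where
  finite : Module.Finite R A
  projective : Module.Projective R A
  odd : ∀ x ∈ 𝒜 1, t x = 0
  supersymm : ∀ i j, ∀ x ∈ 𝒜 i, ∀ y ∈ 𝒜 j, t (x * y) = sgn R i j * t (y * x)
  hat_parity : ∀ i, ∀ a ∈ 𝒜 i, superHat 𝒜 t a ∈ dualPart 𝒜 i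
  hat_left : ∀ a' a, superHat 𝒜 t (a' * a) = superLeftAct 𝒜 a' (superHat 𝒜 t a)
  hat_right : ∀ a a', superHat 𝒜 t (a * a') = rightAct (superHat 𝒜 t a) a'
  hat_bijective : Function.Bijective (superHat 𝒜 t)

end Superalgebra

/-! ## Cyclotomic Hecke-Clifford algebras -/

namespace HeckeClifford

/-- The two types of the defining polynomial: `f^(0)` and `f^(s)`. -/
inductive Kind
  | zero
  | s

/-- The level, i.e. the degree of the defining polynomial with `m` parameters. -/
def level : Kind → ℕ → ℕ
  | Kind.zero, m => 2 * m
  | Kind.s, m => 2 * m + 1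

/-- The generators, indexed from `0`: `T i` (for `0 ≤ i < n - 1`), and `X j`, its inverse, and
`C j` (for `0 ≤ j < n`). -/
inductive Gen (n : ℕ)
  | T (i : ℕ) (h : i + 1 < n)
  | X (j : Fin n)
  | Xinv (j : Fin n)
  | C (j : Fin n)

/-- The parity of a generator: the `C j` are odd, the others even. -/
def Gen.parity {n : ℕ} : Gen n → ZMod 2
  | Gen.C _ => 1
  | _ => 0

variable {R : Type*} [CommRing R]

/-- `ε = q - q⁻¹`. -/
def eps (q : Rˣ) : R := (q : R) - ((q⁻¹ : Rˣ) : R)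

/-- `2 (q ι + (q ι)⁻¹) / (q + q⁻¹)`, for `q + q⁻¹` a unit. -/
def qval (q ι : Rˣ) : R :=
  2 * (((q * ι : Rˣ) : R) + (((q * ι)⁻¹ : Rˣ) : R)) * Ring.inverse ((q : R) + ((q⁻¹ : Rˣ) : R))

/-- The defining polynomial, evaluated at an element `x` of an algebra and its inverse `x'`:
`∏ (x + x' - qval q (Q i))`, with the further factor `x - 1` in front for the type `s`. -/
def cycPoly {A : Type*} [Ring A] [Algebra R A] (q : Rˣ) (κ : Kind) {m : ℕ} (Q : Fin m → Rˣ)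
    (x x' : A) : A :=
  (match κ with
    | Kind.zero => 1
    | Kind.s => x - 1) *
  (List.ofFn fun i => x + x' - algebraMap R A (qval q (Q i))).prod

/-- The defining relations: those of the affine Hecke-Clifford algebra, and, in `cyc`, the
vanishing of the defining polynomial at the first `X`. -/
inductive Rel (q : Rˣ) (κ : Kind) {m : ℕ} (Q : Fin m → Rˣ) (n : ℕ) :
    FreeAlgebra R (Gen n) → FreeAlgebra R (Gen n) → Prop
  | T_sq (i : ℕ) (h : i + 1 < n) :
      Rel q κ Q n (FreeAlgebra.ι R (Gen.T i h) * FreeAlgebra.ι R (Gen.T i h))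
        (eps q • FreeAlgebra.ι R (Gen.T i h) + 1)
  | T_comm (i j : ℕ) (hi : i + 1 < n) (hj : j + 1 < n) (hij : i + 1 < j) :
      Rel q κ Q n (FreeAlgebra.ι R (Gen.T i hi) * FreeAlgebra.ι R (Gen.T j hj))
        (FreeAlgebra.ι R (Gen.T j hj) * FreeAlgebra.ι R (Gen.T i hi))
  | T_braid (i : ℕ) (h : i + 1 < n) (h' : i + 1 + 1 < n) :
      Rel q κ Q n
        (FreeAlgebra.ι R (Gen.T i h) * FreeAlgebra.ι R (Gen.T (i + 1) h') *
          FreeAlgebra.ι R (Gen.T i h))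
        (FreeAlgebra.ι R (Gen.T (i + 1) h') * FreeAlgebra.ι R (Gen.T i h) *
          FreeAlgebra.ι R (Gen.T (i + 1) h'))
  | X_comm (i j : Fin n) :
      Rel q κ Q n (FreeAlgebra.ι R (Gen.X i) * FreeAlgebra.ι R (Gen.X j))
        (FreeAlgebra.ι R (Gen.X j) * FreeAlgebra.ι R (Gen.X i))
  | X_mul_inv (i : Fin n) :
      Rel q κ Q n (FreeAlgebra.ι R (Gen.X i) * FreeAlgebra.ι R (Gen.Xinv i)) 1
  | X_inv_mul (i : Fin n) :
      Rel q κ Q n (FreeAlgebra.ι R (Gen.Xinv i) * FreeAlgebra.ι R (Gen.X i)) 1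
  | C_sq (i : Fin n) :
      Rel q κ Q n (FreeAlgebra.ι R (Gen.C i) * FreeAlgebra.ι R (Gen.C i)) 1
  | C_anti (i j : Fin n) (hij : i ≠ j) :
      Rel q κ Q n (FreeAlgebra.ι R (Gen.C i) * FreeAlgebra.ι R (Gen.C j))
        (-(FreeAlgebra.ι R (Gen.C j) * FreeAlgebra.ι R (Gen.C i)))
  | T_X (i : ℕ) (h : i + 1 < n) :
      Rel q κ Q n (FreeAlgebra.ι R (Gen.T i h) * FreeAlgebra.ι R (Gen.X ⟨i, by omega⟩))
        (FreeAlgebra.ι R (Gen.X ⟨i + 1, h⟩) * FreeAlgebra.ι R (Gen.T i h) -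
          eps q • (FreeAlgebra.ι R (Gen.X ⟨i + 1, h⟩) +
            FreeAlgebra.ι R (Gen.C ⟨i, by omega⟩) * FreeAlgebra.ι R (Gen.C ⟨i + 1, h⟩) *
              FreeAlgebra.ι R (Gen.X ⟨i, by omega⟩)))
  | T_X_succ (i : ℕ) (h : i + 1 < n) :
      Rel q κ Q n (FreeAlgebra.ι R (Gen.T i h) * FreeAlgebra.ι R (Gen.X ⟨i + 1, h⟩))
        (FreeAlgebra.ι R (Gen.X ⟨i, by omega⟩) * FreeAlgebra.ι R (Gen.T i h) +
          eps q • ((1 - FreeAlgebra.ι R (Gen.C ⟨i, by omega⟩) *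
              FreeAlgebra.ι R (Gen.C ⟨i + 1, h⟩)) * FreeAlgebra.ι R (Gen.X ⟨i + 1, h⟩)))
  | T_X_comm (i : ℕ) (h : i + 1 < n) (j : Fin n) (hj : (j : ℕ) ≠ i) (hj' : (j : ℕ) ≠ i + 1) :
      Rel q κ Q n (FreeAlgebra.ι R (Gen.T i h) * FreeAlgebra.ι R (Gen.X j))
        (FreeAlgebra.ι R (Gen.X j) * FreeAlgebra.ι R (Gen.T i h))
  | T_C (i : ℕ) (h : i + 1 < n) :
      Rel q κ Q n (FreeAlgebra.ι R (Gen.T i h) * FreeAlgebra.ι R (Gen.C ⟨i, by omega⟩))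
        (FreeAlgebra.ι R (Gen.C ⟨i + 1, h⟩) * FreeAlgebra.ι R (Gen.T i h))
  | T_C_succ (i : ℕ) (h : i + 1 < n) :
      Rel q κ Q n (FreeAlgebra.ι R (Gen.T i h) * FreeAlgebra.ι R (Gen.C ⟨i + 1, h⟩))
        (FreeAlgebra.ι R (Gen.C ⟨i, by omega⟩) * FreeAlgebra.ι R (Gen.T i h) -
          eps q • (FreeAlgebra.ι R (Gen.C ⟨i, by omega⟩) - FreeAlgebra.ι R (Gen.C ⟨i + 1, h⟩)))
  | T_C_comm (i : ℕ) (h : i + 1 < n) (j : Fin n) (hj : (j : ℕ) ≠ i) (hj' : (j : ℕ) ≠ i + 1) :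
      Rel q κ Q n (FreeAlgebra.ι R (Gen.T i h) * FreeAlgebra.ι R (Gen.C j))
        (FreeAlgebra.ι R (Gen.C j) * FreeAlgebra.ι R (Gen.T i h))
  | X_C (i : Fin n) :
      Rel q κ Q n (FreeAlgebra.ι R (Gen.X i) * FreeAlgebra.ι R (Gen.C i))
        (FreeAlgebra.ι R (Gen.C i) * FreeAlgebra.ι R (Gen.Xinv i))
  | X_C_comm (i j : Fin n) (hij : i ≠ j) :
      Rel q κ Q n (FreeAlgebra.ι R (Gen.X i) * FreeAlgebra.ι R (Gen.C j))
        (FreeAlgebra.ι R (Gen.C j) * FreeAlgebra.ι R (Gen.X i))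
  | cyc (h : 0 < n) :
      Rel q κ Q n (cycPoly q κ Q (FreeAlgebra.ι R (Gen.X ⟨0, h⟩))
        (FreeAlgebra.ι R (Gen.Xinv ⟨0, h⟩))) 0

/-- The cyclotomic Hecke-Clifford algebra: the quotient of the affine Hecke-Clifford algebra by
the two-sided ideal generated by the defining polynomial at the first `X`. For `n = 0` it is the
ground ring. -/
abbrev Cyc (q : Rˣ) (κ : Kind) {m : ℕ} (Q : Fin m → Rˣ) (n : ℕ) : Type _ :=
  RingQuot (Rel q κ Q n)

variable (q : Rˣ) (κ : Kind) {m : ℕ} (Q : Fin m → Rˣ)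

/-- The image of a generator in the cyclotomic Hecke-Clifford algebra. -/
def gen {n : ℕ} (g : Gen n) : Cyc q κ Q n :=
  RingQuot.mkAlgHom R (Rel q κ Q n) (FreeAlgebra.ι R g)

/-- The parts of the cyclotomic Hecke-Clifford algebra as a superalgebra: the part of parity `i`
is spanned by the products of generators in which the number of odd generators is `i` mod `2`. -/
abbrev parityPart (n : ℕ) : ZMod 2 → Submodule R (Cyc q κ Q n) :=
  SuperPres.part Gen.parity (Rel q κ Q n)

theorem rel_homogeneous (n : ℕ) : SuperPres.Homogeneous Gen.parity (Rel q κ Q n) := by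
  have hT : ∀ i h, FreeAlgebra.ι R (Gen.T (n := n) i h) ∈ SuperPres.freePart R Gen.parity 0 :=
    fun i h => SuperPres.free_gen Gen.parity (Gen.T i h)
  have hX : ∀ j, FreeAlgebra.ι R (Gen.X (n := n) j) ∈ SuperPres.freePart R Gen.parity 0 :=
    fun j => SuperPres.free_gen Gen.parity (Gen.X j)
  have hX' : ∀ j, FreeAlgebra.ι R (Gen.Xinv (n := n) j) ∈ SuperPres.freePart R Gen.parity 0 :=
    fun j => SuperPres.free_gen Gen.parity (Gen.Xinv j)
  have hC : ∀ j, FreeAlgebra.ι R (Gen.C (n := n) j) ∈ SuperPres.freePart R Gen.parity 1 :=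
    fun j => SuperPres.free_gen Gen.parity (Gen.C j)
  have h1 : (1 : FreeAlgebra R (Gen n)) ∈ SuperPres.freePart R Gen.parity 0 :=
    SuperPres.free_one Gen.parity
  have m00 : ∀ {x y : FreeAlgebra R (Gen n)}, x ∈ SuperPres.freePart R Gen.parity 0 →
      y ∈ SuperPres.freePart R Gen.parity 0 → x * y ∈ SuperPres.freePart R Gen.parity 0 :=
    fun hx hy => (show (0 + 0 : ZMod 2) = 0 by decide) ▸ SuperPres.free_mul Gen.parity hx hy
  have m01 : ∀ {x y : FreeAlgebra R (Gen n)}, x ∈ SuperPres.freePart R Gen.parity 0 →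
      y ∈ SuperPres.freePart R Gen.parity 1 → x * y ∈ SuperPres.freePart R Gen.parity 1 :=
    fun hx hy => (show (0 + 1 : ZMod 2) = 1 by decide) ▸ SuperPres.free_mul Gen.parity hx hy
  have m10 : ∀ {x y : FreeAlgebra R (Gen n)}, x ∈ SuperPres.freePart R Gen.parity 1 →
      y ∈ SuperPres.freePart R Gen.parity 0 → x * y ∈ SuperPres.freePart R Gen.parity 1 :=
    fun hx hy => (show (1 + 0 : ZMod 2) = 1 by decide) ▸ SuperPres.free_mul Gen.parity hx hy
  have m11 : ∀ {x y : FreeAlgebra R (Gen n)}, x ∈ SuperPres.freePart R Gen.parity 1 →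
      y ∈ SuperPres.freePart R Gen.parity 1 → x * y ∈ SuperPres.freePart R Gen.parity 0 :=
    fun hx hy => (show (1 + 1 : ZMod 2) = 0 by decide) ▸ SuperPres.free_mul Gen.parity hx hy
  intro a b hab
  cases hab with
  | T_sq i h => exact ⟨0, m00 (hT _ _) (hT _ _), add_mem (Submodule.smul_mem _ _ (hT _ _)) h1⟩
  | T_comm i j hi hj hij => exact ⟨0, m00 (hT _ _) (hT _ _), m00 (hT _ _) (hT _ _)⟩
  | T_braid i h h' =>
    exact ⟨0, m00 (m00 (hT _ _) (hT _ _)) (hT _ _), m00 (m00 (hT _ _) (hT _ _)) (hT _ _)⟩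
  | X_comm i j => exact ⟨0, m00 (hX _) (hX _), m00 (hX _) (hX _)⟩
  | X_mul_inv i => exact ⟨0, m00 (hX _) (hX' _), h1⟩
  | X_inv_mul i => exact ⟨0, m00 (hX' _) (hX _), h1⟩
  | C_sq i => exact ⟨0, m11 (hC _) (hC _), h1⟩
  | C_anti i j hij => exact ⟨0, m11 (hC _) (hC _), neg_mem (m11 (hC _) (hC _))⟩
  | T_X i h =>
    exact ⟨0, m00 (hT _ _) (hX _), sub_mem (m00 (hX _) (hT _ _)) (Submodule.smul_mem _ _
      (add_mem (hX _) (m00 (m11 (hC _) (hC _)) (hX _))))⟩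
  | T_X_succ i h =>
    exact ⟨0, m00 (hT _ _) (hX _), add_mem (m00 (hX _) (hT _ _)) (Submodule.smul_mem _ _
      (m00 (sub_mem h1 (m11 (hC _) (hC _))) (hX _)))⟩
  | T_X_comm i h j hj hj' => exact ⟨0, m00 (hT _ _) (hX _), m00 (hX _) (hT _ _)⟩
  | T_C i h => exact ⟨1, m01 (hT _ _) (hC _), m10 (hC _) (hT _ _)⟩
  | T_C_succ i h =>
    exact ⟨1, m01 (hT _ _) (hC _), sub_mem (m10 (hC _) (hT _ _)) (Submodule.smul_mem _ _
      (sub_mem (hC _) (hC _)))⟩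
  | T_C_comm i h j hj hj' => exact ⟨1, m01 (hT _ _) (hC _), m10 (hC _) (hT _ _)⟩
  | X_C i => exact ⟨1, m01 (hX _) (hC _), m10 (hC _) (hX' _)⟩
  | X_C_comm i j hij => exact ⟨1, m01 (hX _) (hC _), m10 (hC _) (hX _)⟩
  | cyc h =>
    refine ⟨0, ?_, zero_mem _⟩
    unfold cycPoly
    refine m00 ?_ ?_
    · cases κ
      · exact h1
      · exact sub_mem (hX _) h1
    · have key : ∀ l : List (FreeAlgebra R (Gen n)),
          (∀ x ∈ l, x ∈ SuperPres.freePart R Gen.parity 0) →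
          l.prod ∈ SuperPres.freePart R Gen.parity 0 := by
        intro l
        induction l with
        | nil => intro _; simpa using h1
        | cons x l ih =>
          intro hl
          rw [List.prod_cons]
          exact m00 (hl x (by simp)) (ih fun y hy => hl y (by simp [hy]))
      apply key
      intro x hx
      obtain ⟨i, rfl⟩ := (List.mem_ofFn' _ _).1 hx
      refine sub_mem (add_mem (hX _) (hX' _)) ?_
      rw [Algebra.algebraMap_eq_smul_one]
      exact Submodule.smul_mem _ _ h1

/-- The cyclotomic Hecke-Clifford algebra is a superalgebra. -/
instance superalgebra (n : ℕ) : GradedAlgebra (parityPart q κ Q n) :=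
  SuperPres.gradedAlgebra Gen.parity (Rel q κ Q n) (rel_homogeneous q κ Q n)

/-- The generators for `n` as generators for `n + 1`. -/
def Gen.up {n : ℕ} : Gen n → Gen (n + 1)
  | Gen.T i h => Gen.T i (Nat.lt_succ_of_lt h)
  | Gen.X j => Gen.X j.castSucc
  | Gen.Xinv j => Gen.Xinv j.castSucc
  | Gen.C j => Gen.C j.castSucc

theorem rel_up {n : ℕ} {a b : FreeAlgebra R (Gen n)} (h : Rel q κ Q n a b) :
    Rel q κ Q (n + 1) (FreeAlgebra.lift R (fun g => FreeAlgebra.ι R (Gen.up g)) a)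
      (FreeAlgebra.lift R (fun g => FreeAlgebra.ι R (Gen.up g)) b) := by
  cases h with
  | T_sq i h => simpa [Gen.up] using Rel.T_sq i (Nat.lt_succ_of_lt h)
  | T_comm i j hi hj hij => simpa [Gen.up] using Rel.T_comm i j _ _ hij
  | T_braid i h h' => simpa [Gen.up] using Rel.T_braid i _ _
  | X_comm i j => simpa [Gen.up] using Rel.X_comm i.castSucc j.castSucc
  | X_mul_inv i => simpa [Gen.up] using Rel.X_mul_inv i.castSucc
  | X_inv_mul i => simpa [Gen.up] using Rel.X_inv_mul i.castSucc
  | C_sq i => simpa [Gen.up] using Rel.C_sq i.castSucc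
  | C_anti i j hij =>
    simpa [Gen.up] using Rel.C_anti i.castSucc j.castSucc (by simpa using hij)
  | T_X i h =>
    simpa [Gen.up] using Rel.T_X (q := q) (κ := κ) (Q := Q) i (Nat.lt_succ_of_lt h)
  | T_X_succ i h => simpa [Gen.up] using Rel.T_X_succ i (Nat.lt_succ_of_lt h)
  | T_X_comm i h j hj hj' =>
    simpa [Gen.up] using Rel.T_X_comm i (Nat.lt_succ_of_lt h) j.castSucc hj hj'
  | T_C i h => simpa [Gen.up] using Rel.T_C i (Nat.lt_succ_of_lt h)
  | T_C_succ i h => simpa [Gen.up] using Rel.T_C_succ i (Nat.lt_succ_of_lt h)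
  | T_C_comm i h j hj hj' =>
    simpa [Gen.up] using Rel.T_C_comm i (Nat.lt_succ_of_lt h) j.castSucc hj hj'
  | X_C i => simpa [Gen.up] using Rel.X_C i.castSucc
  | X_C_comm i j hij =>
    simpa [Gen.up] using Rel.X_C_comm i.castSucc j.castSucc (by simpa using hij)
  | cyc h =>
    have := Rel.cyc (q := q) (κ := κ) (Q := Q) (n := n + 1) (Nat.succ_pos n)
    rw [map_zero]
    convert this using 1
    unfold cycPoly
    rw [map_mul, map_list_prod, List.map_ofFn]
    cases κ <;> simp [Gen.up, Function.comp_def]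

/-- The natural map from the algebra for `n` to the algebra for `n + 1`. -/
def incl (n : ℕ) : Cyc q κ Q n →ₐ[R] Cyc q κ Q (n + 1) :=
  RingQuot.liftAlgHom R
    ⟨(RingQuot.mkAlgHom R (Rel q κ Q (n + 1))).comp
      (FreeAlgebra.lift R fun g => FreeAlgebra.ι R (Gen.up g)),
      fun _ _ h => RingQuot.mkAlgHom_rel R (rel_up q κ Q h)⟩

/-- The span of the elements `x T y` with `x`, `y` from the algebra for `n` and `T` the last of
the generators `T` of the algebra for `n + 1`; it is `0` if there is none, i.e. if `n = 0`. -/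
def mackeyT (n : ℕ) : Submodule R (Cyc q κ Q (n + 1)) :=
  Submodule.span R {z | ∃ (i : ℕ) (hi : i + 1 = n) (x y : Cyc q κ Q n),
    z = incl q κ Q n x * gen q κ Q (Gen.T i (by omega)) * incl q κ Q n y}

/-- `p` is the family of coefficients in the Mackey decomposition of `h`:
`h = (element of the span of the x T y) + ∑ X^k C^a p k a`, where `T`, `X`, `C` are the last
generators, `0 ≤ k < r` for the level `r`, and `a` is `0` or `1`. -/
def IsMackey {n : ℕ} (h : Cyc q κ Q (n + 1)) (p : Fin (level κ m) → Fin 2 → Cyc q κ Q n) : Prop :=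
  h - ∑ k : Fin (level κ m), ∑ a : Fin 2, gen q κ Q (Gen.X (Fin.last n)) ^ (k : ℕ) *
    gen q κ Q (Gen.C (Fin.last n)) ^ (a : ℕ) * incl q κ Q n (p k a) ∈ mackeyT q κ Q n

/-- The coefficients in the Mackey decomposition. -/
def mackeyCoeff {n : ℕ} (h : Cyc q κ Q (n + 1)) : Fin (level κ m) → Fin 2 → Cyc q κ Q n :=
  Classical.epsilon (IsMackey q κ Q h)

/-- The coefficient of `X^0 C^0` in the Mackey decomposition. (At level `0` the algebra for
`n + 1` is the zero ring and there are no coefficients.) -/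
def mackeyProj {n : ℕ} (h : Cyc q κ Q (n + 1)) : Cyc q κ Q n :=
  if hr : 0 < level κ m then mackeyCoeff q κ Q h ⟨0, hr⟩ 0 else 0

/-- The identification of the algebra for `n = 0`, which has no generators, with the ground
ring. -/
def base : Cyc q κ Q 0 →ₐ[R] R :=
  RingQuot.liftAlgHom R
    ⟨FreeAlgebra.lift R fun g : Gen 0 => match g with
      | Gen.T _ h => absurd h (by omega)
      | Gen.X j => j.elim0
      | Gen.Xinv j => j.elim0
      | Gen.C j => j.elim0, fun _ _ h => by
      cases h <;> first | exact Fin.elim0 ‹_› | omega⟩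

/-- The standard Frobenius form: the composition of the projections from the algebra for `n` down
to the ground ring. -/
def tau : (n : ℕ) → Cyc q κ Q n → R
  | 0, h => base q κ Q h
  | n + 1, h => tau n (mackeyProj q κ Q h)

/-- The product `X_1 X_2 ⋯ X_n`. -/
def prodX (n : ℕ) : Cyc q κ Q n := (List.ofFn fun j : Fin n => gen q κ Q (Gen.X j)).prod

/-- The product `(1 + X_1)(1 + X_2) ⋯ (1 + X_n)`. -/
def prodOneAddX (n : ℕ) : Cyc q κ Q n :=
  (List.ofFn fun j : Fin n => 1 + gen q κ Q (Gen.X j)).prod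

end HeckeClifford

end

open HeckeClifford Superalgebra

/-!
The relations of the algebra simplify when `X j` is replaced by `Y j = C j * X j`, which is an odd
involution: `C` and `Y` become two anticommuting Clifford families, permuted by the Hecke
generators up to the correction for `C (i + 1)`. In this presentation (`HCSystem`) everything is
determined by the `T i`, the `C j` and `Y 0`, and the cyclotomic relation says that `P` kills
`X 0`, where `P` is palindromic of degree the level `r` (`isPalindromic_defPoly`).

*The projection.* Write `H n` for the algebra of rank `n`. Over `H n` stands the tower: `n + 1`
copies of the free right module on the words `x ^ k` and `c * x ^ k` with `k < r`, the copy `j`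
being a model of the elements `w * T j * ⋯ * T (n - 1) * h` for words `w` in the strand `j`. The
formulas by which the generators should act define operators on it, and these satisfy the
relations of rank `n + 1` (`Tower.seed`, `Tower.system`). Most relations are immediate. The braid
relation is a relation of the operator `D` that moves a `T` past a word (`Window.D_braid`,
`Tower.opT_braid`); the anticommutation of `Y 0` and `Y 1` comes from the relations of the
commutator `delta` of `D` with the last `y`, in which the polynomial `P` enters
(`Window.delta_mul_delta`, `Tower.opY_conj`). So `H (n + 1)` acts on the tower, and the coefficient
of the empty word in the image of the empty word is a projection `π : H (n + 1) → H n`, linear over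
`H n` on both sides, which kills `x T y` and picks out the coefficient of `1` on `X ^ k`, `C X ^ k`
(`TowerRep.step`). That the injectivity of `H n → H (n + 1)` and the linear independence of the
words need no separate proof is the advantage of this construction.

*Its symmetry.* On all integral powers of the last `X` the projection satisfies
`π (C X ^ k) = 0` and `π (X ^ (r + k)) = s' π (X ^ (-k))`, with `s' = -1` for type `0` and `s' = 1`
for type `s`, and it does not distinguish left and right multiplication by `X` (`Regular`). In rank
one this is the symmetry of the recursion with coefficients `P` (`regular_base`). It passes from
one rank to the next (`Regular.succ`) because the values `π (T X ^ k)` and `π (T x T X ^ k)` obey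
recursions that reflect the ones of the lower rank; on the way comes the Mackey formula
`π (T x T) = π x` (`π_T_ι_T`), in which the right-hand side is the projection one rank below. The
consequence for the last `C` is `π (C x C) = s' σ (π (X ^ r x))`, where `σ` is the parity
automorphism (`Regular.frobenius`).

*Mackey decompositions and dual bases.* The functionals `π (X ^ (r - j) * ·)` are triangular on the
words `X ^ k`, and `π (X ^ j C * ·)` are triangular on the words `X ^ k C`; made dual, they give the
coefficients of the Mackey decomposition (`DualWords.expand`, `DualWords.unique`), with `π` itself
as the first one. For the remaining part, the words `x T y`, the Mackey formula turns a dual basis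
of the rank below into a dual one (`HasDualBasis.succ`). Hence `τ`, the composite of the
projections, has a dual basis at each rank (`tauLin_hasFormBasis`).

*The trace property.* Correcting `π` by `X ^ m`, or by `X ^ m (1 + X)` for type `s`, absorbs the
factor `X ^ r` above: the corrected projection turns `x C` into `s' σ (C x)` (`proj_mul_C`). With
`trace_T`, which is again the Mackey formula, the composite `t` of the corrected projections
satisfies `t (x y) = t (σ y x)` for type `0` and `t (x y) = t (y x)` for type `s`
(`cycForm_isTrace`). If the correction is by an invertible element, as it always is for type `0`,
the dual basis for `τ` gives one for `t`, and a form with this trace property and a dual basis is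
(super)symmetrizing
(`Superalgebra.isSymmetrizingForm`, `Superalgebra.isSupersymmetrizingForm`). At level `0` the
algebras of positive rank vanish and there is nothing to prove.
-/

noncomputable section

open scoped Polynomial

/-! ### Systems of generators -/

namespace HeckeClifford

section Systems

variable {R : Type*} [CommRing R] {B : Type*} [Ring B] [Algebra R B]

/-- Elements of an algebra `B` that satisfy the relations of the cyclotomic Hecke-Clifford algebra
of rank `n`, in the presentation by the Hecke generators `T i` and two families of Clifford
generators, `C j` and `Y j = C j * X j`. The parameter `e` is that of the quadratic relation and
`P` is the defining polynomial, which kills `X 0 = C 0 * Y 0`. The families are indexed by `ℕ`;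
only the indices that make sense in rank `n` are constrained. -/
structure HCSystem (e : R) (P : R[X]) (n : ℕ) (B : Type*) [Ring B] [Algebra R B] where
  T : ℕ → B
  C : ℕ → B
  Y : ℕ → B
  T_sq : ∀ i, i + 1 < n → T i * T i = e • T i + 1
  T_comm : ∀ i j, i + 1 < n → j + 1 < n → i + 1 < j → T i * T j = T j * T i
  T_braid : ∀ i, i + 2 < n → T i * T (i + 1) * T i = T (i + 1) * T i * T (i + 1)
  C_sq : ∀ j, j < n → C j * C j = 1
  C_anti : ∀ i j, i < n → j < n → i ≠ j → C i * C j = -(C j * C i)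
  T_C : ∀ i, i + 1 < n → T i * C i = C (i + 1) * T i
  T_C_comm : ∀ i j, i + 1 < n → j < n → j ≠ i → j ≠ i + 1 → T i * C j = C j * T i
  Y_sq : ∀ j, j < n → Y j * Y j = 1
  Y_anti : ∀ i j, i < n → j < n → i ≠ j → Y i * Y j = -(Y j * Y i)
  C_Y_anti : ∀ i j, i < n → j < n → i ≠ j → C i * Y j = -(Y j * C i)
  T_Y : ∀ i, i + 1 < n → T i * Y (i + 1) = Y i * T i
  T_Y_comm : ∀ i j, i + 1 < n → j < n → j ≠ i → j ≠ i + 1 → T i * Y j = Y j * T i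
  cyc : 0 < n → Polynomial.aeval (C 0 * Y 0) P = 0

/-- The part of an `HCSystem` that determines the rest: of the family `Y` only the first member
is given. -/
structure HCSeed (e : R) (P : R[X]) (n : ℕ) (B : Type*) [Ring B] [Algebra R B] where
  T : ℕ → B
  C : ℕ → B
  y : B
  T_sq : ∀ i, i + 1 < n → T i * T i = e • T i + 1
  T_comm : ∀ i j, i + 1 < n → j + 1 < n → i + 1 < j → T i * T j = T j * T i
  T_braid : ∀ i, i + 2 < n → T i * T (i + 1) * T i = T (i + 1) * T i * T (i + 1)
  C_sq : ∀ j, j < n → C j * C j = 1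
  C_anti : ∀ i j, i < n → j < n → i ≠ j → C i * C j = -(C j * C i)
  T_C : ∀ i, i + 1 < n → T i * C i = C (i + 1) * T i
  T_C_comm : ∀ i j, i + 1 < n → j < n → j ≠ i → j ≠ i + 1 → T i * C j = C j * T i
  y_sq : 0 < n → y * y = 1
  C_y_anti : ∀ i, 0 < i → i < n → C i * y = -(y * C i)
  T_y_comm : ∀ i, 0 < i → i + 1 < n → T i * y = y * T i
  y_anti : 1 < n → y * ((T 0 - e • 1) * y * T 0) = -(((T 0 - e • 1) * y * T 0) * y)
  cyc : 0 < n → Polynomial.aeval (C 0 * y) P = 0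

namespace HCSeed

variable {e : R} {P : R[X]} {n : ℕ} (d : HCSeed e P n B)

/-- The inverse of `T i`. -/
def Tinv (i : ℕ) : B := d.T i - e • 1

/-- The family `Y`, each member of which is conjugate to the one before. -/
def Y : ℕ → B
  | 0 => d.y
  | j + 1 => d.Tinv j * Y j * d.T j

theorem T_mul_Tinv {i : ℕ} (h : i + 1 < n) : d.T i * d.Tinv i = 1 := by
  rw [Tinv, mul_sub, d.T_sq i h, mul_smul_comm, mul_one]; abel

theorem Tinv_mul_T {i : ℕ} (h : i + 1 < n) : d.Tinv i * d.T i = 1 := by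
  rw [Tinv, sub_mul, d.T_sq i h, smul_mul_assoc, one_mul]; abel

theorem Tinv_commute {i : ℕ} {z : B} (h : Commute (d.T i) z) : Commute (d.Tinv i) z :=
  h.sub_left ((Commute.one_left z).smul_left e)

theorem T_Y {i : ℕ} (h : i + 1 < n) : d.T i * d.Y (i + 1) = d.Y i * d.T i := by
  rw [Y, ← mul_assoc, ← mul_assoc, d.T_mul_Tinv h, one_mul]

theorem T_comm' {i j : ℕ} (hi : i + 1 < n) (hj : j + 1 < n) (h : i + 1 < j ∨ j + 1 < i) :
    Commute (d.T i) (d.T j) := by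
  rcases h with h | h
  · exact d.T_comm i j hi hj h
  · exact (d.T_comm j i hj hi h).symm

theorem T_Y_commute_of_lt {i j : ℕ} (hij : i < j) (hj : j + 1 < n) :
    Commute (d.T j) (d.Y i) := by
  induction i with
  | zero => exact d.T_y_comm j hij hj
  | succ i ih =>
    have h1 : Commute (d.T j) (d.T i) := d.T_comm' hj (by omega) (by omega)
    exact ((d.Tinv_commute h1.symm).symm.mul_right (ih (by omega))).mul_right h1

/-- The braid relation, with one factor inverted. -/
theorem T_Tinv_Tinv {i : ℕ} (h : i + 2 < n) :
    d.T i * (d.Tinv (i + 1) * d.Tinv i) = d.Tinv (i + 1) * d.Tinv i * d.T (i + 1) := by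
  have a := d.T_mul_Tinv (i := i) (by omega)
  have b := d.T_mul_Tinv (i := i + 1) (by omega)
  have a' := d.Tinv_mul_T (i := i) (by omega)
  have b' := d.Tinv_mul_T (i := i + 1) (by omega)
  calc d.T i * (d.Tinv (i + 1) * d.Tinv i)
      = (d.Tinv (i + 1) * (d.Tinv i * d.T i) * d.T (i + 1)) * d.T i *
          (d.Tinv (i + 1) * d.Tinv i) := by rw [a', mul_one, b', one_mul]
    _ = d.Tinv (i + 1) * d.Tinv i * (d.T i * d.T (i + 1) * d.T i) *
          (d.Tinv (i + 1) * d.Tinv i) := by noncomm_ring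
    _ = d.Tinv (i + 1) * d.Tinv i * d.T (i + 1) * d.T i * (d.T (i + 1) *
          d.Tinv (i + 1)) * d.Tinv i := by rw [d.T_braid i h]; noncomm_ring
    _ = d.Tinv (i + 1) * d.Tinv i * d.T (i + 1) * (d.T i * d.Tinv i) := by
          rw [b, mul_one, mul_assoc _ (d.T i)]
    _ = _ := by rw [a, mul_one]

theorem T_Y_commute_add_two {j : ℕ} (h : j + 2 < n) : Commute (d.T j) (d.Y (j + 2)) := by
  have hc : Commute (d.T (j + 1)) (d.Y j) := d.T_Y_commute_of_lt (by omega) (by omega)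
  change d.T j * (d.Tinv (j + 1) * (d.Tinv j * d.Y j * d.T j) * d.T (j + 1)) =
    d.Tinv (j + 1) * (d.Tinv j * d.Y j * d.T j) * d.T (j + 1) * d.T j
  calc d.T j * (d.Tinv (j + 1) * (d.Tinv j * d.Y j * d.T j) * d.T (j + 1))
      = d.T j * (d.Tinv (j + 1) * d.Tinv j) * d.Y j * (d.T j * d.T (j + 1)) := by
        simp only [mul_assoc]
    _ = d.Tinv (j + 1) * d.Tinv j * (d.T (j + 1) * d.Y j) * (d.T j * d.T (j + 1)) := by
        rw [d.T_Tinv_Tinv h]; simp only [mul_assoc]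
    _ = d.Tinv (j + 1) * d.Tinv j * d.Y j * (d.T (j + 1) * d.T j * d.T (j + 1)) := by
        rw [hc.eq]; simp only [mul_assoc]
    _ = _ := by rw [← d.T_braid j h]; simp only [mul_assoc]

theorem T_Y_commute_of_gt {i j : ℕ} (hij : i + 1 < j) (hj : j < n) :
    Commute (d.T i) (d.Y j) := by
  obtain ⟨k, rfl⟩ : ∃ k, j = i + 2 + k := ⟨j - (i + 2), by omega⟩
  induction k with
  | zero => exact d.T_Y_commute_add_two hj
  | succ k ih =>
    have h1 : Commute (d.T i) (d.T (i + 2 + k)) := d.T_comm' (by omega) (by omega) (by omega)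
    exact ((d.Tinv_commute h1.symm).symm.mul_right (ih (by omega) (by omega))).mul_right h1

theorem Y_sq {j : ℕ} (hj : j < n) : d.Y j * d.Y j = 1 := by
  induction j with
  | zero => exact d.y_sq hj
  | succ j ih =>
    calc d.Tinv j * d.Y j * d.T j * (d.Tinv j * d.Y j * d.T j)
        = d.Tinv j * d.Y j * (d.T j * d.Tinv j) * d.Y j * d.T j := by simp only [mul_assoc]
      _ = d.Tinv j * (d.Y j * d.Y j) * d.T j := by
        rw [d.T_mul_Tinv hj, mul_one]; simp only [mul_assoc]
      _ = 1 := by rw [ih (by omega), mul_one, d.Tinv_mul_T hj]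

theorem C_Y_anti {i j : ℕ} (hi : i < n) (hj : j < n) (hij : i ≠ j) :
    d.C i * d.Y j = -(d.Y j * d.C i) := by
  induction j generalizing i with
  | zero => exact d.C_y_anti i (by omega) hi
  | succ j ih =>
    change d.C i * (d.Tinv j * d.Y j * d.T j) = -((d.Tinv j * d.Y j * d.T j) * d.C i)
    by_cases h : i = j
    · subst h
      have h1 : d.C i * d.Tinv i = d.Tinv i * d.C (i + 1) := by
        calc d.C i * d.Tinv i = d.Tinv i * (d.T i * d.C i) * d.Tinv i := by
              rw [← mul_assoc, d.Tinv_mul_T hj, one_mul]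
          _ = d.Tinv i * d.C (i + 1) * (d.T i * d.Tinv i) := by
              rw [d.T_C i hj]; simp only [mul_assoc]
          _ = _ := by rw [d.T_mul_Tinv hj, mul_one]
      calc d.C i * (d.Tinv i * d.Y i * d.T i)
          = d.C i * d.Tinv i * d.Y i * d.T i := by simp only [mul_assoc]
        _ = d.Tinv i * (d.C (i + 1) * d.Y i) * d.T i := by rw [h1]; simp only [mul_assoc]
        _ = -(d.Tinv i * d.Y i * (d.C (i + 1) * d.T i)) := by
          rw [ih hj (by omega) (by omega)]; noncomm_ring
        _ = _ := by rw [← d.T_C i hj]; simp only [mul_assoc]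
    · have h1 : Commute (d.T j) (d.C i) := d.T_C_comm j i hj hi h hij
      have h2 := d.Tinv_commute h1
      calc d.C i * (d.Tinv j * d.Y j * d.T j)
          = d.C i * d.Tinv j * d.Y j * d.T j := by simp only [mul_assoc]
        _ = d.Tinv j * (d.C i * d.Y j) * d.T j := by rw [← h2.eq]; simp only [mul_assoc]
        _ = -(d.Tinv j * d.Y j * (d.C i * d.T j)) := by
          rw [ih hi (by omega) h]; noncomm_ring
        _ = _ := by rw [← h1.eq]; simp only [mul_assoc]

theorem Y_anti_succ {i : ℕ} (hi : i + 1 < n) :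
    d.Y i * d.Y (i + 1) = -(d.Y (i + 1) * d.Y i) := by
  induction i with
  | zero => exact d.y_anti hi
  | succ i ih =>
    -- the pair for `i + 1` is the conjugate of the pair for `i` by `T (i + 1) * T i`
    set h := d.T (i + 1) * d.T i with hh
    set h' := d.Tinv i * d.Tinv (i + 1) with hh'
    have e1 : h * h' = 1 := by
      rw [hh, hh', mul_assoc, ← mul_assoc (d.T i), d.T_mul_Tinv (by omega), one_mul,
        d.T_mul_Tinv hi]
    have c1 : h' * d.Y i * h = d.Y (i + 1) := by
      have hc : Commute (d.T (i + 1)) (d.Y i) := d.T_Y_commute_of_lt (by omega) (by omega)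
      calc h' * d.Y i * h = d.Tinv i * d.Tinv (i + 1) * (d.Y i * d.T (i + 1)) * d.T i := by
            rw [hh, hh']; simp only [mul_assoc]
        _ = d.Tinv i * (d.Tinv (i + 1) * d.T (i + 1)) * d.Y i * d.T i := by
            rw [← hc.eq]; simp only [mul_assoc]
        _ = _ := by rw [d.Tinv_mul_T hi, mul_one]; rfl
    have c2 : h' * d.Y (i + 1) * h = d.Y (i + 2) := by
      have hc : Commute (d.T i) (d.Y (i + 2)) := d.T_Y_commute_add_two (by omega)
      calc h' * d.Y (i + 1) * h
          = d.Tinv i * (d.Tinv (i + 1) * d.Y (i + 1) * d.T (i + 1)) * d.T i := by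
            rw [hh, hh']; simp only [mul_assoc]
        _ = d.Tinv i * d.Y (i + 2) * d.T i := rfl
        _ = d.Y (i + 2) := by
            rw [mul_assoc, ← hc.eq, ← mul_assoc, d.Tinv_mul_T (by omega), one_mul]
    calc d.Y (i + 1) * d.Y (i + 2) = h' * d.Y i * (h * h') * d.Y (i + 1) * h := by
          rw [← c1, ← c2, ← c1]; simp only [mul_assoc]
      _ = h' * (d.Y i * d.Y (i + 1)) * h := by rw [e1, mul_one]; simp only [mul_assoc]
      _ = -(h' * d.Y (i + 1) * 1 * d.Y i * h) := by rw [ih (by omega)]; noncomm_ring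
      _ = -(h' * d.Y (i + 1) * h * (h' * d.Y i * h)) := by rw [← e1]; simp only [mul_assoc]
      _ = _ := by rw [c2, c1]

theorem Y_anti {i j : ℕ} (hij : i < j) (hj : j < n) : d.Y i * d.Y j = -(d.Y j * d.Y i) := by
  obtain ⟨k, rfl⟩ : ∃ k, j = i + 1 + k := ⟨j - (i + 1), by omega⟩
  induction k with
  | zero => exact d.Y_anti_succ hj
  | succ k ih =>
    have h1 : Commute (d.T (i + 1 + k)) (d.Y i) := d.T_Y_commute_of_lt (by omega) (by omega)
    have h2 := d.Tinv_commute h1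
    change d.Y i * (d.Tinv (i + 1 + k) * d.Y (i + 1 + k) * d.T (i + 1 + k)) =
      -((d.Tinv (i + 1 + k) * d.Y (i + 1 + k) * d.T (i + 1 + k)) * d.Y i)
    rw [mul_assoc _ (d.T _), h1.eq, ← mul_assoc, ← mul_assoc, ← mul_assoc, ← h2.eq,
      mul_assoc (d.Tinv _), ih (by omega) (by omega)]
    noncomm_ring

/-- The system that grows from a seed. -/
def system : HCSystem e P n B where
  T := d.T
  C := d.C
  Y := d.Y
  T_sq := d.T_sq
  T_comm := d.T_comm
  T_braid := d.T_braid
  C_sq := d.C_sq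
  C_anti := d.C_anti
  T_C := d.T_C
  T_C_comm := d.T_C_comm
  Y_sq _ := d.Y_sq
  Y_anti i j hi hj hij := by
    rcases lt_or_gt_of_ne hij with h | h
    · exact d.Y_anti h hj
    · rw [d.Y_anti h hi, neg_neg]
  C_Y_anti _ _ := d.C_Y_anti
  T_Y _ := d.T_Y
  T_Y_comm i j hi hj h1 h2 := by
    rcases lt_or_gt_of_ne h1 with h | h
    · exact d.T_Y_commute_of_lt h hi
    · exact d.T_Y_commute_of_gt (by omega) hj
  cyc := d.cyc

end HCSeed

namespace HCSystem

variable {e : R} {P : R[X]} {n : ℕ} (d : HCSystem e P n B)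

theorem T_mul_sub {i : ℕ} (h : i + 1 < n) : d.T i * (d.T i - e • 1) = 1 := by
  rw [mul_sub, d.T_sq i h, mul_smul_comm, mul_one]; abel

theorem sub_mul_T {i : ℕ} (h : i + 1 < n) : (d.T i - e • 1) * d.T i = 1 := by
  rw [sub_mul, d.T_sq i h, smul_mul_assoc, one_mul]; abel

theorem C_succ {i : ℕ} (h : i + 1 < n) : d.C (i + 1) = d.T i * d.C i * (d.T i - e • 1) := by
  rw [d.T_C i h, mul_assoc, d.T_mul_sub h, mul_one]

theorem Y_succ {i : ℕ} (h : i + 1 < n) : d.Y (i + 1) = (d.T i - e • 1) * d.Y i * d.T i := by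
  rw [mul_assoc, ← d.T_Y i h, ← mul_assoc, d.sub_mul_T h, one_mul]

/-- The relation that moves `C (i + 1)` to the left of `T i`. -/
theorem T_C_succ {i : ℕ} (h : i + 1 < n) :
    d.T i * d.C (i + 1) = d.C i * d.T i - e • (d.C i - d.C (i + 1)) := by
  calc d.T i * d.C (i + 1) = d.T i * d.T i * d.C i * (d.T i - e • 1) := by
        rw [d.C_succ h]; simp only [mul_assoc]
    _ = e • (d.T i * d.C i * (d.T i - e • 1)) + d.C i * (d.T i - e • 1) := by
        rw [d.T_sq i h, add_mul, add_mul, one_mul, smul_mul_assoc, smul_mul_assoc]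
    _ = _ := by
        rw [← d.C_succ h, mul_sub, smul_sub, mul_smul_comm, mul_one]; abel

end HCSystem

end Systems

/-! ### The defining polynomial -/

section DefiningPolynomial

open Polynomial

variable {R : Type*} [CommRing R]

/-- The sign that relates the trace form to the super structure: `-1` for type `0`, where the form
is supersymmetric, and `1` for type `s`, where it is symmetric. It is minus the constant
coefficient of the defining polynomial. -/
def kindSign (R : Type*) [CommRing R] : Kind → R
  | Kind.zero => -1
  | Kind.s => 1

theorem kindSign_mul_self (κ : Kind) : kindSign R κ * kindSign R κ = 1 := by
  cases κ <;> simp [kindSign]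

/-- The polynomial `x ^ m * cycPoly q κ Q x x⁻¹`. -/
def defPoly (q : Rˣ) (κ : Kind) {m : ℕ} (Q : Fin m → Rˣ) : R[X] :=
  (match κ with
    | Kind.zero => 1
    | Kind.s => X - 1) *
  (List.ofFn fun i => X ^ 2 - Polynomial.C (qval q (Q i)) * X + 1).prod

variable (q : Rˣ) (κ : Kind) {m : ℕ} (Q : Fin m → Rˣ)

theorem aeval_defPoly {A : Type*} [Ring A] [Algebra R A] {x x' : A} (h : x * x' = 1)
    (h' : x' * x = 1) : aeval x (defPoly q κ Q) = cycPoly q κ Q x x' * x ^ m := by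
  have key : ∀ l : List R, (l.map fun a => aeval x (X ^ 2 - Polynomial.C a * X + 1)).prod =
      (l.map fun a => x + x' - algebraMap R A a).prod * x ^ l.length := by
    intro l
    induction l with
    | nil => simp
    | cons a l ih =>
      have hx : aeval x (X ^ 2 - Polynomial.C a * X + 1) = (x + x' - algebraMap R A a) * x := by
        simp [sub_mul, add_mul, h', sq]; abel
      have hc : Commute x (l.map fun a => x + x' - algebraMap R A a).prod := by
        refine Commute.list_prod_right _ _ fun y hy => ?_
        obtain ⟨a, -, rfl⟩ := List.mem_map.1 hy
        exact ((Commute.refl x).add_right (h.trans h'.symm)).sub_right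
          (Algebra.commutes a x).symm
      rw [List.map_cons, List.prod_cons, List.map_cons, List.prod_cons, ih, hx, List.length_cons,
        pow_succ', mul_assoc, mul_assoc, ← mul_assoc x, hc.eq]
      simp only [mul_assoc]
  have key' := key (List.ofFn fun i => qval q (Q i))
  rw [List.map_ofFn, List.map_ofFn, List.length_ofFn] at key'
  unfold defPoly cycPoly
  rw [map_mul, map_list_prod, List.map_ofFn, mul_assoc]
  refine congrArg₂ _ ?_ key'
  cases κ <;> simp

theorem defPoly_aux [Nontrivial R] (l : List R) :
    ((l.map fun a => X ^ 2 - Polynomial.C a * X + 1).prod).Monic ∧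
    ((l.map fun a => X ^ 2 - Polynomial.C a * X + 1).prod).natDegree = 2 * l.length ∧
    reflect (2 * l.length) (l.map fun a => X ^ 2 - Polynomial.C a * X + 1).prod =
      (l.map fun a => X ^ 2 - Polynomial.C a * X + 1).prod := by
  induction l with
  | nil => simp
  | cons a l ih =>
    obtain ⟨h1, h2, h3⟩ := ih
    have hd : (X ^ 2 - Polynomial.C a * X + 1 : R[X]).natDegree = 2 := by compute_degree!
    have hm : (X ^ 2 - Polynomial.C a * X + 1 : R[X]).Monic := by monicity!
    have hr : reflect 2 (X ^ 2 - Polynomial.C a * X + 1 : R[X]) =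
        X ^ 2 - Polynomial.C a * X + 1 := by
      ext i
      rw [coeff_reflect]
      by_cases hi : i ≤ 2
      · rw [revAt_le hi]
        interval_cases i <;> simp [coeff_X, coeff_one, coeff_X_pow]
      · rw [revAt_eq_self_of_lt (by omega)]
    rw [List.map_cons, List.prod_cons, List.length_cons,
      show 2 * (l.length + 1) = 2 + 2 * l.length by ring]
    refine ⟨hm.mul h1, by rw [hm.natDegree_mul h1, h2, hd], ?_⟩
    rw [reflect_mul _ _ hd.le h2.le, h3, hr]

theorem defPoly_facts [Nontrivial R] : (defPoly q κ Q).Monic ∧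
    (defPoly q κ Q).natDegree = level κ m ∧
    reflect (level κ m) (defPoly q κ Q) = Polynomial.C (-kindSign R κ) * defPoly q κ Q := by
  obtain ⟨h1, h2, h3⟩ := defPoly_aux (List.ofFn fun i => qval q (Q i))
  rw [List.map_ofFn, List.length_ofFn] at h2 h3
  rw [List.map_ofFn] at h1
  simp only [Function.comp_def] at h1 h2 h3
  have hd : (X - 1 : R[X]).natDegree = 1 := natDegree_X_sub_C 1
  have hm : (X - 1 : R[X]).Monic := monic_X_sub_C 1
  have hr : reflect 1 (X - 1 : R[X]) = Polynomial.C (-1) * (X - 1) := by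
    ext i
    rw [coeff_reflect, coeff_C_mul]
    by_cases hi : i ≤ 1
    · rw [revAt_le hi]
      interval_cases i <;> simp [coeff_X, coeff_one]
    · rw [revAt_eq_self_of_lt (by omega)]
      simp [coeff_X, coeff_one, show i ≠ 0 by omega, show 1 ≠ i by omega]
  cases κ
  · simp only [defPoly, one_mul, level, kindSign, neg_neg, map_one]
    exact ⟨h1, h2, h3⟩
  · simp only [defPoly, level, kindSign]
    rw [add_comm (2 * m)]
    refine ⟨hm.mul h1, ?_, ?_⟩
    · rw [hm.natDegree_mul h1, hd]; exact congrArg _ h2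
    · rw [reflect_mul _ _ hd.le (le_of_eq h2), hr, mul_assoc]
      exact congrArg _ (congrArg _ h3)

/-- The properties of the defining polynomial on which everything rests: it is monic of degree `r`
and palindromic up to sign. -/
structure IsPalindromic (P : R[X]) (r : ℕ) (s : R) : Prop where
  coeff_top : P.coeff r = 1
  natDegree_le : P.natDegree ≤ r
  sq : s * s = 1
  coeff_sub : ∀ k, k ≤ r → P.coeff (r - k) = s * P.coeff k

theorem isPalindromic_defPoly [Nontrivial R] :
    IsPalindromic (defPoly q κ Q) (level κ m) (-kindSign R κ) := by
  obtain ⟨h1, h2, h3⟩ := defPoly_facts q κ Q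
  refine ⟨?_, h2.le, by rw [neg_mul_neg, kindSign_mul_self], fun k hk => ?_⟩
  · rw [← h2]; exact h1
  · have := congrArg (fun p => coeff p k) h3
    simpa only [coeff_reflect, revAt_le hk, coeff_C_mul] using this

theorem IsPalindromic.coeff_zero {P : R[X]} {r : ℕ} {s : R} (h : IsPalindromic P r s) :
    P.coeff 0 = s := by
  have := h.coeff_sub r le_rfl
  rwa [Nat.sub_self, h.coeff_top, mul_one] at this

/-- The value of a palindromic polynomial at an inverse. -/
theorem IsPalindromic.aeval_inv {P : R[X]} {r : ℕ} {s : R} (h : IsPalindromic P r s)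
    {A : Type*} [Ring A] [Algebra R A] {x x' : A} (hx : x * x' = 1) :
    aeval x' P = s • (aeval x P * x' ^ r) := by
  have hp : ∀ k j, k ≤ j → x ^ k * x' ^ j = x' ^ (j - k) := by
    intro k j hk
    obtain ⟨i, rfl⟩ := Nat.exists_eq_add_of_le hk
    rw [Nat.add_sub_cancel_left, pow_add, ← mul_assoc]
    have : x ^ k * x' ^ k = 1 := by
      clear hk
      induction k with
      | zero => simp
      | succ k ih => rw [pow_succ, pow_succ', mul_assoc, ← mul_assoc x, hx, one_mul, ih]
    rw [this, one_mul]
  rw [aeval_eq_sum_range' (Nat.lt_succ_of_le h.natDegree_le),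
    aeval_eq_sum_range' (Nat.lt_succ_of_le h.natDegree_le), Finset.sum_mul, Finset.smul_sum,
    ← Finset.sum_range_reflect]
  refine Finset.sum_congr rfl fun k hk => ?_
  have hk' : k ≤ r := Nat.lt_succ_iff.1 (Finset.mem_range.1 hk)
  rw [Nat.succ_sub_one, h.coeff_sub k hk', smul_mul_assoc, smul_smul, hp k r hk']

end DefiningPolynomial

/-! ### The universal property -/

namespace HCSystem

variable {R : Type*} [CommRing R] {B : Type*} [Ring B] [Algebra R B] {e : R} {P : R[X]} {n : ℕ}
  (d : HCSystem e P n B)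

/-- The even generators `X j`. -/
def X (j : ℕ) : B := d.C j * d.Y j

/-- The inverse of `X j`. -/
def X' (j : ℕ) : B := d.Y j * d.C j

theorem X_mul_X' {j : ℕ} (hj : j < n) : d.X j * d.X' j = 1 := by
  rw [X, X', mul_assoc, ← mul_assoc (d.Y j), d.Y_sq j hj, one_mul, d.C_sq j hj]

theorem X'_mul_X {j : ℕ} (hj : j < n) : d.X' j * d.X j = 1 := by
  rw [X, X', mul_assoc, ← mul_assoc (d.C j), d.C_sq j hj, one_mul, d.Y_sq j hj]

theorem X_C {j : ℕ} : d.X j * d.C j = d.C j * d.X' j := by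
  rw [X, X', mul_assoc]

theorem C_X {j : ℕ} (hj : j < n) : d.C j * d.X j = d.Y j := by
  rw [X, ← mul_assoc, d.C_sq j hj, one_mul]

theorem X_C_comm {i j : ℕ} (hi : i < n) (hj : j < n) (hij : i ≠ j) :
    d.X i * d.C j = d.C j * d.X i := by
  rw [X, mul_assoc, ← neg_eq_iff_eq_neg.2 (d.C_Y_anti j i hj hi hij.symm), mul_neg, ← mul_assoc,
    d.C_anti i j hi hj hij, neg_mul, neg_neg, mul_assoc]

theorem X_Y_comm {i j : ℕ} (hi : i < n) (hj : j < n) (hij : i ≠ j) :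
    d.X i * d.Y j = d.Y j * d.X i := by
  rw [X, mul_assoc, d.Y_anti i j hi hj hij, mul_neg, ← mul_assoc, d.C_Y_anti i j hi hj hij,
    neg_mul, neg_neg, mul_assoc]

theorem X_comm {i j : ℕ} (hi : i < n) (hj : j < n) : d.X i * d.X j = d.X j * d.X i := by
  by_cases hij : i = j
  · rw [hij]
  · conv_lhs => rw [X.eq_def d j]
    rw [← mul_assoc, d.X_C_comm hi hj hij, mul_assoc, d.X_Y_comm hi hj hij, ← mul_assoc]
    rfl

theorem T_X_comm {i j : ℕ} (hi : i + 1 < n) (hj : j < n) (h : j ≠ i) (h' : j ≠ i + 1) :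
    d.T i * d.X j = d.X j * d.T i := by
  rw [X, ← mul_assoc, d.T_C_comm i j hi hj h h', mul_assoc, d.T_Y_comm i j hi hj h h', mul_assoc]

theorem T_X_succ {i : ℕ} (h : i + 1 < n) : d.T i * d.X (i + 1) =
    d.X i * d.T i + e • ((1 - d.C i * d.C (i + 1)) * d.X (i + 1)) := by
  have h1 : d.C i * d.C (i + 1) * d.X (i + 1) = d.C i * d.Y (i + 1) := by
    rw [mul_assoc, d.C_X h]
  rw [sub_mul, one_mul, h1]
  conv_lhs => rw [X, ← mul_assoc, d.T_C_succ h, sub_mul, mul_assoc, d.T_Y i h, smul_mul_assoc,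
    sub_mul]
  rw [X, X, smul_sub, smul_sub, mul_assoc]
  abel

theorem T_X {i : ℕ} (h : i + 1 < n) : d.T i * d.X i =
    d.X (i + 1) * d.T i - e • (d.X (i + 1) + d.C i * d.C (i + 1) * d.X i) := by
  have h1 : d.C i * d.C (i + 1) * d.X i = -(d.C (i + 1) * d.Y i) := by
    rw [d.C_anti i (i + 1) (by omega) h (by omega), neg_mul, mul_assoc, d.C_X (by omega)]
  have h2 : d.Y (i + 1) * (d.T i - e • 1) = (d.T i - e • 1) * d.Y i := by
    rw [d.Y_succ h, mul_assoc, d.T_mul_sub h, mul_one]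
  have h3 : d.X (i + 1) * d.T i - e • d.X (i + 1) = d.C (i + 1) * (d.T i - e • 1) * d.Y i := by
    rw [mul_assoc, ← h2, X, mul_sub, mul_sub, mul_smul_comm, mul_one, mul_smul_comm, mul_assoc]
  rw [h1, smul_add, ← sub_sub, h3, mul_sub, sub_mul, ← d.T_C i h, mul_smul_comm, smul_mul_assoc,
    smul_neg, mul_one, X, mul_assoc]
  abel

/-- The values of the generators of the cyclotomic Hecke-Clifford algebra in a system. -/
def genVal : Gen n → B
  | Gen.T i _ => d.T i
  | Gen.X j => d.X j
  | Gen.Xinv j => d.X' j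
  | Gen.C j => d.C j

end HCSystem

section Universal

variable {R : Type*} [CommRing R] {q : Rˣ} {κ : Kind} {m : ℕ} {Q : Fin m → Rˣ} {n : ℕ}
  {B : Type*} [Ring B] [Algebra R B]

theorem seed_succ {e : R} {t x z c f : B} (r1 : t * x = z * t - e • (z + c * f * x))
    (r2 : t * t = e • t + 1) (r3 : t * c = f * t) (r4 : c * f = -(f * c)) (r5 : f * f = 1) :
    (t - e • 1) * (c * x) * t = f * z := by
  have k0 : (t - e • 1) * t = 1 := by
    rw [sub_mul, r2, smul_mul_assoc, one_mul]; abel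
  have k1 : z * (t - e • 1) = t * x + e • (c * f * x) := by
    rw [r1, mul_sub, mul_smul_comm, mul_one, smul_add]; abel
  have k2 : f * (t * x + e • (c * f * x)) = (t - e • 1) * c * x := by
    rw [mul_add, ← mul_assoc, ← r3, mul_smul_comm, r4, neg_mul, mul_neg, ← mul_assoc, ← mul_assoc,
      r5, one_mul, sub_mul, smul_mul_assoc, one_mul, smul_neg, sub_mul, smul_mul_assoc]
    abel
  rw [← mul_assoc, ← k2, ← k1, mul_assoc, mul_assoc, k0, mul_one]

theorem seed_y_anti {e : R} {t x z c f : B} (r1 : t * x = z * t - e • (z + c * f * x))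
    (r2 : t * t = e • t + 1) (r3 : t * c = f * t) (r4 : c * f = -(f * c)) (r5 : f * f = 1)
    (r6 : x * f = f * x) (r7 : z * c = c * z) (r8 : x * z = z * x) :
    c * x * ((t - e • 1) * (c * x) * t) = -((t - e • 1) * (c * x) * t * (c * x)) := by
  rw [seed_succ r1 r2 r3 r4 r5, mul_assoc, ← mul_assoc x, r6, mul_assoc f, r8, ← mul_assoc, r4,
    neg_mul, mul_assoc, mul_assoc f z, ← mul_assoc z, r7, ← mul_assoc c]

theorem seed_c_y_anti {x c f : B} (h1 : f * c = -(c * f)) (h2 : x * f = f * x) :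
    f * (c * x) = -(c * x * f) := by
  rw [mul_assoc, h2, ← mul_assoc, h1, neg_mul, mul_assoc]

theorem HCSystem.lift_rel (d : HCSystem (eps q) (defPoly q κ Q) n B) :
    ∀ ⦃a b : FreeAlgebra R (Gen n)⦄, Rel q κ Q n a b →
      FreeAlgebra.lift R d.genVal a = FreeAlgebra.lift R d.genVal b := by
  intro a b hab
  cases hab with
  | T_sq i h => simpa [genVal] using d.T_sq i h
  | T_comm i j hi hj hij => simpa [genVal] using d.T_comm i j hi hj hij
  | T_braid i h h' => simpa [genVal] using d.T_braid i h'
  | X_comm i j => simpa [genVal] using d.X_comm i.2 j.2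
  | X_mul_inv i => simpa [genVal] using d.X_mul_X' i.2
  | X_inv_mul i => simpa [genVal] using d.X'_mul_X i.2
  | C_sq i => simpa [genVal] using d.C_sq i i.2
  | C_anti i j hij =>
    simpa [genVal] using d.C_anti i j i.2 j.2 (fun h => hij (Fin.ext h))
  | T_X i h => simpa [genVal] using d.T_X h
  | T_X_succ i h => simpa [genVal] using d.T_X_succ h
  | T_X_comm i h j hj hj' => simpa [genVal] using d.T_X_comm h j.2 hj hj'
  | T_C i h => simpa [genVal] using d.T_C i h
  | T_C_succ i h => simpa [genVal] using d.T_C_succ h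
  | T_C_comm i h j hj hj' => simpa [genVal] using d.T_C_comm i j h j.2 hj hj'
  | X_C i => simpa [genVal] using d.X_C
  | X_C_comm i j hij =>
    simpa [genVal] using d.X_C_comm i.2 j.2 (fun h => hij (Fin.ext h))
  | cyc h =>
    have h1 := aeval_defPoly q κ Q (d.X_mul_X' h) (d.X'_mul_X h)
    have h2 : cycPoly q κ Q (d.X 0) (d.X' 0) = 0 := by
      have h3 : d.X 0 ^ m * d.X' 0 ^ m = 1 := by
        have hc : Commute (d.X 0) (d.X' 0) := (d.X_mul_X' h).trans (d.X'_mul_X h).symm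
        rw [← hc.mul_pow, d.X_mul_X' h, one_pow]
      calc cycPoly q κ Q (d.X 0) (d.X' 0)
          = cycPoly q κ Q (d.X 0) (d.X' 0) * d.X 0 ^ m * d.X' 0 ^ m := by
            rw [mul_assoc, h3, mul_one]
        _ = 0 := by rw [← h1, X, d.cyc h, zero_mul]
    rw [map_zero, ← h2]
    unfold cycPoly
    rw [map_mul, map_list_prod, List.map_ofFn]
    cases κ <;> simp [genVal, Function.comp_def]

/-- The universal property of the cyclotomic Hecke-Clifford algebra. -/
def HCSystem.lift (d : HCSystem (eps q) (defPoly q κ Q) n B) : Cyc q κ Q n →ₐ[R] B :=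
  RingQuot.liftAlgHom R ⟨FreeAlgebra.lift R d.genVal, d.lift_rel⟩

theorem HCSystem.lift_gen (d : HCSystem (eps q) (defPoly q κ Q) n B) (g : Gen n) :
    d.lift (gen q κ Q g) = d.genVal g := by
  simp [lift, gen]

variable (q κ Q)

/-- Relations of the presentation, in the quotient. -/
theorem gen_rel {a b : FreeAlgebra R (Gen n)} (h : Rel q κ Q n a b) :
    RingQuot.mkAlgHom R (Rel q κ Q n) a = RingQuot.mkAlgHom R (Rel q κ Q n) b :=
  RingQuot.mkAlgHom_rel R h

/-- The generator `T i`, with value `0` for indices out of range. -/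
def tGen (n i : ℕ) : Cyc q κ Q n := if h : i + 1 < n then gen q κ Q (Gen.T i h) else 0

/-- The generator `C j`, with value `0` for indices out of range. -/
def cGen (n j : ℕ) : Cyc q κ Q n := if h : j < n then gen q κ Q (Gen.C ⟨j, h⟩) else 0

/-- The generator `X j`, with value `0` for indices out of range. -/
def xGen (n j : ℕ) : Cyc q κ Q n := if h : j < n then gen q κ Q (Gen.X ⟨j, h⟩) else 0

theorem tGen_of_lt {i : ℕ} (h : i + 1 < n) : tGen q κ Q n i = gen q κ Q (Gen.T i h) := dif_pos h

theorem cGen_of_lt {j : ℕ} (h : j < n) : cGen q κ Q n j = gen q κ Q (Gen.C ⟨j, h⟩) := dif_pos h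

theorem xGen_of_lt {j : ℕ} (h : j < n) : xGen q κ Q n j = gen q κ Q (Gen.X ⟨j, h⟩) := dif_pos h

/-- The seed of the tautological system. -/
def cycSeed (n : ℕ) : HCSeed (eps q) (defPoly q κ Q) n (Cyc q κ Q n) where
  T := tGen q κ Q n
  C := cGen q κ Q n
  y := cGen q κ Q n 0 * xGen q κ Q n 0
  T_sq i h := by
    simpa [gen, tGen_of_lt, h] using gen_rel q κ Q (Rel.T_sq (n := n) i h)
  T_comm i j hi hj hij := by
    simpa [gen, tGen_of_lt, hi, hj] using gen_rel q κ Q (Rel.T_comm (n := n) i j hi hj hij)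
  T_braid i h := by
    have h1 : i + 1 < n := by omega
    have h2 : i + 1 + 1 < n := h
    simpa [gen, tGen_of_lt, h1, h2] using gen_rel q κ Q (Rel.T_braid (n := n) i h1 h2)
  C_sq j h := by
    simpa [gen, cGen_of_lt, h] using gen_rel q κ Q (Rel.C_sq (n := n) ⟨j, h⟩)
  C_anti i j hi hj hij := by
    simpa [gen, cGen_of_lt, hi, hj] using
      gen_rel q κ Q (Rel.C_anti (n := n) ⟨i, hi⟩ ⟨j, hj⟩ (by simpa using hij))
  T_C i h := by
    have h1 : i < n := by omega
    simpa [gen, cGen_of_lt, tGen_of_lt, h, h1] using gen_rel q κ Q (Rel.T_C (n := n) i h)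
  T_C_comm i j h hj h1 h2 := by
    simpa [gen, cGen_of_lt, tGen_of_lt, h, hj] using
      gen_rel q κ Q (Rel.T_C_comm (n := n) i h ⟨j, hj⟩ h1 h2)
  y_sq h := by
    have h1 := gen_rel q κ Q (Rel.X_C (n := n) ⟨0, h⟩)
    have h2 := gen_rel q κ Q (Rel.C_sq (n := n) ⟨0, h⟩)
    have h3 := gen_rel q κ Q (Rel.X_inv_mul (n := n) ⟨0, h⟩)
    simp only [map_mul, map_one] at h1 h2 h3
    rw [cGen_of_lt q κ Q h, xGen_of_lt q κ Q h, gen, gen, mul_assoc, ← mul_assoc _ _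
      (RingQuot.mkAlgHom R _ (FreeAlgebra.ι R (Gen.X _))), h1, ← mul_assoc, ← mul_assoc, h2,
      one_mul, h3]
  C_y_anti i hi hin := by
    have h : 0 < n := by omega
    have h1 := gen_rel q κ Q (Rel.C_anti (n := n) ⟨i, hin⟩ ⟨0, h⟩ (by simpa using hi.ne'))
    have h2 := gen_rel q κ Q (Rel.X_C_comm (n := n) ⟨0, h⟩ ⟨i, hin⟩ (by simpa using hi.ne))
    simp only [map_mul, map_neg] at h1 h2
    rw [cGen_of_lt q κ Q h, cGen_of_lt q κ Q hin, xGen_of_lt q κ Q h, gen, gen, gen]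
    exact seed_c_y_anti h1 h2
  T_y_comm i hi hin := by
    have h : 0 < n := by omega
    have h1 := gen_rel q κ Q (Rel.T_C_comm (n := n) i hin ⟨0, h⟩ hi.ne (by simp))
    have h2 := gen_rel q κ Q (Rel.T_X_comm (n := n) i hin ⟨0, h⟩ hi.ne (by simp))
    simp only [map_mul] at h1 h2
    rw [cGen_of_lt q κ Q h, tGen_of_lt q κ Q hin, xGen_of_lt q κ Q h, gen, gen, gen, mul_assoc,
      ← h2, ← mul_assoc, h1, mul_assoc]
  y_anti h := by
    have h0 : 0 < n := by omega
    have r1 := gen_rel q κ Q (Rel.T_X (n := n) 0 h)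
    have r2 := gen_rel q κ Q (Rel.T_sq (n := n) 0 h)
    have r3 := gen_rel q κ Q (Rel.T_C (n := n) 0 h)
    have r4 := gen_rel q κ Q (Rel.C_anti (n := n) ⟨0, h0⟩ ⟨0 + 1, h⟩ (by simp))
    have r5 := gen_rel q κ Q (Rel.C_sq (n := n) ⟨0 + 1, h⟩)
    have r6 := gen_rel q κ Q (Rel.X_C_comm (n := n) ⟨0, h0⟩ ⟨0 + 1, h⟩ (by simp))
    have r7 := gen_rel q κ Q (Rel.X_C_comm (n := n) ⟨0 + 1, h⟩ ⟨0, h0⟩ (by simp))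
    have r8 := gen_rel q κ Q (Rel.X_comm (n := n) ⟨0, h0⟩ ⟨0 + 1, h⟩)
    simp only [map_mul, map_add, map_sub, map_smul, map_neg, map_one] at r1 r2 r3 r4 r5 r6 r7 r8
    rw [cGen_of_lt q κ Q h0, tGen_of_lt q κ Q h, xGen_of_lt q κ Q h0, gen, gen, gen]
    exact seed_y_anti r1 r2 r3 r4 r5 r6 r7 r8
  cyc h := by
    have h1 := gen_rel q κ Q (Rel.X_mul_inv (n := n) ⟨0, h⟩)
    have h2 := gen_rel q κ Q (Rel.X_inv_mul (n := n) ⟨0, h⟩)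
    have h3 := gen_rel q κ Q (Rel.C_sq (n := n) ⟨0, h⟩)
    have h4 := gen_rel q κ Q (Rel.cyc (n := n) h)
    simp only [map_mul, map_one] at h1 h2 h3
    rw [cGen_of_lt q κ Q h, xGen_of_lt q κ Q h, gen, gen, ← mul_assoc, h3, one_mul,
      aeval_defPoly q κ Q h1 h2]
    rw [map_zero] at h4
    rw [← zero_mul (RingQuot.mkAlgHom R (Rel q κ Q n) (FreeAlgebra.ι R (Gen.X ⟨0, h⟩)) ^ m), ← h4]
    congr 1
    unfold cycPoly
    rw [map_mul, map_list_prod, List.map_ofFn]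
    cases κ <;> simp [Function.comp_def]

end Universal

/-! ### Generation and parity -/

namespace HCSystem

variable {R : Type*} [CommRing R] {B : Type*} [Ring B] [Algebra R B] {e : R} {P : R[X]} {n : ℕ}

/-- The system is generated, as an algebra, by the `T i` and the first members of the two Clifford
families. -/
def Generates (d : HCSystem e P n B) : Prop :=
  ∀ S : Subalgebra R B, (∀ i, i + 1 < n → d.T i ∈ S) → (0 < n → d.C 0 ∈ S) →
    (0 < n → d.Y 0 ∈ S) → S = ⊤

theorem mem_of_mem_zero (d : HCSystem e P n B) (S : Subalgebra R B)
    (hT : ∀ i, i + 1 < n → d.T i ∈ S) (hC : 0 < n → d.C 0 ∈ S) (hY : 0 < n → d.Y 0 ∈ S) {j : ℕ}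
    (hj : j < n) : d.C j ∈ S ∧ d.Y j ∈ S := by
  induction j with
  | zero => exact ⟨hC hj, hY hj⟩
  | succ j ih =>
    obtain ⟨h1, h2⟩ := ih (by omega)
    have h3 : d.T j - e • 1 ∈ S := sub_mem (hT j hj) (S.smul_mem (one_mem S) e)
    rw [d.C_succ hj, d.Y_succ hj]
    exact ⟨mul_mem (mul_mem (hT j hj) h1) h3, mul_mem (mul_mem h3 h2) (hT j hj)⟩

/-- The change of sign of all odd generators. -/
def neg (d : HCSystem e P n B) : HCSystem e P n B where
  T := d.T
  C j := -d.C j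
  Y j := -d.Y j
  T_sq := d.T_sq
  T_comm := d.T_comm
  T_braid := d.T_braid
  C_sq j h := by rw [neg_mul_neg, d.C_sq j h]
  C_anti i j hi hj h := by rw [neg_mul_neg, neg_mul_neg, d.C_anti i j hi hj h]
  T_C i h := by rw [mul_neg, neg_mul, d.T_C i h]
  T_C_comm i j hi hj h h' := by rw [mul_neg, neg_mul, d.T_C_comm i j hi hj h h']
  Y_sq j h := by rw [neg_mul_neg, d.Y_sq j h]
  Y_anti i j hi hj h := by rw [neg_mul_neg, neg_mul_neg, d.Y_anti i j hi hj h]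
  C_Y_anti i j hi hj h := by rw [neg_mul_neg, neg_mul_neg, d.C_Y_anti i j hi hj h]
  T_Y i h := by rw [mul_neg, neg_mul, d.T_Y i h]
  T_Y_comm i j hi hj h h' := by rw [mul_neg, neg_mul, d.T_Y_comm i j hi hj h h']
  cyc h := by rw [neg_mul_neg, d.cyc h]

theorem neg_X (d : HCSystem e P n B) {j : ℕ} : d.neg.X j = d.X j := neg_mul_neg _ _

theorem neg_X' (d : HCSystem e P n B) {j : ℕ} : d.neg.X' j = d.X' j := neg_mul_neg _ _

end HCSystem

section Cyclotomic

variable {R : Type*} [CommRing R] (q : Rˣ) (κ : Kind) {m : ℕ} (Q : Fin m → Rˣ)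

/-- The tautological system in the cyclotomic Hecke-Clifford algebra. -/
def cycSys (n : ℕ) : HCSystem (eps q) (defPoly q κ Q) n (Cyc q κ Q n) := (cycSeed q κ Q n).system

theorem cycSys_T {n i : ℕ} (h : i + 1 < n) : (cycSys q κ Q n).T i = gen q κ Q (Gen.T i h) :=
  tGen_of_lt q κ Q h

theorem cycSys_C {n j : ℕ} (h : j < n) : (cycSys q κ Q n).C j = gen q κ Q (Gen.C ⟨j, h⟩) :=
  cGen_of_lt q κ Q h

theorem cycSys_Y_eq {n j : ℕ} (h : j < n) :
    (cycSys q κ Q n).Y j = gen q κ Q (Gen.C ⟨j, h⟩) * gen q κ Q (Gen.X ⟨j, h⟩) := by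
  induction j with
  | zero =>
    rw [← cGen_of_lt q κ Q h, ← xGen_of_lt q κ Q h]
    rfl
  | succ j ih =>
    have h0 : j < n := by omega
    have r1 := gen_rel q κ Q (Rel.T_X (n := n) j h)
    have r2 := gen_rel q κ Q (Rel.T_sq (n := n) j h)
    have r3 := gen_rel q κ Q (Rel.T_C (n := n) j h)
    have r4 := gen_rel q κ Q (Rel.C_anti (n := n) ⟨j, h0⟩ ⟨j + 1, h⟩ (by simp))
    have r5 := gen_rel q κ Q (Rel.C_sq (n := n) ⟨j + 1, h⟩)
    simp only [map_mul, map_add, map_sub, map_smul, map_neg, map_one] at r1 r2 r3 r4 r5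
    rw [(cycSys q κ Q n).Y_succ h, ih h0, cycSys_T q κ Q h]
    exact seed_succ r1 r2 r3 r4 r5

theorem cycSys_X {n j : ℕ} (h : j < n) :
    (cycSys q κ Q n).X j = gen q κ Q (Gen.X ⟨j, h⟩) := by
  rw [HCSystem.X, cycSys_Y_eq q κ Q h, ← cycSys_C q κ Q h, ← mul_assoc,
    (cycSys q κ Q n).C_sq j h, one_mul]

theorem cycSys_X' {n j : ℕ} (h : j < n) :
    (cycSys q κ Q n).X' j = gen q κ Q (Gen.Xinv ⟨j, h⟩) := by
  have h1 : gen q κ Q (Gen.X ⟨j, h⟩) * gen q κ Q (Gen.Xinv ⟨j, h⟩) = 1 := by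
    simpa [gen] using gen_rel q κ Q (Rel.X_mul_inv (n := n) ⟨j, h⟩)
  rw [← mul_one ((cycSys q κ Q n).X' j), ← h1, ← cycSys_X q κ Q h, ← mul_assoc,
    (cycSys q κ Q n).X'_mul_X h, one_mul]

theorem cyc_subalgebra_eq_top {n : ℕ} (S : Subalgebra R (Cyc q κ Q n))
    (h : ∀ g, gen q κ Q g ∈ S) : S = ⊤ := by
  refine eq_top_iff.2 fun x _ => ?_
  obtain ⟨x, rfl⟩ := RingQuot.mkAlgHom_surjective R (Rel q κ Q n) x
  induction x using FreeAlgebra.induction with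
  | grade0 r => rw [AlgHom.commutes]; exact S.algebraMap_mem r
  | grade1 g => exact h g
  | mul a b ha hb => rw [map_mul]; exact mul_mem (ha trivial) (hb trivial)
  | add a b ha hb => rw [map_add]; exact add_mem (ha trivial) (hb trivial)

theorem cycSys_generates (n : ℕ) : (cycSys q κ Q n).Generates := by
  intro S hT hC hY
  have key := fun {j} (hj : j < n) => (cycSys q κ Q n).mem_of_mem_zero S hT hC hY hj
  refine cyc_subalgebra_eq_top q κ Q S fun g => ?_
  cases g with
  | T i h => rw [← cycSys_T q κ Q h]; exact hT i h
  | X j => rw [← cycSys_X q κ Q j.2]; exact mul_mem (key j.2).1 (key j.2).2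
  | Xinv j => rw [← cycSys_X' q κ Q j.2]; exact mul_mem (key j.2).2 (key j.2).1
  | C j => rw [← cycSys_C q κ Q j.2]; exact (key j.2).1

theorem incl_gen {n : ℕ} (g : Gen n) : incl q κ Q n (gen q κ Q g) = gen q κ Q (Gen.up g) := by
  exact (RingQuot.liftAlgHom_mkAlgHom_apply R _ _ _).trans (by simp [gen])

theorem incl_T {n i : ℕ} (h : i + 1 < n) :
    incl q κ Q n ((cycSys q κ Q n).T i) = (cycSys q κ Q (n + 1)).T i := by
  rw [cycSys_T q κ Q h, incl_gen, cycSys_T q κ Q (Nat.lt_succ_of_lt h)]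
  rfl

theorem incl_C {n j : ℕ} (h : j < n) :
    incl q κ Q n ((cycSys q κ Q n).C j) = (cycSys q κ Q (n + 1)).C j := by
  rw [cycSys_C q κ Q h, incl_gen, cycSys_C q κ Q (Nat.lt_succ_of_lt h)]
  rfl

theorem incl_Y {n j : ℕ} (h : j < n) :
    incl q κ Q n ((cycSys q κ Q n).Y j) = (cycSys q κ Q (n + 1)).Y j := by
  rw [cycSys_Y_eq q κ Q h, map_mul, incl_gen, incl_gen,
    cycSys_Y_eq q κ Q (Nat.lt_succ_of_lt h)]
  rfl

/-- The parity automorphism, which is `1` on even and `-1` on odd elements. -/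
def parityHom (n : ℕ) : Cyc q κ Q n →ₐ[R] Cyc q κ Q n := (cycSys q κ Q n).neg.lift

theorem parityHom_T {n i : ℕ} (h : i + 1 < n) :
    parityHom q κ Q n ((cycSys q κ Q n).T i) = (cycSys q κ Q n).T i := by
  conv_lhs => rw [cycSys_T q κ Q h]
  exact HCSystem.lift_gen _ _

theorem parityHom_C {n j : ℕ} (h : j < n) :
    parityHom q κ Q n ((cycSys q κ Q n).C j) = -(cycSys q κ Q n).C j := by
  conv_lhs => rw [cycSys_C q κ Q h]
  exact HCSystem.lift_gen _ _

theorem parityHom_Y {n j : ℕ} (h : j < n) :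
    parityHom q κ Q n ((cycSys q κ Q n).Y j) = -(cycSys q κ Q n).Y j := by
  conv_lhs => rw [cycSys_Y_eq q κ Q h, ← cycSys_C q κ Q h, map_mul, parityHom_C q κ Q h]
  rw [parityHom, HCSystem.lift_gen]
  change -(cycSys q κ Q n).C j * (-(cycSys q κ Q n).C j * -(cycSys q κ Q n).Y j) = _
  exact ((cycSys q κ Q n).neg.C_X h)

/-- The sign `(-1) ^ i`. -/
def paritySign (R : Type*) [CommRing R] (i : ZMod 2) : R := if i = 0 then 1 else -1

theorem paritySign_add (i j : ZMod 2) :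
    paritySign R (i + j) = paritySign R i * paritySign R j := by
  have key : ∀ i : ZMod 2, i = 0 ∨ i = 1 := by decide
  rcases key i with rfl | rfl <;> rcases key j with rfl | rfl <;>
    simp [paritySign, show (1 + 1 : ZMod 2) = 0 by decide]

theorem parityHom_gen {n : ℕ} (g : Gen n) :
    parityHom q κ Q n (gen q κ Q g) = paritySign R g.parity • gen q κ Q g := by
  rw [parityHom, HCSystem.lift_gen]
  cases g with
  | T i h => rw [← cycSys_T q κ Q h]; simp [Gen.parity, paritySign, HCSystem.genVal, HCSystem.neg]
  | X j =>
    rw [← cycSys_X q κ Q j.2, show (Gen.X j).parity = 0 from rfl, paritySign, if_pos rfl, one_smul]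
    exact (cycSys q κ Q n).neg_X
  | Xinv j =>
    rw [← cycSys_X' q κ Q j.2, show (Gen.Xinv j).parity = 0 from rfl, paritySign, if_pos rfl,
      one_smul]
    exact (cycSys q κ Q n).neg_X'
  | C j =>
    rw [← cycSys_C q κ Q j.2, Gen.parity, paritySign, if_neg (by decide)]
    exact (neg_one_smul R ((cycSys q κ Q n).C j)).symm

theorem parityHom_of_mem {n : ℕ} {i : ZMod 2} {x : Cyc q κ Q n} (hx : x ∈ parityPart q κ Q n i) :
    parityHom q κ Q n x = paritySign R i • x := by
  obtain ⟨x, hx, rfl⟩ := hx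
  change parityHom q κ Q n (RingQuot.mkAlgHom R _ x) = paritySign R i • RingQuot.mkAlgHom R _ x
  induction hx using Submodule.span_induction with
  | mem x h =>
    obtain ⟨l, rfl, rfl⟩ := h
    induction l with
    | nil => simp [paritySign]
    | cons g l ih =>
      rw [List.map_cons, List.prod_cons, map_mul, map_mul, ih, List.map_cons, List.sum_cons,
        paritySign_add, mul_smul]
      have h := parityHom_gen q κ Q g
      rw [gen] at h
      rw [h, smul_mul_smul_comm, mul_smul]
  | zero => simp
  | add x y hx hy ihx ihy => rw [map_add, map_add, ihx, ihy, smul_add]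
  | smul r x hx ih => rw [map_smul, map_smul, ih, smul_comm]

end Cyclotomic

/-! ### Words in the last strand -/

/-- Sums of the words `x ^ k` and `c * x ^ k` with `k < r` and right coefficients in `A`, as a
right `A`-module; the two components hold the coefficients of the two kinds of words. -/
def Window (A : Type*) (r : ℕ) : Type _ := (Fin r → A) × (Fin r → A)

namespace Window

variable {R : Type*} [CommRing R] {A : Type*} [Ring A] [Algebra R A] {r : ℕ}

instance : AddCommGroup (Window A r) := inferInstanceAs (AddCommGroup ((Fin r → A) × (Fin r → A)))

instance : Module Aᵐᵒᵖ (Window A r) := inferInstanceAs (Module Aᵐᵒᵖ ((Fin r → A) × (Fin r → A)))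

instance : Module A (Window A r) := inferInstanceAs (Module A ((Fin r → A) × (Fin r → A)))

instance : Module R (Window A r) := inferInstanceAs (Module R ((Fin r → A) × (Fin r → A)))

instance : SMulCommClass A Aᵐᵒᵖ (Window A r) :=
  inferInstanceAs (SMulCommClass A Aᵐᵒᵖ ((Fin r → A) × (Fin r → A)))

instance : SMulCommClass R Aᵐᵒᵖ (Window A r) :=
  inferInstanceAs (SMulCommClass R Aᵐᵒᵖ ((Fin r → A) × (Fin r → A)))

instance : SMulCommClass Aᵐᵒᵖ R (Window A r) := SMulCommClass.symm _ _ _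

instance : IsScalarTower R A (Window A r) :=
  inferInstanceAs (IsScalarTower R A ((Fin r → A) × (Fin r → A)))

instance : IsScalarTower R Aᵐᵒᵖ (Window A r) :=
  inferInstanceAs (IsScalarTower R Aᵐᵒᵖ ((Fin r → A) × (Fin r → A)))

theorem fst_add (v w : Window A r) (i : Fin r) : (v + w).1 i = v.1 i + w.1 i := rfl

theorem snd_add (v w : Window A r) (i : Fin r) : (v + w).2 i = v.2 i + w.2 i := rfl

theorem fst_smul (a : Aᵐᵒᵖ) (v : Window A r) (i : Fin r) : (a • v).1 i = v.1 i * a.unop := rfl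

theorem snd_smul (a : Aᵐᵒᵖ) (v : Window A r) (i : Fin r) : (a • v).2 i = v.2 i * a.unop := rfl

theorem fst_lsmul (a : A) (v : Window A r) (i : Fin r) : (a • v).1 i = a * v.1 i := rfl

theorem snd_lsmul (a : A) (v : Window A r) (i : Fin r) : (a • v).2 i = a * v.2 i := rfl

theorem fst_neg (v : Window A r) (i : Fin r) : (-v).1 i = -v.1 i := rfl

theorem snd_neg (v : Window A r) (i : Fin r) : (-v).2 i = -v.2 i := rfl

theorem fst_sum {ι : Type*} (s : Finset ι) (f : ι → Window A r) (i : Fin r) :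
    (∑ k ∈ s, f k).1 i = ∑ k ∈ s, (f k).1 i :=
  map_sum (AddMonoidHom.mk' (fun v : Window A r => v.1 i) fun v w => fst_add v w i) f s

theorem snd_sum {ι : Type*} (s : Finset ι) (f : ι → Window A r) (i : Fin r) :
    (∑ k ∈ s, f k).2 i = ∑ k ∈ s, (f k).2 i :=
  map_sum (AddMonoidHom.mk' (fun v : Window A r => v.2 i) fun v w => snd_add v w i) f s

theorem ext' {A : Type*} {r : ℕ} {v w : Window A r} (h : ∀ i, v.1 i = w.1 i) (h' : ∀ i,
v.2 i = w.2 i) : v = w :=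
  Prod.ext (funext h) (funext h')

end Window

/-- The right `A`-linear operators on the window. -/
abbrev WindowEnd (A : Type*) [Ring A] (r : ℕ) : Type _ := Module.End Aᵐᵒᵖ (Window A r)

namespace Window

open MulOpposite

variable {R : Type*} [CommRing R] {A : Type*} [Ring A] [Algebra R A] {r : ℕ}

/-- The word `x ^ k` (`0` if `k` is out of range). -/
def xw (A : Type*) [Ring A] (r k : ℕ) : Window A r := (fun i => if (i : ℕ) = k then 1 else 0, 0)

/-- The word `c * x ^ k` (`0` if `k` is out of range). -/
def cw (A : Type*) [Ring A] (r k : ℕ) : Window A r := (0, fun i => if (i : ℕ) = k then 1 else 0)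

theorem xw_fst (k : ℕ) (i : Fin r) : (xw A r k).1 i = if (i : ℕ) = k then 1 else 0 := rfl

theorem xw_snd (k : ℕ) (i : Fin r) : (xw A r k).2 i = 0 := rfl

theorem cw_fst (k : ℕ) (i : Fin r) : (cw A r k).1 i = 0 := rfl

theorem cw_snd (k : ℕ) (i : Fin r) : (cw A r k).2 i = if (i : ℕ) = k then 1 else 0 := rfl

theorem eq_sum (v : Window A r) :
    v = ∑ i : Fin r, op (v.1 i) • xw A r i + ∑ i : Fin r, op (v.2 i) • cw A r i := by
  refine ext' (fun j => ?_) (fun j => ?_)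
  · rw [fst_add, fst_sum, fst_sum]
    simp [fst_smul, xw_fst, cw_fst, Fin.val_inj]
  · rw [snd_add, snd_sum, snd_sum]
    simp [snd_smul, xw_snd, cw_snd, Fin.val_inj]

theorem end_ext {φ ψ : WindowEnd A r} (h : ∀ k < r, φ (xw A r k) = ψ (xw A r k))
    (h' : ∀ k < r, φ (cw A r k) = ψ (cw A r k)) : φ = ψ := by
  refine LinearMap.ext fun v => ?_
  rw [eq_sum v]
  simp only [map_add, map_sum, map_smul, h _ (Fin.is_lt _), h' _ (Fin.is_lt _)]

/-- The operator with prescribed values on the words. -/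
def ofWords (f g : ℕ → Window A r) : WindowEnd A r where
  toFun v := ∑ i : Fin r, op (v.1 i) • f i + ∑ i : Fin r, op (v.2 i) • g i
  map_add' v w := by
    simp only [fst_add, snd_add, op_add, add_smul, Finset.sum_add_distrib]
    abel
  map_smul' a v := by
    simp only [fst_smul, snd_smul, RingHom.id_apply, smul_add, Finset.smul_sum, smul_smul, op_mul,
      op_unop]

theorem ofWords_xw (f g : ℕ → Window A r) {k : ℕ} (hk : k < r) :
    ofWords f g (xw A r k) = f k := by
  change ∑ i : Fin r, op (if (i : ℕ) = k then (1 : A) else 0) • f i + ∑ i : Fin r,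
  op (0 : A) • g i = _
  rw [Finset.sum_eq_single ⟨k, hk⟩]
  · simp
  · intro i _ hi
    rw [if_neg (fun h => hi (Fin.ext h))]
    simp
  · simp

theorem ofWords_cw (f g : ℕ → Window A r) {k : ℕ} (hk : k < r) :
    ofWords f g (cw A r k) = g k := by
  change ∑ i : Fin r, op (0 : A) • f i + ∑ i : Fin r, op (if (i : ℕ) =
      k then (1 : A) else 0) • g i = _
  rw [Finset.sum_eq_single ⟨k, hk⟩ (f := fun i : Fin r => op (if (i : ℕ) =
      k then (1 : A) else 0) • g i)]
  · simp
  · intro i _ hi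
    rw [if_neg (fun h => hi (Fin.ext h))]
    simp
  · simp

/-- Multiplication of the coefficients from the left. -/
def lam (r : ℕ) : A →+* WindowEnd A r := Module.toModuleEnd Aᵐᵒᵖ (S := A) (Window A r)

/-- The sign of the words `c * x ^ k`. -/
def sg (A : Type*) [Ring A] (r : ℕ) : WindowEnd A r where
  toFun v := (v.1, -v.2)
  map_add' _ _ := ext' (fun _ => rfl) fun _ => neg_add _ _
  map_smul' _ _ := ext' (fun _ => rfl) fun _ => (neg_mul _ _).symm

/-- Left multiplication by an odd element `a` of `A`, which has to pass the words. -/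
def lo (r : ℕ) (a : A) : WindowEnd A r := sg A r * lam r a

/-- Left multiplication by `c`. -/
def cl (A : Type*) [Ring A] (r : ℕ) : WindowEnd A r where
  toFun v := (v.2, v.1)
  map_add' _ _ := rfl
  map_smul' _ _ := rfl

theorem lam_apply (a : A) (v : Window A r) : lam r a v = a • v := rfl

theorem lam_xw (a : A) (k : ℕ) : lam r a (xw A r k) = op a • xw A r k := by
  refine ext' (fun j => ?_) (fun j => ?_)
  · simp [lam_apply, fst_lsmul, fst_smul, xw_fst]
  · simp [lam_apply, snd_lsmul, snd_smul, xw_snd]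

theorem lam_cw (a : A) (k : ℕ) : lam r a (cw A r k) = op a • cw A r k := by
  refine ext' (fun j => ?_) (fun j => ?_)
  · simp [lam_apply, fst_lsmul, fst_smul, cw_fst]
  · simp [lam_apply, snd_lsmul, snd_smul, cw_snd]

theorem sg_xw (k : ℕ) : sg A r (xw A r k) = xw A r k :=
  ext' (fun _ => rfl) fun _ => neg_zero

theorem sg_cw (k : ℕ) : sg A r (cw A r k) = -cw A r k :=
  ext' (fun _ => neg_zero.symm) fun _ => rfl

theorem lo_xw (a : A) (k : ℕ) : lo r a (xw A r k) = op a • xw A r k := by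
  rw [lo, Module.End.mul_apply, lam_xw, map_smul, sg_xw]

theorem lo_cw (a : A) (k : ℕ) : lo r a (cw A r k) = -(op a • cw A r k) := by
  rw [lo, Module.End.mul_apply, lam_cw, map_smul, sg_cw, smul_neg]

theorem cl_xw (k : ℕ) : cl A r (xw A r k) = cw A r k := rfl

theorem cl_cw (k : ℕ) : cl A r (cw A r k) = xw A r k := rfl

theorem sg_mul_sg : sg A r * sg A r = 1 :=
  LinearMap.ext fun _ => ext' (fun _ => rfl) fun _ => neg_neg _

theorem cl_mul_cl : cl A r * cl A r = 1 := rfl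

theorem sg_mul_cl : sg A r * cl A r = -(cl A r * sg A r) :=
  LinearMap.ext fun _ => ext' (fun _ => (neg_neg _).symm) fun _ => rfl

theorem sg_mul_lam (a : A) : sg A r * lam r a = lam r a * sg A r :=
  LinearMap.ext fun _ => ext' (fun _ => rfl) fun _ => (mul_neg _ _).symm

theorem cl_mul_lam (a : A) : cl A r * lam r a = lam r a * cl A r := rfl

theorem lo_mul_lo (a b : A) : lo r a * lo r b = lam r (a * b) := by
  rw [lo, lo, sg_mul_lam b, mul_assoc, ← mul_assoc (lam r a), ← map_mul, ← sg_mul_lam, ← mul_assoc,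
    sg_mul_sg, one_mul]

theorem lam_mul_lo (a b : A) : lam r a * lo r b = lo r (a * b) := by
  rw [lo, lo, ← mul_assoc, ← sg_mul_lam, mul_assoc, map_mul]

theorem lo_mul_lam (a b : A) : lo r a * lam r b = lo r (a * b) := by
  rw [lo, lo, mul_assoc, map_mul]

theorem lo_mul_cl (a : A) : lo r a * cl A r = -(cl A r * lo r a) := by
  rw [lo, mul_assoc, ← cl_mul_lam, ← mul_assoc, sg_mul_cl, neg_mul, mul_assoc]

theorem lo_sub (a b : A) : lo r (a - b) = lo r a - lo r b := by
  rw [lo, map_sub, mul_sub, lo, lo]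

theorem lam_smul_one (e : R) : lam r (e • (1 : A)) = e • (1 : WindowEnd A r) := by
  refine LinearMap.ext fun v => ?_
  rw [lam_apply, smul_assoc, one_smul]
  rfl

theorem lam_smul (e : R) (a : A) : lam r (e • a) = e • lam r a := by
  rw [← smul_one_mul, map_mul, lam_smul_one, smul_one_mul]

theorem lo_smul (e : R) (a : A) : lo r (e • a) = e • lo r a := by
  rw [lo, lam_smul, mul_smul_comm, lo]

end Window

/-! ### Moving a generator past a word -/

namespace Window

open MulOpposite

variable {R : Type*} [CommRing R] {A : Type*} [Ring A] [Algebra R A] {r : ℕ}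

theorem map_rsmul (φ : WindowEnd A r) (e : R) (v : Window A r) : φ (e • v) = e • φ v :=
  LinearMap.map_smul_of_tower φ e v

/-- The values `D (x ^ k)` and `D (c * x ^ k)` of the operator `Window.D`. -/
def dWords (r : ℕ) (e : R) (c y : A) : ℕ → Window A r × Window A r
  | 0 => (0, e • (cw A r 0 - op c • xw A r 0))
  | k + 1 =>
    (lo r c (lo r y (dWords r e c y k).1 - e • cw A r (k + 1)) + e • xw A r (k + 1),
      lo r y (dWords r e c y k).1)

/-- The twisted derivation that describes how a Hecke generator `T` passes a word: if `c`, `y` are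
the Clifford generators of the neighbouring strand, then `T * w = w' * T + D w`, where `w'` is the
word `w` in the letters `c`, `y`. -/
def D (r : ℕ) (e : R) (c y : A) : WindowEnd A r :=
  ofWords (fun k => (dWords r e c y k).1) fun k => (dWords r e c y k).2

variable {e : R} {c y : A}

theorem D_xw {k : ℕ} (hk : k < r) : D r e c y (xw A r k) = (dWords r e c y k).1 := ofWords_xw _ _ hk

theorem D_cw {k : ℕ} (hk : k < r) : D r e c y (cw A r k) = (dWords r e c y k).2 := ofWords_cw _ _ hk

theorem D_xw_zero : D r e c y (xw A r 0) = 0 := by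
  rcases Nat.eq_zero_or_pos r with rfl | hr
  · rw [show xw A 0 0 = 0 from ext' (fun i => i.elim0) fun i => i.elim0, map_zero]
  · exact D_xw hr

theorem dWords_succ_snd (k : ℕ) :
    (dWords r e c y (k + 1)).2 = lo r y (dWords r e c y k).1 := rfl

theorem lo_lo_one {a : A} (h : a * a = 1) (v : Window A r) : lo r a (lo r a v) = v := by
  rw [← Module.End.mul_apply, lo_mul_lo, h, map_one, Module.End.one_apply]

theorem rsmul_op_comm (e : R) (a : A) (v : Window A r) : e • op a • v = op a • e • v :=
  smul_comm _ _ _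

theorem op_op_one {a : A} (h : a * a = 1) (v : Window A r) : op a • op a • v = v := by
  rw [smul_smul, ← op_mul, h, op_one, one_smul]

/-- The two sequences of values determine each other. -/
theorem dWords_fst (hc : c * c = 1) (k : ℕ) : (dWords r e c y k).1 =
    lo r c ((dWords r e c y k).2 - e • cw A r k) + e • xw A r k := by
  cases k with
  | zero =>
    simp only [dWords, map_sub, map_rsmul, map_smul, lo_xw, lo_cw, smul_sub, smul_neg, op_op_one hc]
    abel
  | succ k => rfl

theorem lo_dWords_fst (hc : c * c = 1) (k : ℕ) : lo r c (dWords r e c y k).1 =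
    (dWords r e c y k).2 - e • cw A r k + e • op c • xw A r k := by
  rw [dWords_fst hc, map_add, lo_lo_one hc, map_rsmul, lo_xw]

/-- The passage of the last letter `c` through `T`: the counterpart of `T_C_succ`. -/
theorem D_mul_cl (hc : c * c = 1) :
    D r e c y * cl A r = lo r c * (D r e c y - e • 1) + e • cl A r := by
  refine end_ext (fun k hk => ?_) (fun k hk => ?_)
  · simp only [Module.End.mul_apply, LinearMap.add_apply, LinearMap.sub_apply, LinearMap.smul_apply,
      Module.End.one_apply, cl_xw, D_xw hk, D_cw hk, map_sub, map_rsmul, lo_xw,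
      lo_dWords_fst hc]
    abel
  · simp only [Module.End.mul_apply, LinearMap.add_apply, LinearMap.sub_apply, LinearMap.smul_apply,
      Module.End.one_apply, cl_cw, D_xw hk, D_cw hk, dWords_fst hc]

/-- The values of `D` are eigenvectors of the two left multiplications by `c`; see `D_mul_lo`. -/
theorem cl_dWords (hc : c * c = 1) (k : ℕ) :
    cl A r (dWords r e c y k).1 = op c • (dWords r e c y k).1 ∧
    cl A r (dWords r e c y k).2 = -(op c • (dWords r e c y k).2) := by
  have hl : ∀ (a : A) (v : Window A r), cl A r (lo r a v) = -lo r a (cl A r v) := fun a v => by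
    have := congrArg (fun φ : WindowEnd A r => φ v) (lo_mul_cl (r := r) a)
    simp only [Module.End.mul_apply, LinearMap.neg_apply] at this
    rw [this, neg_neg]
  have h2 : ∀ k, cl A r (dWords r e c y k).2 = -(op c • (dWords r e c y k).2) →
      cl A r (dWords r e c y k).1 = op c • (dWords r e c y k).1 := fun k h => by
    rw [dWords_fst hc, map_add, hl, map_sub, h, map_rsmul, cl_cw, map_rsmul, cl_xw, map_sub,
      smul_add, map_neg, map_smul, map_sub, smul_sub, map_rsmul, map_rsmul, lo_cw, lo_xw, smul_neg,
      smul_neg, ← rsmul_op_comm, ← rsmul_op_comm, op_op_one hc]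
    abel
  induction k with
  | zero =>
    refine ⟨by simp [dWords], ?_⟩
    simp only [dWords, map_sub, map_rsmul, map_smul, cl_xw, cl_cw, smul_sub, ← rsmul_op_comm,
      op_op_one hc]
    abel
  | succ k ih =>
    have h3 : cl A r (dWords r e c y (k + 1)).2 = -(op c • (dWords r e c y (k + 1)).2) := by
      rw [dWords_succ_snd, hl, ih.1, map_smul]
    exact ⟨h2 _ h3, h3⟩

/-- The passage of the neighbouring letter `c` through `T`: the counterpart of `T_C`. -/
theorem D_mul_lo (hc : c * c = 1) : D r e c y * lo r c = cl A r * D r e c y := by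
  refine end_ext (fun k hk => ?_) (fun k hk => ?_)
  · simp only [Module.End.mul_apply, lo_xw, map_smul, D_xw hk, (cl_dWords hc k).1]
  · simp only [Module.End.mul_apply, lo_cw, map_neg, map_smul, D_cw hk, (cl_dWords hc k).2]

/-- `D` commutes with the operators that supercommute with the letters `c`, `y`; the operator is
`θ`, and `g` describes it on words. -/
theorem D_commute (hc : c * c = 1) {θ : WindowEnd A r} {g : A} (η : ℤˣ)
    (h1 : ∀ k, θ (xw A r k) = op g • xw A r k) (h2 : ∀ k, θ (cw A r k) = η • op g • cw A r k)
    (hθc : θ * lo r c = η • (lo r c * θ)) (hθy : θ * lo r y = η • (lo r y * θ))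
    (hgc : g * c = η • (c * g)) :
    D r e c y * θ = θ * D r e c y := by
  have hη : ∀ v : Window A r, η • η • v = v := fun v => by
    rw [smul_smul, Int.units_mul_self, one_smul]
  have hm : ∀ (φ : WindowEnd A r) (v : Window A r), φ (η • v) = η • φ v := fun φ v => by
    rcases Int.units_eq_one_or η with rfl | rfl <;> simp
  have hs' : ∀ (v : Window A r), e • η • v = η • e • v := fun v => by
    rcases Int.units_eq_one_or η with rfl | rfl <;> simp
  have hθc' : ∀ v, θ (lo r c v) = η • lo r c (θ v) := fun v => by
    have := congrArg (fun φ : WindowEnd A r => φ v) hθc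
    rcases Int.units_eq_one_or η with rfl | rfl <;>
      simpa [Module.End.mul_apply] using this
  have hθy' : ∀ v, θ (lo r y v) = η • lo r y (θ v) := fun v => by
    have := congrArg (fun φ : WindowEnd A r => φ v) hθy
    rcases Int.units_eq_one_or η with rfl | rfl <;>
      simpa [Module.End.mul_apply] using this
  have hgc' : ∀ v : Window A r, op c • op g • v = η • op g • op c • v := fun v => by
    rw [smul_smul, smul_smul, ← op_mul, ← op_mul, hgc]
    rcases Int.units_eq_one_or η with rfl | rfl <;> simp
  have key : ∀ k, θ (dWords r e c y k).1 = op g • (dWords r e c y k).1 ∧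
      θ (dWords r e c y k).2 = η • op g • (dWords r e c y k).2 := by
    have aux : ∀ k, θ (dWords r e c y k).2 = η • op g • (dWords r e c y k).2 →
        θ (dWords r e c y k).1 = op g • (dWords r e c y k).1 := fun k h => by
      rw [dWords_fst hc, map_add, hθc', map_sub, h, map_rsmul, h2, hs', map_rsmul, h1,
        ← smul_sub, hm, hη, smul_add, rsmul_op_comm, rsmul_op_comm, ← smul_sub, map_smul]
    intro k
    induction k with
    | zero =>
      refine ⟨by simp [dWords], ?_⟩
      simp only [dWords, map_rsmul, map_sub, h2, map_smul, h1, hgc', smul_sub, rsmul_op_comm, hs']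
    | succ k ih =>
      have h3 : θ (dWords r e c y (k + 1)).2 = η • op g • (dWords r e c y (k + 1)).2 := by
        rw [dWords_succ_snd, hθy', ih.1, map_smul]
      exact ⟨aux _ h3, h3⟩
  refine end_ext (fun k hk => ?_) (fun k hk => ?_)
  · simp only [Module.End.mul_apply, h1, map_smul, D_xw hk, (key k).1]
  · simp only [Module.End.mul_apply, h2, hm, map_smul, D_cw hk, (key k).2]

theorem D_mul_lam_of_commute (hc : c * c = 1) {g : A} (h1 : g * c = c * g) (h2 : g * y = y * g) :
    D r e c y * lam r g = lam r g * D r e c y := by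
  refine D_commute hc 1 (lam_xw g) (fun k => by rw [one_smul, lam_cw]) ?_ ?_ (by rw [one_smul, h1])
  · rw [one_smul, lam_mul_lo, lo_mul_lam, h1]
  · rw [one_smul, lam_mul_lo, lo_mul_lam, h2]

theorem D_mul_lo_of_anti (hc : c * c = 1) {g : A} (h1 : g * c = -(c * g))
    (h2 : g * y = -(y * g)) :
    D r e c y * lo r g = lo r g * D r e c y := by
  refine D_commute hc (-1) (lo_xw g) (fun k => by rw [lo_cw]; simp) ?_ ?_ (by rw [h1]; simp)
  · rw [lo_mul_lo, lo_mul_lo, h1, map_neg]; simp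
  · rw [lo_mul_lo, lo_mul_lo, h2, map_neg]; simp

end Window

/-! ### The braid relation on words and left multiplication by the last involution -/

namespace Window

open MulOpposite

variable {R : Type*} [CommRing R] {A : Type*} [Ring A] [Algebra R A] {r : ℕ} {e : R} {c y : A}

theorem apply_of_mul_eq {φ ψ φ' ψ' : WindowEnd A r} (h : φ * ψ = φ' * ψ') (v : Window A r) :
    φ (ψ v) = φ' (ψ' v) := congrArg (fun θ : WindowEnd A r => θ v) h

/-- The relation between the operators `D` of two neighbouring strands, on which the braid relation
rests. -/
theorem D_braid {c' y' t : A} (hc : c * c = 1) (hc' : c' * c' = 1) (hcc : c * c' = -(c' * c))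
    (hyy : y * y' = -(y' * y)) (hcy : c * y' = -(y' * c)) (hyc : y * c' = -(c' * y))
    (htc : t * c = c' * t) (htc' : t * c' = c * t - e • (c - c')) (hty : t * y' = y * t) :
    D r e c y * lam r t + D r e c' y' * D r e c y = lam r t * D r e c' y' + e • D r e c y := by
  set E : WindowEnd A r := D r e c y * lam r t + D r e c' y' * D r e c y -
    (lam r t * D r e c' y' + e • D r e c y) with hE
  have k1 : D r e c' y' * lo r c = lo r c * D r e c' y' := D_mul_lo_of_anti hc' hcc hcy
  have k2 : D r e c' y' * lo r y = lo r y * D r e c' y' := D_mul_lo_of_anti hc' hyc hyy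
  have k3 : lam r t * lo r c = lo r c' * lam r t := by rw [lam_mul_lo, lo_mul_lam, htc]
  have k4 : lam r t * lo r c' = lo r c * lam r t - e • (lo r c - lo r c') := by
    rw [lam_mul_lo, lo_mul_lam, htc', lo_sub, lo_smul, lo_sub]
  have k5 : lam r t * lo r y' = lo r y * lam r t := by rw [lam_mul_lo, lo_mul_lam, hty]
  have hcl : E * cl A r = lo r c * E := by
    have a1 : D r e c y * lam r t * cl A r =
        lo r c * (D r e c y * lam r t) - e • (lo r c * lam r t) + e • (cl A r * lam r t) := by
      rw [mul_assoc, ← cl_mul_lam, ← mul_assoc, D_mul_cl hc, add_mul, mul_sub, mul_smul_comm,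
        mul_one, sub_mul, smul_mul_assoc, smul_mul_assoc, mul_assoc]
    have a2 : D r e c' y' * D r e c y * cl A r =
        lo r c * (D r e c' y' * D r e c y) - e • (lo r c * D r e c' y') +
          e • (lo r c' * D r e c' y') - e • e • lo r c' + e • e • cl A r := by
      rw [mul_assoc, D_mul_cl hc, mul_add, ← mul_assoc, k1, mul_smul_comm, D_mul_cl hc', mul_sub,
        mul_sub, mul_smul_comm, mul_smul_comm, mul_one, mul_one, mul_assoc, smul_add, smul_sub]
      abel
    have a3 : lam r t * D r e c' y' * cl A r =
        lo r c * (lam r t * D r e c' y') - e • (lo r c * D r e c' y')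
          + e • (lo r c' * D r e c' y') - e • (lo r c * lam r t) + e • e • lo r c
          - e • e • lo r c' + e • (cl A r * lam r t) := by
      rw [mul_assoc, D_mul_cl hc', mul_add, ← mul_assoc, k4, mul_smul_comm, ← cl_mul_lam, mul_sub,
        sub_mul, mul_smul_comm, mul_one, smul_mul_assoc, sub_mul, mul_assoc, smul_sub, smul_sub,
        smul_sub, smul_sub]
      abel
    have a4 : e • D r e c y * cl A r =
        e • (lo r c * D r e c y) - e • e • lo r c + e • e • cl A r := by
      rw [smul_mul_assoc, D_mul_cl hc, mul_sub, mul_smul_comm, mul_one, smul_add, smul_sub]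
    rw [hE, sub_mul, add_mul, add_mul, a1, a2, a3, a4, mul_sub, mul_add, mul_add, mul_smul_comm]
    abel
  have hcw : ∀ k, E (xw A r k) = 0 → E (cw A r k) = 0 := fun k h => by
    rw [← cl_xw, apply_of_mul_eq hcl, h, map_zero]
  have hxw : ∀ k, E (cw A r k) = 0 → E (xw A r k) = 0 := fun k h => by
    rw [← cl_cw, apply_of_mul_eq hcl, h, map_zero]
  have hstep : ∀ k, k + 1 < r → E (cw A r (k + 1)) = lo r y (E (xw A r k)) := fun k hk => by
    have hk' : k < r := by omega
    simp only [hE, LinearMap.sub_apply, LinearMap.add_apply, Module.End.mul_apply,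
      LinearMap.smul_apply, lam_cw, lam_xw, map_smul, D_cw hk, D_xw hk', dWords_succ_snd,
      map_sub, map_add, map_rsmul, apply_of_mul_eq k2, apply_of_mul_eq k5]
  have hall : ∀ k < r, E (xw A r k) = 0 := by
    intro k hk
    induction k with
    | zero => simp [hE, D_xw_zero, lam_xw, Module.End.mul_apply]
    | succ k ih => exact hxw _ (by rw [hstep k hk, ih (by omega), map_zero])
  have h0 : E = 0 := end_ext (fun k hk => by simp [hall k hk]) fun k hk => by
    simp [hcw k (hall k hk)]
  exact sub_eq_zero.1 h0

/-- Left multiplication by `y` on words, the powers of `x` being reduced modulo the palindromic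
polynomial `P` of degree `r`. -/
def yb (P : R[X]) (A : Type*) [Ring A] [Algebra R A] (r : ℕ) : WindowEnd A r :=
  ofWords
    (fun k => if k + 1 < r then cw A r (k + 1) else
      -∑ j ∈ Finset.range r, P.coeff j • cw A r j)
    (fun k => if k = 0 then -(P.coeff 0 • ∑ j ∈ Finset.range r, P.coeff (j + 1) • xw A r j)
      else xw A r (k - 1))

variable {P : R[X]} {s : R}

theorem yb_xw_of_lt {k : ℕ} (hk : k + 1 < r) : yb P A r (xw A r k) = cw A r (k + 1) := by
  rw [yb, ofWords_xw _ _ (by omega), if_pos hk]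

theorem yb_xw_last {k : ℕ} (hk : k + 1 = r) :
    yb P A r (xw A r k) = -∑ j ∈ Finset.range r, P.coeff j • cw A r j := by
  rw [yb, ofWords_xw _ _ (by omega), if_neg (by omega)]

theorem yb_cw_zero (hr : 0 < r) : yb P A r (cw A r 0) =
    -(P.coeff 0 • ∑ j ∈ Finset.range r, P.coeff (j + 1) • xw A r j) := by
  rw [yb, ofWords_cw _ _ hr, if_pos rfl]

theorem yb_cw_succ {k : ℕ} (hk : k + 1 < r) : yb P A r (cw A r (k + 1)) = xw A r k := by
  rw [yb, ofWords_cw _ _ hk, if_neg (by omega), Nat.add_sub_cancel]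

/-- The operator `yb` commutes up to the sign `η` with an operator that multiplies the words by
coefficients `g` from the right, with the sign `η` on the words `c * x ^ k`. -/
theorem yb_comm_aux {θ : WindowEnd A r} {g : A} (η : R)
    (h1 : ∀ k, θ (xw A r k) = op g • xw A r k) (h2 : ∀ k, θ (cw A r k) = η • op g • cw A r k)
    (hη : η * η = 1) :
    yb P A r * θ = η • (θ * yb P A r) := by
  have hs : ∀ v : Window A r, η • η • v = v := fun v => by rw [smul_smul, hη, one_smul]
  refine end_ext (fun k hk => ?_) (fun k hk => ?_)
  · rw [LinearMap.smul_apply, Module.End.mul_apply, Module.End.mul_apply, h1, map_smul]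
    by_cases h : k + 1 < r
    · rw [yb_xw_of_lt h, h2, hs]
    · rw [yb_xw_last (by omega)]
      simp only [map_neg, map_sum, map_rsmul, h2, smul_neg, Finset.smul_sum,
        smul_comm η (_ : R), hs, rsmul_op_comm]
  · rw [LinearMap.smul_apply, Module.End.mul_apply, Module.End.mul_apply, h2, map_rsmul, map_smul]
    cases k with
    | zero =>
      rw [yb_cw_zero hk]
      simp only [map_neg, map_sum, map_rsmul, h1, smul_neg, Finset.smul_sum, rsmul_op_comm]
    | succ k => rw [yb_cw_succ hk, h1]

theorem yb_mul_lam (g : A) : yb P A r * lam r g = lam r g * yb P A r := by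
  have := yb_comm_aux (P := P) (θ := lam r g) (1 : R) (lam_xw g)
    (fun k => by rw [one_smul, lam_cw]) (one_mul 1)
  rwa [one_smul] at this

theorem yb_mul_lo (g : A) : yb P A r * lo r g = -(lo r g * yb P A r) := by
  have := yb_comm_aux (P := P) (θ := lo r g) (-1 : R) (lo_xw g)
    (fun k => by rw [lo_cw, neg_smul, one_smul]) (by simp)
  rwa [neg_smul, one_smul] at this

/-- The reduction modulo `P` is compatible with `y * y = 1` because `P` is palindromic. -/
theorem yb_mul_yb (hP : IsPalindromic P r s) : yb P A r * yb P A r = 1 := by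
  have hs : ∀ v : Window A r, P.coeff 0 • P.coeff 0 • v = v := fun v => by
    rw [hP.coeff_zero, smul_smul, hP.sq, one_smul]
  refine end_ext (fun k hk => ?_) (fun k hk => ?_)
  · rw [Module.End.mul_apply, Module.End.one_apply]
    by_cases h : k + 1 < r
    · rw [yb_xw_of_lt h, yb_cw_succ h]
    · obtain rfl : r = k + 1 := by omega
      have h0 : ∑ j ∈ Finset.range k, yb P A (k + 1) (P.coeff (j + 1) • cw A (k + 1) (j + 1)) =
          ∑ j ∈ Finset.range k, P.coeff (j + 1) • xw A (k + 1) j := by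
        refine Finset.sum_congr rfl fun j hj => ?_
        rw [map_rsmul, yb_cw_succ (by have := Finset.mem_range.1 hj; omega)]
      rw [yb_xw_last rfl, map_neg, map_sum, Finset.sum_range_succ', map_rsmul,
        yb_cw_zero (Nat.succ_pos k), smul_neg, hs, Finset.sum_range_succ, hP.coeff_top, one_smul,
        h0]
      abel
  · rw [Module.End.mul_apply, Module.End.one_apply]
    cases k with
    | zero =>
      obtain ⟨k, rfl⟩ : ∃ k, r = k + 1 := ⟨r - 1, by omega⟩
      rw [yb_cw_zero hk, map_neg, map_rsmul, map_sum, Finset.sum_range_succ, map_rsmul,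
        yb_xw_last rfl, hP.coeff_top, one_smul, Finset.sum_range_succ', neg_add, smul_add,
        smul_add, smul_neg _ (P.coeff 0 • _), hs]
      have h0 : ∑ j ∈ Finset.range k, yb P A (k + 1) (P.coeff (j + 1) • xw A (k + 1) j) =
          ∑ j ∈ Finset.range k, P.coeff (j + 1) • cw A (k + 1) (j + 1) := by
        refine Finset.sum_congr rfl fun j hj => ?_
        rw [map_rsmul, yb_xw_of_lt (by have := Finset.mem_range.1 hj; omega)]
      rw [h0, smul_neg]
      abel
    | succ k => rw [yb_cw_succ hk, yb_xw_of_lt hk]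

end Window

/-! ### The commutator of the two operators -/

namespace Window

open MulOpposite

variable {R : Type*} [CommRing R] {A : Type*} [Ring A] [Algebra R A] {r : ℕ} {e : R} {c y : A}
  {P : R[X]} {s : R}

theorem dWords_succ_snd' (hc : c * c = 1) (k : ℕ) : (dWords r e c y (k + 1)).2 =
    lam r (y * c) (dWords r e c y k).2 - e • op (y * c) • cw A r k + e • op y • xw A r k := by
  rw [dWords_succ_snd, dWords_fst hc, map_add, apply_of_mul_eq ((lo_mul_lo y c).trans (mul_one _).symm),
    Module.End.one_apply, map_sub, map_rsmul, map_rsmul, lam_cw, lo_xw]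

/-- Left multiplication by `x` on words. -/
def xb (P : R[X]) (A : Type*) [Ring A] [Algebra R A] (r : ℕ) : WindowEnd A r := cl A r * yb P A r

theorem xb_pow_xw_zero (k : ℕ) (hk : k < r) : (xb P A r ^ k) (xw A r 0) = xw A r k := by
  induction k with
  | zero => rfl
  | succ k ih =>
    rw [pow_succ', Module.End.mul_apply, ih (by omega), xb, Module.End.mul_apply, yb_xw_of_lt hk,
      cl_cw]

theorem aeval_xb (hr : 0 < r) (hP : IsPalindromic P r s) :
    ∑ k ∈ Finset.range (r + 1), P.coeff k • (xb P A r ^ k) (xw A r 0) = 0 := by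
  obtain ⟨k, rfl⟩ : ∃ k, r = k + 1 := ⟨r - 1, by omega⟩
  rw [Finset.sum_range_succ, Finset.sum_congr rfl fun j hj => by
    rw [xb_pow_xw_zero j (Finset.mem_range.1 hj)], hP.coeff_top, one_smul, pow_succ',
    Module.End.mul_apply, xb_pow_xw_zero k (Nat.lt_succ_self k), xb, Module.End.mul_apply,
    yb_xw_last rfl, map_neg, map_sum]
  simp only [map_rsmul, cl_cw, add_neg_cancel]

/-- The polynomial `P` in `x` evaluated through the values of `D` at the words `c * x ^ k`. -/
def kap (P : R[X]) (r : ℕ) (e : R) (c y : A) : Window A r :=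
  ∑ j ∈ Finset.range (r + 1), P.coeff j • (dWords r e c y j).2

/-- The failure of `D` to pass from `yb` to the multiplication by the neighbouring letter `y`. -/
def delta (P : R[X]) (r : ℕ) (e : R) (c y : A) : WindowEnd A r :=
  D r e c y * yb P A r - lo r y * D r e c y

theorem delta_xw {k : ℕ} (hk : k + 1 < r) : delta P r e c y (xw A r k) = 0 := by
  rw [delta, LinearMap.sub_apply, Module.End.mul_apply, Module.End.mul_apply, yb_xw_of_lt hk,
    D_cw hk, D_xw (by omega), dWords_succ_snd, sub_self]

theorem delta_xw_last (hP : IsPalindromic P r s) {k : ℕ} (hk : k + 1 = r) :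
    delta P r e c y (xw A r k) = -kap P r e c y := by
  have h : lo r y (D r e c y (xw A r k)) = (dWords r e c y r).2 := by
    rw [D_xw (by omega), ← hk, dWords_succ_snd]
  rw [delta, LinearMap.sub_apply, Module.End.mul_apply, Module.End.mul_apply, yb_xw_last hk, h, kap,
    Finset.sum_range_succ, hP.coeff_top, one_smul, map_neg, map_sum, neg_add, sub_eq_add_neg]
  congr 2
  exact Finset.sum_congr rfl fun j hj => by rw [map_rsmul, D_cw (Finset.mem_range.1 hj)]

theorem delta_cw_succ (hy : y * y = 1) {k : ℕ} (hk : k + 1 < r) :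
    delta P r e c y (cw A r (k + 1)) = 0 := by
  rw [delta, LinearMap.sub_apply, Module.End.mul_apply, Module.End.mul_apply, yb_cw_succ hk,
    D_cw hk, D_xw (by omega), dWords_succ_snd, lo_lo_one hy, sub_self]

theorem delta_cw_zero (hP : IsPalindromic P r s) (hy : y * y = 1) (hr : 0 < r) :
    delta P r e c y (cw A r 0) = -(s • lo r y (kap P r e c y)) := by
  rw [delta, LinearMap.sub_apply, Module.End.mul_apply, Module.End.mul_apply, yb_cw_zero hr,
    D_cw hr, kap, Finset.sum_range_succ', map_neg, map_rsmul, map_add, smul_add, neg_add,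
    hP.coeff_zero, map_rsmul, smul_smul s s, hP.sq, one_smul, sub_eq_add_neg, map_sum, map_sum]
  congr 3
  exact Finset.sum_congr rfl fun j hj => by
    rw [map_rsmul, map_rsmul, D_xw (Finset.mem_range.1 hj), dWords_succ_snd, lo_lo_one hy]

/-- Left multiplication by the last letter `y` plus right multiplication by the neighbouring one, on
the value of `D` at `c * x ^ k`. Each term on the right-hand side is a linear function of the `k`-th
power of `x`, of `c * y` or of `y * c`, so that it vanishes on summing with the coefficients of `P`.
-/
theorem yb_dWords (hP : IsPalindromic P r s) (hc : c * c = 1) (hy : y * y = 1) {k : ℕ}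
    (hk : k ≤ r) :
    yb P A r (dWords r e c y k).2 + op y • (dWords r e c y k).2 =
      e • (op y • cl A r ((xb P A r ^ k) (xw A r 0)) - op (c * (c * y) ^ k) • yb P A r (xw A r 0)
        + yb P A r (cl A r ((xb P A r ^ k) (xw A r 0))) - op (c * y * (y * c) ^ k) • xw A r 0) := by
  have hxy : y * c * (c * y) = 1 := by rw [mul_assoc, ← mul_assoc c, hc, one_mul, hy]
  have hyx : c * y * (y * c) = 1 := by rw [mul_assoc, ← mul_assoc y, hy, one_mul, hc]
  induction k with
  | zero =>
    simp only [dWords, map_rsmul, map_sub, map_smul, pow_zero, mul_one, Module.End.one_apply, cl_xw,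
      ← rsmul_op_comm, smul_sub, smul_smul _ _ (xw A r 0), ← op_mul,
      smul_add]
    simp only [← smul_sub, ← smul_add]
    congr 1
    abel
  | succ k ih =>
    have hk' : k < r := hk
    have e1 : (xb P A r ^ (k + 1)) (xw A r 0) = cl A r (yb P A r (xw A r k)) := by
      rw [pow_succ', Module.End.mul_apply, xb_pow_xw_zero k hk']
      rfl
    have hcc : ∀ v, cl A r (cl A r v) = v := fun v => rfl
    have hyy : ∀ v, yb P A r (yb P A r v) = v := fun v => by
      rw [← Module.End.mul_apply, yb_mul_yb hP, Module.End.one_apply]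
    have l1 : yb P A r (lam r (y * c) (dWords r e c y k).2) + op y • lam r (y *
        c) (dWords r e c y k).2
        = lam r (y * c) (yb P A r (dWords r e c y k).2 + op y • (dWords r e c y k).2) := by
      rw [map_add, map_smul, apply_of_mul_eq (yb_mul_lam (y * c))]
    have l2 : ∀ v, lam r (y * c) (yb P A r v) = yb P A r (lam r (y * c) v) := fun v =>
      (apply_of_mul_eq (yb_mul_lam (y * c)) v).symm
    have e2 : y * c * (c * (c * y) ^ k) = c * (c * y) ^ (k + 1) := by
      rw [pow_succ', ← mul_assoc, ← mul_assoc, ← mul_assoc, mul_assoc y c c, hc, mul_one, one_mul]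
    have e3 : y * c * (c * y * (y * c) ^ k) = c * y * (y * c) ^ (k + 1) := by
      rw [pow_succ', ← mul_assoc, hxy, ← mul_assoc, hyx]
    rw [dWords_succ_snd' hc, map_add, map_sub, smul_add, smul_sub, e1, hcc, hyy,
      add_add_add_comm, sub_add_sub_comm, l1, ih (by omega), xb_pow_xw_zero k hk']
    simp only [map_rsmul, map_smul, map_add, map_sub, cl_xw, lam_cw, lam_xw, l2, ← rsmul_op_comm,
      smul_smul (_ : Aᵐᵒᵖ) (_ : Aᵐᵒᵖ), ← op_mul, e2, e3, hy, op_one, one_smul]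
    simp only [← smul_sub, ← smul_add]
    congr 1
    abel

/-- Left multiplication by the last letter `y` acts on `kap` as minus the right multiplication by
the neighbouring one. -/
theorem yb_kap (hr : 0 < r) (hP : IsPalindromic P r s) (hc : c * c = 1) (hy : y * y = 1)
    (hx : Polynomial.aeval (c * y) P = 0) :
    yb P A r (kap P r e c y) = -(op y • kap P r e c y) := by
  have hyx : c * y * (y * c) = 1 := by rw [mul_assoc, ← mul_assoc y, hy, one_mul, hc]
  have h0 := aeval_xb (A := A) hr hP
  have hev : ∀ x : A, ∑ k ∈ Finset.range (r + 1), P.coeff k • x ^ k = Polynomial.aeval x P :=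
    fun x => (Polynomial.aeval_eq_sum_range' (Nat.lt_succ_of_le hP.natDegree_le) x).symm
  have h1 := hev (c * y)
  have h2 := hev (y * c)
  rw [hP.aeval_inv hyx, hx, zero_mul, smul_zero] at h2
  rw [hx] at h1
  rw [← sub_eq_zero, sub_neg_eq_add, kap, map_sum, Finset.smul_sum, ← Finset.sum_add_distrib]
  have h3 : ∀ k ∈ Finset.range (r + 1), yb P A r (P.coeff k • (dWords r e c y k).2) +
      op y • P.coeff k • (dWords r e c y k).2 =
      e • (op y • cl A r (P.coeff k • (xb P A r ^ k) (xw A r 0))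
        - op (c * (P.coeff k • (c * y) ^ k)) • yb P A r (xw A r 0)
        + yb P A r (cl A r (P.coeff k • (xb P A r ^ k) (xw A r 0)))
        - op (c * y * (P.coeff k • (y * c) ^ k)) • xw A r 0) := by
    intro k hk
    rw [map_rsmul, ← rsmul_op_comm, ← smul_add,
      yb_dWords hP hc hy (by have := Finset.mem_range.1 hk; omega), smul_comm]
    simp only [mul_smul_comm, op_smul, smul_assoc, map_rsmul, smul_add, smul_sub, rsmul_op_comm]
  rw [Finset.sum_congr rfl h3, ← Finset.smul_sum, Finset.sum_sub_distrib, Finset.sum_add_distrib,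
    Finset.sum_sub_distrib, ← Finset.smul_sum, ← map_sum, ← map_sum, ← map_sum, h0,
    ← Finset.sum_smul, ← Finset.sum_smul]
  have h4 : ∀ (a : A) (f : ℕ → A), ∑ k ∈ Finset.range (r + 1), op (a * f k) =
      op (a * ∑ k ∈ Finset.range (r + 1), f k) := fun a f => by
    rw [Finset.mul_sum]
    exact (map_sum (opAddEquiv : A ≃+ Aᵐᵒᵖ) _ _).symm
  rw [h4, h4, h1, h2]
  simp

theorem fst_rsmul (a : R) (v : Window A r) (i : Fin r) : (a • v).1 i = a • v.1 i := rfl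

theorem snd_rsmul (a : R) (v : Window A r) (i : Fin r) : (a • v).2 i = a • v.2 i := rfl

/-- With `kap_fst`, these are the two coefficients of `kap` that `delta` sees. -/
theorem kap_snd (hP : IsPalindromic P r s) (hc : c * c = 1) (i : Fin r) (hi : (i : ℕ) = 0) :
    (kap P r e c y).2 i = (s * e) • (1 : A) := by
  have h0 : (dWords r e c y 0).2.2 i = e • (1 : A) := by
    simp only [dWords, sub_eq_add_neg, snd_rsmul, snd_add, snd_neg, snd_smul, cw_snd, xw_snd,
      if_pos hi, zero_mul, neg_zero, add_zero]
  have h : ∀ k, (dWords r e c y (k + 1)).2.2 i = 0 := by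
    intro k
    rw [dWords_succ_snd' hc, sub_eq_add_neg, snd_add, snd_add, snd_neg, snd_rsmul, snd_rsmul,
      snd_smul, snd_smul, cw_snd, xw_snd, lam_apply, snd_lsmul, zero_mul, smul_zero, add_zero]
    induction k with
    | zero => rw [h0, if_pos hi, unop_op, one_mul, mul_smul_comm, mul_one, add_neg_cancel]
    | succ k ih =>
      have hik : (i : ℕ) ≠ k + 1 := by omega
      rw [if_neg hik, zero_mul, smul_zero, neg_zero, add_zero, dWords_succ_snd' hc,
        sub_eq_add_neg, snd_add, snd_add, snd_neg, snd_rsmul, snd_rsmul, snd_smul, snd_smul, cw_snd,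
        xw_snd, lam_apply, snd_lsmul, zero_mul, smul_zero, add_zero, ih, mul_zero]
  rw [kap, snd_sum, Finset.sum_range_succ', snd_rsmul, h0, hP.coeff_zero, smul_smul,
    Finset.sum_eq_zero fun k _ => by rw [snd_rsmul, h, smul_zero], zero_add]

theorem kap_fst (hP : IsPalindromic P r s) (hc : c * c = 1)
    (hx : Polynomial.aeval (c * y) P = 0) (i : Fin r)
    (hi : (i : ℕ) + 1 = r) : (kap P r e c y).1 i = e • y := by
  have h0 : (dWords r e c y 0).2.1 i = if r = 1 then -(e • c) else 0 := by
    simp only [dWords, sub_eq_add_neg, fst_rsmul, fst_add, fst_neg, fst_smul, cw_fst, xw_fst,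
      zero_add, unop_op]
    by_cases h : r = 1
    · rw [if_pos h, if_pos (by omega), one_mul, smul_neg]
    · rw [if_neg h, if_neg (by omega), zero_mul, neg_zero, smul_zero]
  have hs : ∀ k, (dWords r e c y (k + 1)).2.1 i =
      y * c * (dWords r e c y k).2.1 i + if k + 1 = r then e • y else 0 := by
    intro k
    rw [dWords_succ_snd' hc, sub_eq_add_neg, fst_add, fst_add, fst_neg, fst_rsmul, fst_rsmul,
      fst_smul, fst_smul, cw_fst, xw_fst, lam_apply, fst_lsmul, zero_mul, smul_zero, neg_zero,
      add_zero, unop_op]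
    by_cases h : k + 1 = r
    · rw [if_pos h, if_pos (by omega), one_mul]
    · rw [if_neg h, if_neg (by omega), zero_mul, smul_zero]
  by_cases hr : r = 1
  · subst hr
    have hy : s • (1 : A) + c * y = 0 := by
      have := Polynomial.aeval_eq_sum_range' (Nat.lt_succ_of_le hP.natDegree_le) (c * y)
      rw [hx, Finset.sum_range_succ, Finset.sum_range_one, hP.coeff_top, hP.coeff_zero, pow_zero,
        pow_one, one_smul] at this
      exact this.symm
    have hy' : y = -(s • c) := by
      have h := congrArg (c * ·) hy
      simp only [mul_add, ← mul_assoc, hc, one_mul, mul_zero, mul_smul_comm, mul_one] at h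
      rw [eq_neg_iff_add_eq_zero, add_comm, h]
    rw [kap, fst_sum, Finset.sum_range_succ, Finset.sum_range_one, fst_rsmul, fst_rsmul, hs, h0,
      if_pos rfl, if_pos rfl, hP.coeff_top, hP.coeff_zero, mul_neg, mul_smul_comm, mul_assoc, hc,
      mul_one, neg_add_cancel, smul_zero, add_zero, hy', smul_neg, smul_neg, smul_smul, smul_smul,
      mul_comm]
  · have h : ∀ k < r, (dWords r e c y k).2.1 i = 0 := by
      intro k hk
      induction k with
      | zero => rw [h0, if_neg hr]
      | succ k ih => rw [hs, ih (by omega), if_neg (by omega), mul_zero, add_zero]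
    obtain ⟨k, rfl⟩ : ∃ k, r = k + 1 := ⟨r - 1, by omega⟩
    rw [kap, fst_sum, Finset.sum_range_succ, fst_rsmul, hs, h k (by omega), if_pos rfl, mul_zero,
      zero_add, hP.coeff_top, one_smul, Finset.sum_eq_zero, zero_add]
    intro j hj
    rw [fst_rsmul, h j (Finset.mem_range.1 hj), smul_zero]

/-- `delta` has rank one up to left multiplication by `y`: its values involve only `kap`. -/
theorem delta_apply (hP : IsPalindromic P r s) (hy : y * y = 1) (hr : 0 < r) (v : Window A r) :
    delta P r e c y v = -(op (v.1 ⟨r - 1, by omega⟩) • kap P r e c y) -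
      op (v.2 ⟨0, hr⟩) • s • lo r y (kap P r e c y) := by
  conv_lhs => rw [eq_sum v]
  rw [map_add, map_sum, map_sum, Finset.sum_eq_single ⟨r - 1, by omega⟩,
    Finset.sum_eq_single ⟨0, hr⟩, map_smul, map_smul, delta_xw_last hP (by simp; omega),
    delta_cw_zero hP hy hr, smul_neg, smul_neg, sub_eq_add_neg]
  · intro j _ hj
    obtain ⟨k, hk⟩ : ∃ k, (j : ℕ) = k + 1 :=
      ⟨j - 1, by have : (j : ℕ) ≠ 0 := fun h => hj (Fin.ext h)
                 omega⟩
    rw [map_smul, hk, delta_cw_succ hy (by omega), smul_zero]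
  · simp
  · intro j _ hj
    rw [map_smul, delta_xw, smul_zero]
    have : (j : ℕ) ≠ r - 1 := fun h => hj (Fin.ext h)
    omega
  · simp

/-- With `delta_mul_delta`, the relations of `delta` from which the anticommutation of the first two
`Y` follows on the tower. -/
theorem delta_mul_lo (hr : 0 < r) (hP : IsPalindromic P r s) (hc : c * c = 1) (hy : y * y = 1)
    (hx : Polynomial.aeval (c * y) P = 0) :
    delta P r e c y * lo r y = -(yb P A r * delta P r e c y) := by
  have hk := yb_kap (e := e) hr hP hc hy hx
  have hl : ∀ v, yb P A r (lo r y v) = -lo r y (yb P A r v) := fun v =>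
    apply_of_mul_eq ((yb_mul_lo y).trans (neg_mul _ _).symm) v
  refine end_ext (fun k hk' => ?_) (fun k hk' => ?_)
  · rw [LinearMap.neg_apply, Module.End.mul_apply, Module.End.mul_apply, lo_xw, map_smul]
    by_cases h : k + 1 < r
    · rw [delta_xw h, smul_zero, map_zero, neg_zero]
    · rw [delta_xw_last hP (by omega), smul_neg, map_neg, hk, neg_neg]
  · rw [LinearMap.neg_apply, Module.End.mul_apply, Module.End.mul_apply, lo_cw, map_neg, map_smul]
    cases k with
    | zero =>
      rw [delta_cw_zero hP hy hr, smul_neg, map_neg, map_rsmul, hl, hk, map_neg, map_smul, neg_neg,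
        neg_neg, neg_neg, rsmul_op_comm]
    | succ k => rw [delta_cw_succ hy hk', smul_zero, map_zero]

theorem delta_mul_delta (hr : 0 < r) (hP : IsPalindromic P r s) (hc : c * c = 1) (hy : y * y = 1)
    (hx : Polynomial.aeval (c * y) P = 0) :
    delta P r e c y * delta P r e c y = e • ((yb P A r - lo r y) * delta P r e c y) := by
  have hk := yb_kap (e := e) hr hP hc hy hx
  have hl : ∀ v, yb P A r (lo r y v) = -lo r y (yb P A r v) := fun v =>
    apply_of_mul_eq ((yb_mul_lo y).trans (neg_mul _ _).symm) v
  have hdk : delta P r e c y (kap P r e c y) =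
      -(e • (op y • kap P r e c y + lo r y (kap P r e c y))) := by
    rw [delta_apply hP hy hr, kap_snd hP hc ⟨0, hr⟩ rfl,
      kap_fst hP hc hx ⟨r - 1, by omega⟩ (Nat.sub_add_cancel hr), op_smul, op_smul, op_one,
      smul_assoc, smul_assoc, one_smul, smul_smul (s * e), mul_right_comm, hP.sq, one_mul, smul_add,
      neg_add, sub_eq_add_neg]
  have hdl : delta P r e c y (lo r y (kap P r e c y)) =
      -(yb P A r (delta P r e c y (kap P r e c y))) :=
    apply_of_mul_eq ((delta_mul_lo hr hP hc hy hx).trans (neg_mul _ _).symm) _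
  refine end_ext (fun k hk' => ?_) (fun k hk' => ?_)
  · rw [LinearMap.smul_apply, Module.End.mul_apply, Module.End.mul_apply, LinearMap.sub_apply]
    by_cases h : k + 1 < r
    · rw [delta_xw h, map_zero, map_zero, map_zero, sub_zero, smul_zero]
    · rw [delta_xw_last hP (by omega), map_neg, hdk, map_neg, map_neg, hk, neg_neg, neg_neg,
        sub_neg_eq_add]
  · rw [LinearMap.smul_apply, Module.End.mul_apply, Module.End.mul_apply, LinearMap.sub_apply]
    cases k with
    | zero =>
      rw [delta_cw_zero hP hy hr]
      simp only [map_neg, map_rsmul, hdl, hdk, map_add, map_smul, hl, hk, lo_lo_one hy, smul_neg,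
        op_op_one hy, neg_neg, smul_add, neg_add, smul_sub, smul_comm e s]
      abel
    | succ k => rw [delta_cw_succ hy hk', map_zero, map_zero, map_zero, sub_zero, smul_zero]

end Window

/-! ### Operators on the tower -/

/-- The direct sum of `n + 1` copies of the window. The `j`-th copy stands for the words
`T_j ⋯ T_{n-1} w` with `w` in the span of the words `x ^ k`, `c * x ^ k` in the letters of the last
strand, with right coefficients in `A`. -/
def Tower (A : Type*) (n r : ℕ) : Type _ := Fin (n + 1) → Window A r

namespace Tower

variable {R : Type*} [CommRing R] {A : Type*} [Ring A] [Algebra R A] {n r : ℕ}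

instance : AddCommGroup (Tower A n r) := inferInstanceAs (AddCommGroup (Fin (n + 1) → Window A r))

instance : Module Aᵐᵒᵖ (Tower A n r) := inferInstanceAs (Module Aᵐᵒᵖ (Fin (n + 1) → Window A r))

instance : Module R (Tower A n r) := inferInstanceAs (Module R (Fin (n + 1) → Window A r))

instance : SMulCommClass R Aᵐᵒᵖ (Tower A n r) :=
  inferInstanceAs (SMulCommClass R Aᵐᵒᵖ (Fin (n + 1) → Window A r))

instance : SMulCommClass Aᵐᵒᵖ R (Tower A n r) := SMulCommClass.symm _ _ _

instance : IsScalarTower R Aᵐᵒᵖ (Tower A n r) :=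
  inferInstanceAs (IsScalarTower R Aᵐᵒᵖ (Fin (n + 1) → Window A r))

end Tower

/-- The right `A`-linear operators on the tower. -/
abbrev TowerEnd (A : Type*) [Ring A] (n r : ℕ) : Type _ := Module.End Aᵐᵒᵖ (Tower A n r)

namespace Tower

variable {R : Type*} [CommRing R] {A : Type*} [Ring A] [Algebra R A] {n r : ℕ}

/-- The inclusion of the `j`-th copy (`0` if `j` is out of range). -/
def emb (n j : ℕ) : Window A r →ₗ[Aᵐᵒᵖ] Tower A n r where
  toFun w k := if (k : ℕ) = j then w else 0
  map_add' v w := funext fun k => by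
    change (if (k : ℕ) = j then v + w else 0) =
      (if (k : ℕ) = j then v else 0) + if (k : ℕ) = j then w else 0
    split_ifs <;> simp
  map_smul' a w := funext fun k => by
    change (if (k : ℕ) = j then a • w else 0) = a • if (k : ℕ) = j then w else 0
    split_ifs <;> simp

/-- The projection to the last copy. -/
def last : Tower A n r →ₗ[Aᵐᵒᵖ] Window A r where
  toFun v := v (Fin.last n)
  map_add' _ _ := rfl
  map_smul' _ _ := rfl

theorem last_emb_last (w : Window A r) : last (emb n n w) = w := if_pos (Fin.val_last n)

theorem last_emb_of_ne {j : ℕ} (h : j ≠ n) (w : Window A r) : last (emb n j w) = 0 :=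
  if_neg (by rw [Fin.val_last]; exact h.symm)

theorem sum_apply {ι : Type*} (s : Finset ι) (f : ι → Tower A n r) (k : Fin (n + 1)) :
    (∑ i ∈ s, f i) k = ∑ i ∈ s, f i k :=
  map_sum (AddMonoidHom.mk' (fun v : Tower A n r => v k) fun _ _ => rfl) f s

theorem eq_sum_emb (v : Tower A n r) : v = ∑ j : Fin (n + 1), emb n j (v j) := by
  refine funext fun k => ?_
  rw [sum_apply, Finset.sum_eq_single k]
  · exact (if_pos rfl).symm
  · exact fun j _ hj => if_neg fun h => hj (Fin.ext h.symm)
  · simp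

theorem map_ext {M : Type*} [AddCommGroup M] [Module Aᵐᵒᵖ M] {φ ψ : Tower A n r →ₗ[Aᵐᵒᵖ] M}
    (h : ∀ j ≤ n, ∀ w, φ (emb n j w) = ψ (emb n j w)) : φ = ψ := by
  refine LinearMap.ext fun v => ?_
  rw [eq_sum_emb v, map_sum, map_sum]
  exact Finset.sum_congr rfl fun j _ => h j (by omega) _

/-- The operator with prescribed values on the copies of the window. -/
def ofEmb (g : ℕ → Window A r →ₗ[Aᵐᵒᵖ] Tower A n r) : TowerEnd A n r where
  toFun v := ∑ j : Fin (n + 1), g j (v j)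
  map_add' v w := by
    rw [← Finset.sum_add_distrib]
    exact Finset.sum_congr rfl fun j _ => map_add (g j) (v j) (w j)
  map_smul' a v := by
    rw [RingHom.id_apply, Finset.smul_sum]
    exact Finset.sum_congr rfl fun j _ => map_smul (g j) a (v j)

theorem ofEmb_emb (g : ℕ → Window A r →ₗ[Aᵐᵒᵖ] Tower A n r) {j : ℕ} (hj : j ≤ n)
    (w : Window A r) : ofEmb g (emb n j w) = g j w := by
  change ∑ i : Fin (n + 1), g i (if (i : ℕ) = j then w else 0) = g j w
  rw [Finset.sum_eq_single ⟨j, by omega⟩]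
  · rw [if_pos rfl]
  · intro i _ hi
    rw [if_neg fun h => hi (Fin.ext h), map_zero]
  · simp

theorem emb_rsmul (e : R) (j : ℕ) (w : Window A r) : emb n j (e • w) = e • emb n j w :=
  LinearMap.map_smul_of_tower (emb n j) e w

theorem map_rsmul (φ : TowerEnd A n r) (e : R) (v : Tower A n r) : φ (e • v) = e • φ v :=
  LinearMap.map_smul_of_tower φ e v

section Operators

open Window

variable {e : R} {P : R[X]} (d : HCSystem e P n A)

/-- The operator `T i` on the tower. -/
def opT (r : ℕ) (d : HCSystem e P n A) (i : ℕ) : TowerEnd A n r :=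
  ofEmb fun j =>
    if j < i then emb n j ∘ₗ lam r (d.T (i - 1))
    else if j = i then
      emb n (i + 1) ∘ₗ (1 + e • D r e (d.C i) (d.Y i) - D r e (d.C i) (d.Y i) *
          D r e (d.C i) (d.Y i))
        + emb n i ∘ₗ (e • (1 : WindowEnd A r) - D r e (d.C i) (d.Y i))
    else if j = i + 1 then emb n (i + 1) ∘ₗ D r e (d.C i) (d.Y i) + emb n i
    else emb n j ∘ₗ lam r (d.T i)

/-- The operator `C i` on the tower. -/
def opC (r : ℕ) (d : HCSystem e P n A) (i : ℕ) : TowerEnd A n r :=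
  ofEmb fun j =>
    emb n j ∘ₗ (if j < i then lo r (d.C (i - 1)) else if j = i then cl A r else lo r (d.C i))

/-- The operator `Y 0` on the tower. -/
def opY (r : ℕ) (d : HCSystem e P n A) : TowerEnd A n r :=
  ofEmb fun j => emb n j ∘ₗ (if j = 0 then yb P A r else lo r (d.Y 0))

variable {d}

theorem opT_emb_of_lt {i j : ℕ} (h : j < i) (hj : j ≤ n) (w : Window A r) :
    opT r d i (emb n j w) = emb n j (lam r (d.T (i - 1)) w) := by
  rw [opT, ofEmb_emb _ hj, if_pos h]; rfl

theorem opT_emb_self {i : ℕ} (hj : i ≤ n) (w : Window A r) :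
    opT r d i (emb n i w) = emb n (i + 1) (w + e • D r e (d.C i) (d.Y i) w -
        D r e (d.C i) (d.Y i) (D r e (d.C i) (d.Y i) w)) +
      emb n i (e • w - D r e (d.C i) (d.Y i) w) := by
  rw [opT, ofEmb_emb _ hj, if_neg (lt_irrefl i), if_pos rfl]; rfl

theorem opT_emb_succ {i : ℕ} (hj : i + 1 ≤ n) (w : Window A r) :
    opT r d i (emb n (i + 1) w) = emb n (i + 1) (D r e (d.C i) (d.Y i) w) + emb n i w := by
  rw [opT, ofEmb_emb _ hj, if_neg (by omega), if_neg (by omega), if_pos rfl]; rfl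

theorem opT_emb_of_gt {i j : ℕ} (h : i + 1 < j) (hj : j ≤ n) (w : Window A r) :
    opT r d i (emb n j w) = emb n j (lam r (d.T i) w) := by
  rw [opT, ofEmb_emb _ hj, if_neg (by omega), if_neg (by omega), if_neg (by omega)]; rfl

theorem opC_emb_of_lt {i j : ℕ} (h : j < i) (hj : j ≤ n) (w : Window A r) :
    opC r d i (emb n j w) = emb n j (lo r (d.C (i - 1)) w) := by
  rw [opC, ofEmb_emb _ hj, if_pos h]; rfl

theorem opC_emb_self {i : ℕ} (hj : i ≤ n) (w : Window A r) :
    opC r d i (emb n i w) = emb n i (cl A r w) := by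
  rw [opC, ofEmb_emb _ hj, if_neg (by omega), if_pos rfl]; rfl

theorem opC_emb_of_gt {i j : ℕ} (h : i < j) (hj : j ≤ n) (w : Window A r) :
    opC r d i (emb n j w) = emb n j (lo r (d.C i) w) := by
  rw [opC, ofEmb_emb _ hj, if_neg (by omega), if_neg (by omega)]; rfl

theorem opY_emb_zero (w : Window A r) : opY r d (emb n 0 w) = emb n 0 (yb P A r w) := by
  rw [opY, ofEmb_emb _ (Nat.zero_le n), if_pos rfl]; rfl

theorem opY_emb_of_pos {j : ℕ} (h : 0 < j) (hj : j ≤ n) (w : Window A r) :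
    opY r d (emb n j w) = emb n j (lo r (d.Y 0) w) := by
  rw [opY, ofEmb_emb _ hj, if_neg (by omega)]; rfl

theorem opT_sq {i : ℕ} (hi : i < n) : opT r d i * opT r d i = e • opT r d i + 1 := by
  refine map_ext fun j hj w => ?_
  rw [Module.End.mul_apply, LinearMap.add_apply, LinearMap.smul_apply, Module.End.one_apply]
  rcases lt_trichotomy j i with h | rfl | h
  · simp only [opT_emb_of_lt h hj]
    rw [← emb_rsmul, ← map_add, ← Module.End.mul_apply, ← map_mul, d.T_sq _ (by omega), map_add,
      map_one, lam_smul]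
    rfl
  · simp only [opT_emb_self hj, map_add, map_sub, opT_emb_succ hi, emb_rsmul, map_rsmul,
      smul_add, smul_sub]
    abel
  · obtain rfl | h := eq_or_lt_of_le (Nat.succ_le_of_lt h)
    · simp only [Nat.succ_eq_add_one, opT_emb_succ hi, map_add, map_sub, opT_emb_self hi.le,
        emb_rsmul, smul_add]
      abel
    · simp only [opT_emb_of_gt h hj]
      rw [← emb_rsmul, ← map_add, ← Module.End.mul_apply, ← map_mul, d.T_sq _ (by omega), map_add,
        map_one, lam_smul]
      rfl

theorem lam_lam {a b : A} (h : a * b = b * a) (w : Window A r) :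
    lam r a (lam r b w) = lam r b (lam r a w) :=
  apply_of_mul_eq (by rw [← map_mul, ← map_mul, h]) w

theorem lam_lo {a b a' b' : A} (h : a * b = b' * a') (w : Window A r) :
    lam r a (lo r b w) = lo r b' (lam r a' w) :=
  apply_of_mul_eq (by rw [lam_mul_lo, lo_mul_lam, h]) w

theorem lo_lo {a b : A} (h : a * b = -(b * a)) (w : Window A r) :
    lo r a (lo r b w) = -lo r b (lo r a w) :=
  apply_of_mul_eq (ψ' := lo r a) (φ' := -lo r b)
    (by rw [lo_mul_lo, neg_mul, lo_mul_lo, h, map_neg]) w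

theorem lo_cl (a : A) (w : Window A r) : lo r a (cl A r w) = -cl A r (lo r a w) :=
  apply_of_mul_eq (ψ' := lo r a) (φ' := -cl A r) (by rw [lo_mul_cl, neg_mul]) w

theorem D_lam {i k : ℕ} (hi : i < n) (hk : k + 1 < n) (h : i ≠ k) (h' : i ≠ k + 1)
    (w : Window A r) : D r e (d.C i) (d.Y i) (lam r (d.T k) w) =
      lam r (d.T k) (D r e (d.C i) (d.Y i) w) :=
  apply_of_mul_eq (D_mul_lam_of_commute (d.C_sq i hi) (d.T_C_comm k i hk hi h h')
    (d.T_Y_comm k i hk hi h h')) w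

theorem opT_comm {i k : ℕ} (hk : k < n) (hik : i + 1 < k) :
    opT r d i * opT r d k = opT r d k * opT r d i := by
  refine map_ext fun j hj w => ?_
  rw [Module.End.mul_apply, Module.End.mul_apply]
  rcases lt_trichotomy j i with h | rfl | h
  · rw [opT_emb_of_lt h hj, opT_emb_of_lt (by omega) hj, opT_emb_of_lt h hj,
      opT_emb_of_lt (by omega) hj, lam_lam (d.T_comm _ _ (by omega) (by omega) (by omega))]
  · have hD := D_lam (r := r) (d := d) (i := j) (k := k - 1) (by omega) (by omega) (by omega)
      (by omega)
    rw [opT_emb_of_lt (by omega) hj, opT_emb_self hj, opT_emb_self hj, map_add,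
      opT_emb_of_lt hik (by omega), opT_emb_of_lt (by omega) hj]
    simp only [map_add, map_sub, Window.map_rsmul, hD]
  · rcases lt_trichotomy j (i + 1) with h' | rfl | h'
    · omega
    · have hD := D_lam (r := r) (d := d) (i := i) (k := k - 1) (by omega) (by omega) (by omega)
        (by omega)
      rw [opT_emb_of_lt (by omega) hj, opT_emb_succ hj, opT_emb_succ hj, map_add,
        opT_emb_of_lt hik hj, opT_emb_of_lt (by omega) (by omega), hD]
    · rcases lt_trichotomy j k with h2 | rfl | h2
      · rw [opT_emb_of_lt h2 hj, opT_emb_of_gt h' hj, opT_emb_of_gt h' hj, opT_emb_of_lt h2 hj,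
          lam_lam (d.T_comm _ _ (by omega) (by omega) (by omega))]
      · have hD := D_lam (r := r) (d := d) (i := j) (k := i) (by omega) (by omega) (by omega)
          (by omega)
        rw [opT_emb_of_gt h' hj, opT_emb_self hj, opT_emb_self hj, map_add,
          opT_emb_of_gt (by omega) (by omega), opT_emb_of_gt h' hj]
        simp only [map_add, map_sub, Window.map_rsmul, hD]
      · obtain rfl | h3 := eq_or_lt_of_le (Nat.succ_le_of_lt h2)
        · have hD := D_lam (r := r) (d := d) (i := k) (k := i) (by omega) (by omega) (by omega)
            (by omega)
          rw [Nat.succ_eq_add_one, opT_emb_succ hj, map_add, opT_emb_of_gt (i := i) h' hj,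
            opT_emb_of_gt (i := i) hik (by omega), opT_emb_of_gt (i := i) h' hj, opT_emb_succ hj,
            hD]
        · rw [opT_emb_of_gt (by omega) hj, opT_emb_of_gt (by omega) hj, opT_emb_of_gt (by omega) hj,
            opT_emb_of_gt (by omega) hj, lam_lam (d.T_comm _ _ (by omega) (by omega) (by omega))]

theorem opC_sq {i : ℕ} (hi : i < n + 1) : opC r d i * opC r d i = 1 := by
  refine map_ext fun j hj w => ?_
  rw [Module.End.mul_apply, Module.End.one_apply]
  rcases lt_trichotomy j i with h | rfl | h
  · rw [opC_emb_of_lt h hj, opC_emb_of_lt h hj, lo_lo_one (d.C_sq _ (by omega))]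
  · rw [opC_emb_self hj, opC_emb_self hj]; rfl
  · rw [opC_emb_of_gt h hj, opC_emb_of_gt h hj, lo_lo_one (d.C_sq _ (by omega))]

theorem opC_anti_of_lt {i k : ℕ} (hik : i < k) (hk : k < n + 1) :
    opC r d i * opC r d k = -(opC r d k * opC r d i) := by
  refine map_ext fun j hj w => ?_
  rw [LinearMap.neg_apply, Module.End.mul_apply, Module.End.mul_apply]
  rcases lt_trichotomy j i with h | rfl | h
  · rw [opC_emb_of_lt (by omega) hj, opC_emb_of_lt h hj, opC_emb_of_lt h hj,
      opC_emb_of_lt (by omega) hj, lo_lo (d.C_anti _ _ (by omega) (by omega) (by omega)), map_neg]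
  · rw [opC_emb_of_lt (by omega) hj, opC_emb_self hj, opC_emb_self hj, opC_emb_of_lt (by omega) hj,
      lo_cl, map_neg, neg_neg]
  · rw [opC_emb_of_gt h hj]
    rcases lt_trichotomy j k with h' | rfl | h'
    · rw [opC_emb_of_lt h' hj, opC_emb_of_lt h' hj, opC_emb_of_gt h hj,
        lo_lo (d.C_anti _ _ (by omega) (by omega) (by omega)), map_neg]
    · rw [opC_emb_self hj, opC_emb_self hj, opC_emb_of_gt h hj, lo_cl, map_neg]
    · rw [opC_emb_of_gt h' hj, opC_emb_of_gt h' hj, opC_emb_of_gt h hj,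
        lo_lo (d.C_anti _ _ (by omega) (by omega) (by omega)), map_neg]

theorem D_cl {i : ℕ} (hi : i < n) (w : Window A r) : D r e (d.C i) (d.Y i) (cl A r w) =
    lo r (d.C i) (D r e (d.C i) (d.Y i) w) - e • lo r (d.C i) w + e • cl A r w := by
  refine (apply_of_mul_eq ((D_mul_cl (d.C_sq i hi)).trans (mul_one _).symm) w).trans ?_
  change lo r (d.C i) (D r e (d.C i) (d.Y i) w - e • w) + e • cl A r w = _
  rw [map_sub, Window.map_rsmul]

theorem D_lo {i : ℕ} (hi : i < n) (w : Window A r) : D r e (d.C i) (d.Y i) (lo r (d.C i) w) =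
    cl A r (D r e (d.C i) (d.Y i) w) :=
  apply_of_mul_eq (D_mul_lo (d.C_sq i hi)) w

theorem opT_opC {i : ℕ} (hi : i < n) : opT r d i * opC r d i = opC r d (i + 1) * opT r d i := by
  refine map_ext fun j hj w => ?_
  rw [Module.End.mul_apply, Module.End.mul_apply]
  rcases lt_trichotomy j i with h | rfl | h
  · obtain ⟨k, rfl⟩ : ∃ k, i = k + 1 := ⟨i - 1, by omega⟩
    rw [opC_emb_of_lt h hj, opT_emb_of_lt h hj, opT_emb_of_lt h hj, opC_emb_of_lt (by omega) hj]
    simp only [Nat.add_sub_cancel]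
    rw [lam_lo (d.T_C _ hi)]
  · rw [opC_emb_self hj, opT_emb_self hj, opT_emb_self hj, map_add, opC_emb_self hi,
      opC_emb_of_lt (by omega) hj]
    simp only [D_cl hi, D_lo hi, map_add, map_sub, Window.map_rsmul, Nat.add_sub_cancel]
    abel
  · obtain rfl | h := eq_or_lt_of_le (Nat.succ_le_of_lt h)
    · rw [Nat.succ_eq_add_one, opC_emb_of_gt (by omega) hj, opT_emb_succ hj, opT_emb_succ hj,
        map_add, opC_emb_self hj, opC_emb_of_lt (by omega) (by omega), D_lo hi,
        Nat.add_sub_cancel]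
    · rw [opC_emb_of_gt (by omega) hj, opT_emb_of_gt h hj, opT_emb_of_gt h hj,
        opC_emb_of_gt h hj, lam_lo (d.T_C _ (by omega))]

theorem D_lo_anti {i : ℕ} {g : A} (hi : i < n) (h1 : g * d.C i = -(d.C i * g))
    (h2 : g * d.Y i = -(d.Y i * g)) (w : Window A r) :
    D r e (d.C i) (d.Y i) (lo r g w) = lo r g (D r e (d.C i) (d.Y i) w) :=
  apply_of_mul_eq (D_mul_lo_of_anti (d.C_sq i hi) h1 h2) w

theorem opT_opC_comm {i k : ℕ} (hi : i < n) (hk : k < n + 1) (h1 : k ≠ i) (h2 : k ≠ i + 1) :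
    opT r d i * opC r d k = opC r d k * opT r d i := by
  have hD : ∀ k, k < n → k ≠ i → ∀ w, D r e (d.C i) (d.Y i) (lo r (d.C k) w) =
      lo r (d.C k) (D r e (d.C i) (d.Y i) w) := fun k hk hki =>
    D_lo_anti hi (d.C_anti _ _ hk hi hki) (d.C_Y_anti _ _ hk hi hki)
  refine map_ext fun j hj w => ?_
  rw [Module.End.mul_apply, Module.End.mul_apply]
  have hDk := hD (k - 1)
  rcases lt_or_gt_of_ne h1 with hki | hki
  · rcases lt_trichotomy j k with h | rfl | h
    · rw [opC_emb_of_lt h hj, opT_emb_of_lt (by omega) hj, opT_emb_of_lt (by omega) hj,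
        opC_emb_of_lt h hj, lam_lo (d.T_C_comm _ _ (by omega) (by omega) (by omega) (by omega))]
    · rw [opC_emb_self hj, opT_emb_of_lt hki hj, opT_emb_of_lt hki hj, opC_emb_self hj,
        apply_of_mul_eq (cl_mul_lam _).symm]
    · rw [opC_emb_of_gt h hj]
      rcases lt_trichotomy j i with h' | rfl | h'
      · rw [opT_emb_of_lt h' hj, opT_emb_of_lt h' hj, opC_emb_of_gt h hj,
          lam_lo (d.T_C_comm _ _ (by omega) (by omega) (by omega) (by omega))]
      · rw [opT_emb_self hj, opT_emb_self hj, map_add, opC_emb_of_gt (by omega) hi,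
          opC_emb_of_gt h hj]
        simp only [hD k (by omega) (by omega), map_add, map_sub, Window.map_rsmul]
      · obtain rfl | h' := eq_or_lt_of_le (Nat.succ_le_of_lt h')
        · rw [Nat.succ_eq_add_one, opT_emb_succ hj, opT_emb_succ hj, map_add,
            opC_emb_of_gt (by omega) hj, opC_emb_of_gt (by omega) (by omega),
            hD k (by omega) (by omega)]
        · rw [opT_emb_of_gt h' hj, opT_emb_of_gt h' hj, opC_emb_of_gt h hj,
            lam_lo (d.T_C_comm _ _ (by omega) (by omega) (by omega) (by omega))]
  · rcases lt_trichotomy j i with h' | rfl | h'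
    · rw [opC_emb_of_lt (by omega) hj, opT_emb_of_lt h' hj, opT_emb_of_lt h' hj,
        opC_emb_of_lt (by omega) hj,
        lam_lo (d.T_C_comm _ _ (by omega) (by omega) (by omega) (by omega))]
    · rw [opC_emb_of_lt (by omega) hj, opT_emb_self hj, opT_emb_self hj, map_add,
        opC_emb_of_lt (by omega) hi, opC_emb_of_lt (by omega) hj]
      simp only [hD (k - 1) (by omega) (by omega), map_add, map_sub, Window.map_rsmul]
    · obtain rfl | h' := eq_or_lt_of_le (Nat.succ_le_of_lt h')
      · rw [Nat.succ_eq_add_one, opC_emb_of_lt (by omega) hj, opT_emb_succ hj, opT_emb_succ hj,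
          map_add, opC_emb_of_lt (by omega) hj, opC_emb_of_lt (by omega) (by omega),
          hD (k - 1) (by omega) (by omega)]
      · rw [opT_emb_of_gt h' hj]
        rcases lt_trichotomy j k with h | rfl | h
        · rw [opC_emb_of_lt h hj, opC_emb_of_lt h hj, opT_emb_of_gt h' hj,
            lam_lo (d.T_C_comm _ _ (by omega) (by omega) (by omega) (by omega))]
        · rw [opC_emb_self hj, opC_emb_self hj, opT_emb_of_gt h' hj,
            apply_of_mul_eq (cl_mul_lam _).symm]
        · rw [opC_emb_of_gt h hj, opC_emb_of_gt h hj, opT_emb_of_gt h' hj,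
            lam_lo (d.T_C_comm _ _ (by omega) (by omega) (by omega) (by omega))]

theorem opY_sq {s : R} (hP : IsPalindromic P r s) : opY r d * opY r d = 1 := by
  refine map_ext fun j hj w => ?_
  rw [Module.End.mul_apply, Module.End.one_apply]
  rcases Nat.eq_zero_or_pos j with rfl | h
  · rw [opY_emb_zero, opY_emb_zero, ← Module.End.mul_apply, yb_mul_yb hP, Module.End.one_apply]
  · rw [opY_emb_of_pos h hj, opY_emb_of_pos h hj, lo_lo_one (d.Y_sq _ (by omega))]

theorem opC_opY {i : ℕ} (h0 : 0 < i) (hi : i < n + 1) :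
    opC r d i * opY r d = -(opY r d * opC r d i) := by
  refine map_ext fun j hj w => ?_
  rw [LinearMap.neg_apply, Module.End.mul_apply, Module.End.mul_apply]
  rcases Nat.eq_zero_or_pos j with rfl | h
  · rw [opY_emb_zero, opC_emb_of_lt h0 hj, opC_emb_of_lt h0 hj, opY_emb_zero,
      apply_of_mul_eq ((yb_mul_lo _).trans (neg_mul _ _).symm), LinearMap.neg_apply, map_neg,
      neg_neg]
  · rw [opY_emb_of_pos h hj]
    rcases lt_trichotomy j i with h' | rfl | h'
    · rw [opC_emb_of_lt h' hj, opC_emb_of_lt h' hj, opY_emb_of_pos h hj,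
        lo_lo (d.C_Y_anti _ _ (by omega) (by omega) (by omega)), map_neg]
    · rw [opC_emb_self hj, opC_emb_self hj, opY_emb_of_pos h hj, lo_cl, map_neg, neg_neg]
    · rw [opC_emb_of_gt h' hj, opC_emb_of_gt h' hj, opY_emb_of_pos h hj,
        lo_lo (d.C_Y_anti _ _ (by omega) (by omega) (by omega)), map_neg]

theorem opT_opY {i : ℕ} (h0 : 0 < i) (hi : i < n) :
    opT r d i * opY r d = opY r d * opT r d i := by
  have hD : ∀ w, D r e (d.C i) (d.Y i) (lo r (d.Y 0) w) =
      lo r (d.Y 0) (D r e (d.C i) (d.Y i) w) :=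
    D_lo_anti hi (by rw [d.C_Y_anti i 0 hi (by omega) (by omega), neg_neg])
      (d.Y_anti _ _ (by omega) hi (by omega))
  refine map_ext fun j hj w => ?_
  rw [Module.End.mul_apply, Module.End.mul_apply]
  rcases Nat.eq_zero_or_pos j with rfl | h
  · rw [opY_emb_zero, opT_emb_of_lt h0 hj, opT_emb_of_lt h0 hj, opY_emb_zero,
      apply_of_mul_eq (yb_mul_lam _)]
  · rw [opY_emb_of_pos h hj]
    rcases lt_trichotomy j i with h' | rfl | h'
    · rw [opT_emb_of_lt h' hj, opT_emb_of_lt h' hj, opY_emb_of_pos h hj,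
        lam_lo (d.T_Y_comm _ _ (by omega) (by omega) (by omega) (by omega))]
    · rw [opT_emb_self hj, opT_emb_self hj, map_add, opY_emb_of_pos (by omega) hi,
        opY_emb_of_pos h hj]
      simp only [hD, map_add, map_sub, Window.map_rsmul]
    · obtain rfl | h' := eq_or_lt_of_le (Nat.succ_le_of_lt h')
      · rw [Nat.succ_eq_add_one, opT_emb_succ hj, opT_emb_succ hj, map_add,
          opY_emb_of_pos (by omega) hj, opY_emb_of_pos h0 (by omega), hD]
      · rw [opT_emb_of_gt h' hj, opT_emb_of_gt h' hj, opY_emb_of_pos h hj,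
          lam_lo (d.T_Y_comm _ _ (by omega) (by omega) (by omega) (by omega))]

end Operators

end Tower

/-! ### The braid relation and the anticommutation on the tower -/

namespace Tower

open Window MulOpposite

variable {R : Type*} [CommRing R] {A : Type*} [Ring A] [Algebra R A] {n r : ℕ} {e : R} {P : R[X]}
  {d : HCSystem e P n A} {s : R}

theorem opT_emb_prev {i : ℕ} (hi : i + 1 ≤ n) (w : Window A r) :
    emb n i w = opT r d i (emb n (i + 1) w) - emb n (i + 1) (D r e (d.C i) (d.Y i) w) := by
  rw [opT_emb_succ hi, add_sub_cancel_left]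

/-- The failure of the braid relation intertwines each of the two generators with minus the inverse
of the other one. -/
theorem braid_commutator {B : Type*} [Ring B] [Algebra R B] {a b : B} (ha : a * a = e • a + 1)
    (hb : b * b = e • b + 1) :
    (a * b * a - b * a * b) * a = (e • 1 - b) * (a * b * a - b * a * b) ∧
    (a * b * a - b * a * b) * b = (e • 1 - a) * (a * b * a - b * a * b) := by
  have h1 : a * b * a * a = e • (a * b * a) + a * b := by
    rw [mul_assoc, ha, mul_add, mul_one, mul_smul_comm]
  have h2 : b * (b * a * b) = e • (b * a * b) + a * b := by
    rw [mul_assoc b a, ← mul_assoc b b, hb, add_mul, one_mul, smul_mul_assoc]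
  have h3 : b * a * b * b = e • (b * a * b) + b * a := by
    rw [mul_assoc, hb, mul_add, mul_one, mul_smul_comm]
  have h4 : a * (a * b * a) = e • (a * b * a) + b * a := by
    rw [mul_assoc a b, ← mul_assoc a a, ha, add_mul, one_mul, smul_mul_assoc]
  constructor
  · rw [sub_mul, h1, sub_mul, smul_mul_assoc, one_mul, mul_sub, h2, smul_sub]
    simp only [mul_assoc]
    abel
  · rw [sub_mul, h3, sub_mul, smul_mul_assoc, one_mul, mul_sub, h4, smul_sub]
    simp only [mul_assoc]
    abel

theorem D_braid_apply {i : ℕ} (hi : i + 1 < n) (w : Window A r) :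
    D r e (d.C i) (d.Y i) (lam r (d.T i) w) +
      D r e (d.C (i + 1)) (d.Y (i + 1)) (D r e (d.C i) (d.Y i) w) =
    lam r (d.T i) (D r e (d.C (i + 1)) (d.Y (i + 1)) w) + e • D r e (d.C i) (d.Y i) w :=
  congrArg (fun φ : WindowEnd A r => φ w) (D_braid (d.C_sq i (by omega)) (d.C_sq (i + 1) hi)
    (d.C_anti i (i + 1) (by omega) hi (by omega)) (d.Y_anti i (i + 1) (by omega) hi (by omega))
    (d.C_Y_anti i (i + 1) (by omega) hi (by omega))
    (by rw [d.C_Y_anti (i + 1) i hi (by omega) (by omega), neg_neg])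
    (d.T_C i hi) (d.T_C_succ hi) (d.T_Y i hi))

/-- On the copy `i + 2` the braid relation is a property of the operators `D`. The other two
copies that `T i` and `T (i + 1)` mix with it are reached from it by these operators, and the
difference of the two sides commutes with them up to a factor. -/
theorem opT_braid {i : ℕ} (hi : i + 1 < n) :
    opT r d i * opT r d (i + 1) * opT r d i = opT r d (i + 1) * opT r d i * opT r d (i + 1) := by
  obtain ⟨ha, hb⟩ := braid_commutator (opT_sq (r := r) (d := d) (i := i) (by omega))
    (opT_sq (r := r) (d := d) hi)
  rw [← sub_eq_zero]
  set a := opT r d i with a_def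
  set b := opT r d (i + 1) with b_def
  set E := a * b * a - b * a * b with hE
  have h2 : ∀ w, E (emb n (i + 2) w) = 0 := fun w => by
    have k1 := D_braid_apply (r := r) (d := d) hi w
    have k2 := D_braid_apply (r := r) (d := d) hi (lam r (d.T i) w)
    have k3 := congrArg (fun v => lam r (d.T i) v) k1
    have k4 := congrArg (fun v => D r e (d.C (i + 1)) (d.Y (i + 1)) v) k1
    have hq : ∀ v : Window A r, lam r (d.T i) (lam r (d.T i) v) = e • lam r (d.T i) v + v :=
      fun v => by
        rw [← Module.End.mul_apply, ← map_mul, d.T_sq _ hi, map_add, map_one, lam_smul]; rfl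
    have l1 : a (b (a (emb n (i + 2) w))) =
        emb n (i + 2) (lam r (d.T i) (D r e (d.C (i + 1)) (d.Y (i + 1)) (lam r (d.T i) w)))
        + (emb n (i + 1) (D r e (d.C i) (d.Y i) (lam r (d.T i) w))
        + emb n i (lam r (d.T i) w)) := by
      rw [a_def, b_def, opT_emb_of_gt (by omega) (by omega), opT_emb_succ hi, map_add,
        opT_emb_of_gt (by omega) (by omega), opT_emb_succ (by omega)]
    have l2 : b (a (b (emb n (i + 2) w))) =
        emb n (i + 2) (D r e (d.C (i + 1)) (d.Y (i + 1)) (lam r (d.T i)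
          (D r e (d.C (i + 1)) (d.Y (i + 1)) w)))
        + emb n (i + 1) (lam r (d.T i) (D r e (d.C (i + 1)) (d.Y (i + 1)) w))
        + (emb n (i + 2) (D r e (d.C i) (d.Y i) w + e • D r e (d.C (i + 1)) (d.Y (i + 1))
            (D r e (d.C i) (d.Y i) w) - D r e (d.C (i + 1)) (d.Y (i + 1))
              (D r e (d.C (i + 1)) (d.Y (i + 1)) (D r e (d.C i) (d.Y i) w)))
          + emb n (i + 1) (e • D r e (d.C i) (d.Y i) w - D r e (d.C (i + 1)) (d.Y (i + 1))
            (D r e (d.C i) (d.Y i) w)) + emb n i (lam r (d.T i) w)) := by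
      rw [a_def, b_def, opT_emb_succ hi, map_add, opT_emb_of_gt (by omega) (by omega),
        opT_emb_succ (by omega), map_add, opT_emb_succ hi, map_add, opT_emb_self (by omega),
        opT_emb_of_lt (by omega) (by omega)]
      rfl
    change a (b (a (emb n (i + 2) w))) - b (a (b (emb n (i + 2) w))) = 0
    rw [l1, l2]
    have m1 : lam r (d.T i) (D r e (d.C (i + 1)) (d.Y (i + 1)) (lam r (d.T i) w)) =
        D r e (d.C (i + 1)) (d.Y (i + 1)) (lam r (d.T i) (D r e (d.C (i + 1)) (d.Y (i + 1)) w)) +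
        (D r e (d.C i) (d.Y i) w + e • D r e (d.C (i + 1)) (d.Y (i + 1))
            (D r e (d.C i) (d.Y i) w) - D r e (d.C (i + 1)) (d.Y (i + 1))
              (D r e (d.C (i + 1)) (d.Y (i + 1)) (D r e (d.C i) (d.Y i) w))) := by
      rw [hq, map_add, Window.map_rsmul] at k2
      simp only [map_add, Window.map_rsmul] at k4
      rw [← sub_eq_iff_eq_add] at k2 k4
      rw [← k2, ← k4]
      abel
    have m2 : D r e (d.C i) (d.Y i) (lam r (d.T i) w) =
        lam r (d.T i) (D r e (d.C (i + 1)) (d.Y (i + 1)) w) +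
        (e • D r e (d.C i) (d.Y i) w - D r e (d.C (i + 1)) (d.Y (i + 1))
            (D r e (d.C i) (d.Y i) w)) := by
      rw [← add_sub_assoc, ← k1, add_sub_cancel_right]
    rw [m1, m2]
    simp only [map_add]
    abel
  have h1 : ∀ w, E (emb n (i + 1) w) = 0 := fun w => by
    have := congrArg (fun φ : TowerEnd A n r => φ (emb n (i + 2) w)) hb
    simp only [Module.End.mul_apply, h2, map_zero] at this
    rw [opT_emb_prev (d := d) hi, map_sub, h2, sub_zero]
    exact this
  refine map_ext fun j hj w => ?_
  rw [LinearMap.zero_apply]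
  rcases lt_trichotomy j i with h | rfl | h
  · change a (b (a (emb n j w))) - b (a (b (emb n j w))) = 0
    obtain ⟨k, rfl⟩ : ∃ k, i = k + 1 := ⟨i - 1, by omega⟩
    rw [a_def, b_def]
    simp only [opT_emb_of_lt h hj, opT_emb_of_lt (show j < k + 1 + 1 by omega) hj]
    rw [← map_sub]
    simp only [← Module.End.mul_apply, ← map_mul, Nat.add_sub_cancel]
    rw [← mul_assoc, ← mul_assoc, d.T_braid _ hi, sub_self, map_zero]
  · have := congrArg (fun φ : TowerEnd A n r => φ (emb n (j + 1) w)) ha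
    simp only [Module.End.mul_apply, h1, map_zero] at this
    rw [opT_emb_prev (d := d) (by omega), map_sub, h1, sub_zero]
    exact this
  · rcases Nat.lt_or_ge (i + 2) j with h' | h'
    · change a (b (a (emb n j w))) - b (a (b (emb n j w))) = 0
      rw [a_def, b_def]
      simp only [opT_emb_of_gt (show i + 1 < j by omega) hj,
        opT_emb_of_gt (show i + 1 + 1 < j by omega) hj]
      rw [← map_sub]
      simp only [← Module.End.mul_apply, ← map_mul]
      rw [← mul_assoc, ← mul_assoc, d.T_braid _ (by omega), sub_self, map_zero]
    · obtain rfl | rfl : j = i + 1 ∨ j = i + 2 := by omega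
      · exact h1 w
      · exact h2 w

/-- The anticommutator of `y` with its conjugate by `t` commutes with `t`; note that `t - e` is the
inverse of `t`. -/
theorem conj_commute {B : Type*} [Ring B] [Algebra R B] {t y : B} (ht : t * t = e • t + 1)
    (hy : y * y = 1) :
    (y * ((t - e • 1) * y * t) + (t - e • 1) * y * t * y) * t =
      t * (y * ((t - e • 1) * y * t) + (t - e • 1) * y * t * y) := by
  have h1 : t * (t - e • 1) = 1 := by rw [mul_sub, ht, mul_smul_comm, mul_one]; abel
  have a1 : y * ((t - e • 1) * y * t) * t = e • (y * t * y * t) - e • e • t + y * t *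
      y - e • 1 := by
    rw [mul_assoc, mul_assoc _ t t, ht, sub_mul, smul_mul_assoc, one_mul, sub_mul, mul_add, mul_one,
      smul_mul_assoc, mul_add, mul_one, mul_smul_comm, mul_smul_comm, mul_sub, mul_add,
      mul_smul_comm, mul_smul_comm, mul_add, mul_smul_comm, hy, ← mul_assoc y y t, hy, one_mul,
      smul_add]
    simp only [mul_assoc]
    abel
  have a2 : (t - e • 1) * y * t * y * t = t * y * t * y * t - e • (y * t * y * t) := by
    rw [sub_mul, smul_mul_assoc, one_mul]
    simp only [sub_mul, smul_mul_assoc]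
  have a3 : t * (y * ((t - e • 1) * y * t)) = t * y * t * y * t - e • e • t - e • 1 := by
    rw [sub_mul, smul_mul_assoc, one_mul, sub_mul, smul_mul_assoc, mul_sub, mul_smul_comm,
      ← mul_assoc y y t, hy, one_mul, mul_sub, mul_smul_comm, ht, smul_add]
    simp only [mul_assoc]
    abel
  have a4 : t * ((t - e • 1) * y * t * y) = y * t * y := by
    rw [← mul_assoc, ← mul_assoc, ← mul_assoc, h1, one_mul]
  rw [add_mul, mul_add, a1, a2, a3, a4]
  abel

section Reflection

variable {c y : A}

theorem D_yb_apply (w : Window A r) : D r e c y (yb P A r w) =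
    delta P r e c y w + lo r y (D r e c y w) := by
  rw [delta, LinearMap.sub_apply, Module.End.mul_apply, Module.End.mul_apply, sub_add_cancel]

theorem delta_lo_apply (hr : 0 < r) (hP : IsPalindromic P r s) (hc : c * c = 1) (hy : y * y = 1)
    (hx : Polynomial.aeval (c * y) P = 0) (w : Window A r) :
    delta P r e c y (lo r y w) = -yb P A r (delta P r e c y w) :=
  apply_of_mul_eq ((delta_mul_lo hr hP hc hy hx).trans (neg_mul _ _).symm) w

theorem delta_delta_apply (hr : 0 < r) (hP : IsPalindromic P r s) (hc : c * c = 1) (hy : y * y = 1)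
    (hx : Polynomial.aeval (c * y) P = 0) (w : Window A r) :
    delta P r e c y (delta P r e c y w) =
      e • (yb P A r (delta P r e c y w) - lo r y (delta P r e c y w)) := by
  rw [← Module.End.mul_apply, delta_mul_delta hr hP hc hy hx, LinearMap.smul_apply,
    Module.End.mul_apply, LinearMap.sub_apply]

theorem yb_lo_apply (w : Window A r) : yb P A r (lo r y w) = -lo r y (yb P A r w) :=
  apply_of_mul_eq ((yb_mul_lo y).trans (neg_mul _ _).symm) w

/-- The component in the copy `1` of the anticommutation of `Y 0` and `Y 1`. -/
theorem yb_anti_aux (hr : 0 < r) (hP : IsPalindromic P r s) (hc : c * c = 1) (hy : y * y = 1)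
    (hx : Polynomial.aeval (c * y) P = 0) (w : Window A r) :
    lo r y (D r e c y (lo r y (D r e c y w)) - e • lo r y (D r e c y w) + yb P A r w +
      e • D r e c y (yb P A r w) - D r e c y (D r e c y (yb P A r w))) +
    (D r e c y (lo r y (D r e c y (lo r y w))) - e • lo r y (D r e c y (lo r y w)) +
      yb P A r (lo r y w) + e • D r e c y (yb P A r (lo r y w)) -
      D r e c y (D r e c y (yb P A r (lo r y w)))) = 0 := by
  have hφ := fun w => D_yb_apply (e := e) (P := P) (c := c) (y := y) (r := r) w
  have h1 := fun w => delta_lo_apply (e := e) hr hP hc hy hx w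
  have h2 := fun w => delta_delta_apply (e := e) hr hP hc hy hx w
  have h3 := fun w => yb_lo_apply (P := P) (y := y) (r := r) w
  have h4 : ∀ w, D r e c y (lo r y (yb P A r w)) =
      yb P A r (delta P r e c y w) - lo r y (D r e c y (lo r y w)) := fun w => by
    rw [← neg_eq_iff_eq_neg.2 (h3 w), map_neg, hφ, h1]
    abel
  generalize D r e c y = φ at *
  generalize delta P r e c y = Δ at *
  simp only [map_add, map_sub, map_neg, Window.map_rsmul, hφ, h3, h4, lo_lo_one hy, h2, smul_add,
    smul_sub, smul_neg]
  abel

end Reflection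

theorem opT_sub_emb_of_gt {i j : ℕ} (h : i + 1 < j) (hj : j ≤ n) (w : Window A r) :
    (opT r d i - e • 1) (emb n j w) = emb n j (lam r (d.T i - e • 1) w) := by
  rw [LinearMap.sub_apply, opT_emb_of_gt h hj, LinearMap.smul_apply, Module.End.one_apply,
    map_sub, lam_smul, map_one, LinearMap.sub_apply, map_sub, LinearMap.smul_apply,
    Module.End.one_apply, emb_rsmul]

/-- The conjugate of `Y 0` by `T 0` on the copy `1`. -/
theorem opY_conj_emb_one (hn : 0 < n) (w : Window A r) :
    (opT r d 0 - e • 1) (opY r d (opT r d 0 (emb n 1 w))) =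
      emb n 1 (D r e (d.C 0) (d.Y 0) (lo r (d.Y 0) (D r e (d.C 0) (d.Y 0) w)) -
        e • lo r (d.Y 0) (D r e (d.C 0) (d.Y 0) w) + yb P A r w +
        e • D r e (d.C 0) (d.Y 0) (yb P A r w) -
        D r e (d.C 0) (d.Y 0) (D r e (d.C 0) (d.Y 0) (yb P A r w))) +
      emb n 0 (lo r (d.Y 0) (D r e (d.C 0) (d.Y 0) w) - D r e (d.C 0) (d.Y 0) (yb P A r w)) := by
  have e1 : ∀ w, opT r d 0 (emb n 1 w) = emb n 1 (D r e (d.C 0) (d.Y 0) w) + emb n 0 w :=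
    fun w => opT_emb_succ hn w
  rw [e1, map_add, opY_emb_of_pos Nat.one_pos hn, opY_emb_zero, LinearMap.sub_apply,
    LinearMap.smul_apply, Module.End.one_apply, map_add, e1, opT_emb_self (Nat.zero_le n)]
  simp only [map_add, map_sub, emb_rsmul, smul_add]
  abel

theorem opY_conj_one (hr : 0 < r) (hP : IsPalindromic P r s) (hn : 0 < n) (w : Window A r) :
    opY r d ((opT r d 0 - e • 1) (opY r d (opT r d 0 (emb n 1 w)))) +
      (opT r d 0 - e • 1) (opY r d (opT r d 0 (opY r d (emb n 1 w)))) = 0 := by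
  rw [opY_conj_emb_one hn, opY_emb_of_pos Nat.one_pos hn, opY_conj_emb_one hn, map_add,
    opY_emb_of_pos Nat.one_pos hn, opY_emb_zero, add_add_add_comm, ← map_add, ← map_add,
    yb_anti_aux hr hP (d.C_sq 0 hn) (d.Y_sq 0 hn) (d.cyc hn), map_zero, zero_add,
    D_yb_apply, D_yb_apply, delta_lo_apply hr hP (d.C_sq 0 hn) (d.Y_sq 0 hn) (d.cyc hn),
    sub_add_cancel_right, map_neg, sub_add_cancel_right, neg_neg, neg_add_cancel, map_zero]

theorem opY_conj_of_gt {j : ℕ} (h : 1 < j) (hj : j ≤ n) (w : Window A r) :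
    opY r d ((opT r d 0 - e • 1) (opY r d (opT r d 0 (emb n j w)))) +
      (opT r d 0 - e • 1) (opY r d (opT r d 0 (opY r d (emb n j w)))) = 0 := by
  have hA : d.Y 0 * ((d.T 0 - e • 1) * (d.Y 0 * d.T 0)) +
      (d.T 0 - e • 1) * (d.Y 0 * (d.T 0 * d.Y 0)) = 0 := by
    have := d.Y_anti 0 1 (by omega) (by omega) (by omega)
    rw [d.Y_succ (by omega)] at this
    rw [← eq_neg_iff_add_eq_zero, ← mul_assoc (d.T 0 - e • 1), this]
    simp only [mul_assoc]
  have h0 : 0 < j := by omega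
  rw [opT_emb_of_gt h hj, opY_emb_of_pos h0 hj, opT_sub_emb_of_gt h hj, opY_emb_of_pos h0 hj,
    opY_emb_of_pos h0 hj, opT_emb_of_gt h hj, opY_emb_of_pos h0 hj, opT_sub_emb_of_gt h hj,
    ← map_add]
  have hz : lo r (d.Y 0) * (lam r (d.T 0 - e • 1) * (lo r (d.Y 0) * lam r (d.T 0))) +
      lam r (d.T 0 - e • 1) * (lo r (d.Y 0) * (lam r (d.T 0) * lo r (d.Y 0))) = 0 := by
    rw [lo_mul_lam, lam_mul_lo, lam_mul_lo, lo_mul_lo, lo_mul_lo, ← map_mul, ← map_add, hA,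
      map_zero]
  exact (congrArg (emb n j) (congrArg (fun φ : WindowEnd A r => φ w) hz)).trans (map_zero _)

/-- The first two `Y` anticommute on the tower. On the copy `1` this rests on the relations of
`delta`; the copy `0` is reached from it by `T 0`, with which the anticommutator commutes. -/
theorem opY_conj (hr : 0 < r) (hP : IsPalindromic P r s) (hn : 0 < n) :
    opY r d * ((opT r d 0 - e • 1) * opY r d * opT r d 0) =
      -((opT r d 0 - e • 1) * opY r d * opT r d 0 * opY r d) := by
  have hK := conj_commute (opT_sq (r := r) (d := d) hn) (opY_sq (d := d) hP)
  rw [eq_neg_iff_add_eq_zero]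
  have h1 := fun w => opY_conj_one (d := d) hr hP hn w
  refine map_ext fun j hj w => ?_
  rw [LinearMap.zero_apply]
  rcases Nat.lt_or_ge 1 j with h | h
  · exact opY_conj_of_gt h hj w
  · obtain rfl | rfl : j = 0 ∨ j = 1 := by omega
    · generalize hE : opY r d * ((opT r d 0 - e • 1) * opY r d * opT r d 0) +
        (opT r d 0 - e • 1) * opY r d * opT r d 0 * opY r d = K at hK ⊢
      have h3 : ∀ w, K (emb n 1 w) = 0 := fun w => by rw [← hE]; exact h1 w
      have h2 := congrArg (fun φ : TowerEnd A n r => φ (emb n 1 w)) hK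
      simp only [Module.End.mul_apply, h3, map_zero] at h2
      rw [opT_emb_prev (d := d) hn, map_sub, h3, sub_zero]
      exact h2
    · exact h1 w

end Tower

/-! ### The tower as a representation of the next rank -/

namespace Tower

open Window MulOpposite

variable {R : Type*} [CommRing R] {A : Type*} [Ring A] [Algebra R A] {n r : ℕ} {e : R} {P : R[X]}
  {d : HCSystem e P n A} {s : R}

/-- The polynomial `P` annihilates `xb`: it kills the empty word, hence the powers of `x`, and the
words `c * x ^ k` follow because conjugation by `c` inverts `x` and `P` is palindromic. -/
theorem aeval_xb_eq_zero (hr : 0 < r) (hP : IsPalindromic P r s) :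
    Polynomial.aeval (xb P A r) P = 0 := by
  have h0 : Polynomial.aeval (xb P A r) P (xw A r 0) = 0 := by
    rw [← aeval_xb hr hP, Polynomial.aeval_eq_sum_range' (Nat.lt_succ_of_le hP.natDegree_le),
      LinearMap.sum_apply]
    rfl
  have hcomm : ∀ k, Commute (Polynomial.aeval (xb P A r) P) (xb P A r ^ k) := fun k => by
    have := (Polynomial.commute_X_pow P k).map (Polynomial.aeval (xb P A r))
    rw [map_pow, Polynomial.aeval_X] at this
    exact this.symm
  have hx : ∀ k < r, Polynomial.aeval (xb P A r) P (xw A r k) = 0 := fun k hk => by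
    rw [← xb_pow_xw_zero (P := P) k hk, apply_of_mul_eq (hcomm k).eq, h0, map_zero]
  have hinv : xb P A r * (yb P A r * cl A r) = 1 := by
    rw [xb, mul_assoc, ← mul_assoc (yb P A r), yb_mul_yb hP, one_mul, cl_mul_cl]
  have hinv' : yb P A r * cl A r * xb P A r = 1 := by
    rw [xb, mul_assoc, ← mul_assoc (cl A r), cl_mul_cl, one_mul, yb_mul_yb hP]
  have hcl : ∀ p : R[X], Polynomial.aeval (xb P A r) p * cl A r =
      cl A r * Polynomial.aeval (yb P A r * cl A r) p := fun p => by
    induction p using Polynomial.induction_on' with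
    | add p q hp hq => rw [map_add, map_add, add_mul, mul_add, hp, hq]
    | monomial k a =>
      have h1 : SemiconjBy (cl A r) (yb P A r * cl A r) (xb P A r) := by
        rw [SemiconjBy, xb, mul_assoc]
      rw [Polynomial.aeval_monomial, Polynomial.aeval_monomial, mul_assoc,
        ← (h1.pow_right k).eq, ← mul_assoc, ← mul_assoc, Algebra.commutes]
  refine end_ext (fun k hk => ?_) (fun k hk => ?_)
  · rw [hx k hk, LinearMap.zero_apply]
  · have hc : Commute (Polynomial.aeval (xb P A r) P) ((yb P A r * cl A r) ^ r) := by
      refine Commute.pow_right ?_ r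
      have h := (hcomm 1).eq
      rw [pow_one] at h
      calc Polynomial.aeval (xb P A r) P * (yb P A r * cl A r)
          = yb P A r * cl A r * (xb P A r * Polynomial.aeval (xb P A r) P) *
            (yb P A r * cl A r) := by rw [← mul_assoc _ (xb P A r), hinv', one_mul]
        _ = yb P A r * cl A r * Polynomial.aeval (xb P A r) P *
            (xb P A r * (yb P A r * cl A r)) := by rw [← h]; simp only [mul_assoc]
        _ = _ := by rw [hinv, mul_one]
    rw [← cl_xw, apply_of_mul_eq (hcl P), hP.aeval_inv hinv, hc.eq, LinearMap.smul_apply,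
      Module.End.mul_apply, hx k hk, map_zero, smul_zero, map_zero, LinearMap.zero_apply]

theorem aeval_emb {f : TowerEnd A n r} {g : WindowEnd A r} {j : ℕ}
    (h : ∀ w, f (emb n j w) = emb n j (g w)) (p : R[X]) (w : Window A r) :
    Polynomial.aeval f p (emb n j w) = emb n j (Polynomial.aeval g p w) := by
  have hp : ∀ k w, (f ^ k) (emb n j w) = emb n j ((g ^ k) w) := fun k w => by
    induction k generalizing w with
    | zero => rfl
    | succ k ih => rw [pow_succ, pow_succ, Module.End.mul_apply, Module.End.mul_apply, h, ih]
  rw [Polynomial.aeval_eq_sum_range, Polynomial.aeval_eq_sum_range, LinearMap.sum_apply,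
    LinearMap.sum_apply, map_sum]
  exact Finset.sum_congr rfl fun k _ => by
    rw [LinearMap.smul_apply, LinearMap.smul_apply, hp, emb_rsmul]

/-- Multiplication of the coefficients from the left, as a homomorphism of algebras. -/
def lamAlg (R : Type*) [CommRing R] {A : Type*} [Ring A] [Algebra R A] (r : ℕ) :
    A →ₐ[R] WindowEnd A r where
  toRingHom := lam r
  commutes' a := by
    rw [Algebra.algebraMap_eq_smul_one, Algebra.algebraMap_eq_smul_one]
    exact lam_smul_one a

theorem aeval_opC_opY (hr : 0 < r) (hP : IsPalindromic P r s) :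
    Polynomial.aeval (opC r d 0 * opY r d) P = 0 := by
  refine map_ext fun j hj w => ?_
  rw [LinearMap.zero_apply]
  rcases Nat.eq_zero_or_pos j with rfl | h
  · rw [aeval_emb (g := xb P A r), aeval_xb_eq_zero hr hP, LinearMap.zero_apply, map_zero]
    intro w
    rw [Module.End.mul_apply, opY_emb_zero, opC_emb_self hj]
    rfl
  · rw [aeval_emb (g := lamAlg R r (d.C 0 * d.Y 0)), Polynomial.aeval_algHom_apply,
      d.cyc (by omega),
      map_zero, LinearMap.zero_apply, map_zero]
    intro w
    rw [Module.End.mul_apply, opY_emb_of_pos h hj, opC_emb_of_gt h hj,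
      apply_of_mul_eq ((lo_mul_lo _ _).trans (mul_one _).symm)]
    rfl

/-- The operators on the tower form a system of the next rank. -/
def seed (hr : 0 < r) (hP : IsPalindromic P r s) (d : HCSystem e P n A) :
    HCSeed e P (n + 1) (TowerEnd A n r) where
  T := opT r d
  C := opC r d
  y := opY r d
  T_sq i h := opT_sq (by omega)
  T_comm i j _ hj hij := opT_comm (by omega) hij
  T_braid i h := opT_braid (by omega)
  C_sq j h := opC_sq h
  C_anti i j hi hj hij := by
    rcases lt_or_gt_of_ne hij with h | h
    · exact opC_anti_of_lt h hj
    · rw [opC_anti_of_lt h hi, neg_neg]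
  T_C i h := opT_opC (by omega)
  T_C_comm i j hi hj h1 h2 := opT_opC_comm (by omega) hj h1 h2
  y_sq _ := opY_sq hP
  C_y_anti i h0 hi := opC_opY h0 hi
  T_y_comm i h0 hi := opT_opY h0 (by omega)
  y_anti h := opY_conj hr hP (by omega)
  cyc _ := aeval_opC_opY hr hP

/-- The tower as a module over the algebra of the next rank. -/
def system (hr : 0 < r) (hP : IsPalindromic P r s) (d : HCSystem e P n A) :
    HCSystem e P (n + 1) (TowerEnd A n r) := (seed hr hP d).system

variable (hr : 0 < r) (hP : IsPalindromic P r s)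

theorem system_Y_succ {j : ℕ} : (system hr hP d).Y (j + 1) =
    (opT r d j - e • 1) * (system hr hP d).Y j * opT r d j := rfl

theorem system_Y_emb_of_gt {j k : ℕ} (h : j < k) (hk : k ≤ n) (w : Window A r) :
    (system hr hP d).Y j (emb n k w) = emb n k (lo r (d.Y j) w) := by
  induction j generalizing w with
  | zero => exact opY_emb_of_pos h hk w
  | succ j ih =>
    rw [system_Y_succ, Module.End.mul_apply, Module.End.mul_apply, opT_emb_of_gt h hk,
      ih (by omega), opT_sub_emb_of_gt h hk, ← Module.End.mul_apply (lo r _), lo_mul_lam,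
      ← Module.End.mul_apply, lam_mul_lo, d.Y_succ (by omega), mul_assoc]

theorem system_Y_emb_self {j k : ℕ} (hj : j ≤ n) (hk : k + 1 < r) :
    (system hr hP d).Y j (emb n j (xw A r k)) = emb n j (cw A r (k + 1)) := by
  induction j with
  | zero => exact (opY_emb_zero _).trans (congrArg _ (yb_xw_of_lt hk))
  | succ j ih =>
    have h1 : lo r (d.Y j) (D r e (d.C j) (d.Y j) (xw A r k)) =
        D r e (d.C j) (d.Y j) (cw A r (k + 1)) := by
      rw [D_xw (by omega), D_cw hk, dWords_succ_snd]
    rw [system_Y_succ, Module.End.mul_apply, Module.End.mul_apply, opT_emb_succ hj, map_add,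
      ih (by omega), system_Y_emb_of_gt hr hP (Nat.lt_succ_self j) hj, h1, LinearMap.sub_apply,
      LinearMap.smul_apply, Module.End.one_apply, map_add, opT_emb_succ hj,
      opT_emb_self (by omega)]
    simp only [map_add, map_sub, emb_rsmul, smul_add]
    abel

/-- The coefficient of the empty word in the last copy. -/
def coeffZero (hr : 0 < r) : Tower A n r →ₗ[Aᵐᵒᵖ] A where
  toFun v := (last v).1 ⟨0, hr⟩
  map_add' v w := by rw [map_add, fst_add]
  map_smul' a v := by rw [map_smul, fst_smul]; rfl

/-- The empty word in the last copy. -/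
def vacuum (A : Type*) [Ring A] (n r : ℕ) : Tower A n r := emb n n (xw A r 0)

theorem coeffZero_emb_of_ne {j : ℕ} (h : j ≠ n) (w : Window A r) :
    coeffZero hr (emb n j w) = 0 := by
  change (last (emb n j w)).1 _ = 0
  rw [last_emb_of_ne h]
  rfl

theorem coeffZero_emb_last (w : Window A r) : coeffZero hr (emb n n w) = w.1 ⟨0, hr⟩ := by
  change (last (emb n n w)).1 _ = _
  rw [last_emb_last]

end Tower

/-! ### Consecutive ranks -/

/-- An algebra generated by a system of rank `n`, with the automorphism `σ` that is the identity on
the `T i` and `-1` on the two Clifford families. -/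
structure HCAlg {R : Type*} [CommRing R] (e : R) (P : R[X]) (n : ℕ) (B : Type*) [Ring B]
    [Algebra R B] extends HCSystem e P n B where
  generates : toHCSystem.Generates
  σ : B →ₐ[R] B
  σ_T : ∀ i, i + 1 < n → σ (T i) = T i
  σ_C : ∀ j, j < n → σ (C j) = -C j
  σ_Y : ∀ j, j < n → σ (Y j) = -Y j

namespace HCAlg

variable {R : Type*} [CommRing R] {e : R} {P : R[X]} {n : ℕ} {B : Type*} [Ring B] [Algebra R B]

theorem induction (b : HCAlg e P n B) {p : B → Prop} (halg : ∀ a : R, p (algebraMap R B a))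
    (hadd : ∀ x y, p x → p y → p (x + y)) (hmul : ∀ x y, p x → p y → p (x * y))
    (hT : ∀ i, i + 1 < n → p (b.T i)) (hC : 0 < n → p (b.C 0)) (hY : 0 < n → p (b.Y 0)) (x : B) :
    p x := by
  have h := b.generates
    { carrier := {x | p x}
      mul_mem' := hmul _ _
      add_mem' := hadd _ _
      algebraMap_mem' := halg } hT hC hY
  have hx : x ∈ (⊤ : Subalgebra R B) := Algebra.mem_top
  rw [← h] at hx
  exact hx

variable (b : HCAlg e P n B)

theorem σ_σ (x : B) : b.σ (b.σ x) = x := by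
  refine b.induction (p := fun x => b.σ (b.σ x) = x) (fun a => ?_) (fun x y hx hy => ?_)
    (fun x y hx hy => ?_) (fun i hi => ?_) (fun h => ?_) (fun h => ?_) x
  · rw [AlgHom.commutes, AlgHom.commutes]
  · rw [map_add, map_add, hx, hy]
  · rw [map_mul, map_mul, hx, hy]
  · rw [b.σ_T i hi, b.σ_T i hi]
  · rw [b.σ_C 0 h, map_neg, b.σ_C 0 h, neg_neg]
  · rw [b.σ_Y 0 h, map_neg, b.σ_Y 0 h, neg_neg]

/-- The generator `X j` as a unit. -/
def Xu (j : ℕ) (h : j < n) : Bˣ := ⟨b.X j, b.X' j, b.X_mul_X' h, b.X'_mul_X h⟩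

theorem val_Xu {j : ℕ} (h : j < n) : (b.Xu j h : B) = b.X j := rfl

theorem val_Xu_pow {j : ℕ} (h : j < n) (k : ℕ) : ((b.Xu j h ^ (k : ℤ) : Bˣ) : B) = b.X j ^ k := by
  rw [zpow_natCast, Units.val_pow_eq_pow_val, val_Xu]

theorem C_zpow {j : ℕ} (h : j < n) (k : ℤ) :
    b.C j * ((b.Xu j h ^ k : Bˣ) : B) = ((b.Xu j h ^ (-k) : Bˣ) : B) * b.C j := by
  have h1 : SemiconjBy (b.C j) ((b.Xu j h : Bˣ) : B) (((b.Xu j h)⁻¹ : Bˣ) : B) := by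
    change b.C j * (b.C j * b.Y j) = b.Y j * b.C j * b.C j
    rw [← mul_assoc, mul_assoc (b.Y j), b.C_sq j h, one_mul, mul_one]
  have h2 := h1.units_zpow_right k
  rw [inv_zpow'] at h2
  exact h2

theorem zpow_C {j : ℕ} (h : j < n) (k : ℤ) :
    ((b.Xu j h ^ k : Bˣ) : B) * b.C j = b.C j * ((b.Xu j h ^ (-k) : Bˣ) : B) := by
  rw [b.C_zpow h, neg_neg]

theorem σ_X {j : ℕ} (h : j < n) : b.σ (b.X j) = b.X j := by
  rw [HCSystem.X, map_mul, b.σ_C j h, b.σ_Y j h, neg_mul_neg]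

theorem σ_zpow {j : ℕ} (h : j < n) (k : ℤ) :
    b.σ ((b.Xu j h ^ k : Bˣ) : B) = ((b.Xu j h ^ k : Bˣ) : B) := by
  have h1 : Units.map (b.σ : B →* B) (b.Xu j h) = b.Xu j h := Units.ext (b.σ_X h)
  have h2 := congrArg (fun u : Bˣ => ((u ^ k : Bˣ) : B)) h1
  simp only [← map_zpow] at h2
  exact h2

variable (b : HCAlg e P (n + 1) B)

/-- The powers of the last generator `X`. -/
def Xp (k : ℤ) : B := ((b.Xu n (Nat.lt_succ_self n) ^ k : Bˣ) : B)

theorem Xp_natCast (k : ℕ) : b.Xp k = b.X n ^ k := b.val_Xu_pow _ k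

theorem Xp_zero : b.Xp 0 = 1 := by rw [Xp, zpow_zero, Units.val_one]

theorem Xp_one : b.Xp 1 = b.X n := by rw [Xp, zpow_one, val_Xu]

theorem Xp_add (j k : ℤ) : b.Xp (j + k) = b.Xp j * b.Xp k := by
  rw [Xp, zpow_add, Units.val_mul, Xp, Xp]

theorem Xp_mul (j k : ℤ) : b.Xp j * b.Xp k = b.Xp (j + k) := (b.Xp_add j k).symm

theorem C_Xp (k : ℤ) : b.C n * b.Xp k = b.Xp (-k) * b.C n := b.C_zpow _ k

theorem Xp_C (k : ℤ) : b.Xp k * b.C n = b.C n * b.Xp (-k) := b.zpow_C _ k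

theorem C_C : b.C n * b.C n = 1 := b.C_sq n (Nat.lt_succ_self n)

theorem σ_Xp (k : ℤ) : b.σ (b.Xp k) = b.Xp k := b.σ_zpow _ k

end HCAlg

/-- Two consecutive ranks: a homomorphism `ι` that respects the generators, and the projection `π`
onto the coefficient of the empty word. -/
structure HCStep {R : Type*} [CommRing R] {e : R} {P : R[X]} {n : ℕ} {A B : Type*} [Ring A]
    [Algebra R A] [Ring B] [Algebra R B] (r : ℕ) (a : HCAlg e P n A) (b : HCAlg e P (n + 1) B) where
  ι : A →ₐ[R] B
  ι_T : ∀ i, i + 1 < n → ι (a.T i) = b.T i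
  ι_C : ∀ j, j < n → ι (a.C j) = b.C j
  ι_Y : ∀ j, j < n → ι (a.Y j) = b.Y j
  π : B →ₗ[R] A
  π_left : ∀ x y, π (ι x * y) = x * π y
  π_right : ∀ x y, π (y * ι x) = π y * x
  π_T : ∀ i, i + 1 = n → π (b.T i) = 0
  π_X : ∀ k, k < r → π (b.X n ^ k) = if k = 0 then 1 else 0
  π_CX : ∀ k, k < r → π (b.C n * b.X n ^ k) = 0

namespace HCStep

variable {R : Type*} [CommRing R] {e : R} {P : R[X]} {n r : ℕ} {A B : Type*} [Ring A]
  [Algebra R A] [Ring B] [Algebra R B] {a : HCAlg e P n A} {b : HCAlg e P (n + 1) B}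
  (S : HCStep r a b)

theorem ι_X {j : ℕ} (h : j < n) : S.ι (a.X j) = b.X j := by
  rw [HCSystem.X, map_mul, S.ι_C j h, S.ι_Y j h, HCSystem.X]

theorem X_ι (x : A) : b.X n * S.ι x = S.ι x * b.X n := by
  have hn : n < n + 1 := Nat.lt_succ_self n
  refine a.induction (p := fun x => b.X n * S.ι x = S.ι x * b.X n) (fun c => ?_)
    (fun x y hx hy => ?_) (fun x y hx hy => ?_) (fun i hi => ?_) (fun h => ?_) (fun h => ?_) x
  · rw [AlgHom.commutes, Algebra.commutes]
  · rw [map_add, mul_add, add_mul, hx, hy]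
  · rw [map_mul, ← mul_assoc, hx, mul_assoc, hy, mul_assoc]
  · rw [S.ι_T i hi, b.T_X_comm (by omega) hn (by omega) (by omega)]
  · rw [S.ι_C 0 h, b.X_C_comm hn (by omega) (by omega)]
  · rw [S.ι_Y 0 h, b.X_Y_comm hn (by omega) (by omega)]

theorem Xp_ι (k : ℤ) (x : A) : b.Xp k * S.ι x = S.ι x * b.Xp k := by
  have h : Commute (S.ι x) (b.Xu n (Nat.lt_succ_self n) : B) := (S.X_ι x).symm
  exact (h.units_zpow_right k).symm

theorem C_ι (x : A) : b.C n * S.ι x = S.ι (a.σ x) * b.C n := by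
  have hn : n < n + 1 := Nat.lt_succ_self n
  refine a.induction (p := fun x => b.C n * S.ι x = S.ι (a.σ x) * b.C n) (fun c => ?_)
    (fun x y hx hy => ?_) (fun x y hx hy => ?_) (fun i hi => ?_) (fun h => ?_) (fun h => ?_) x
  · rw [AlgHom.commutes, AlgHom.commutes, AlgHom.commutes, Algebra.commutes]
  · rw [map_add, map_add, map_add, mul_add, add_mul, hx, hy]
  · rw [map_mul, map_mul, map_mul, ← mul_assoc, hx, mul_assoc, hy, mul_assoc]
  · rw [a.σ_T i hi, S.ι_T i hi, b.T_C_comm i n (by omega) hn (by omega) (by omega)]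
  · rw [a.σ_C 0 h, map_neg, S.ι_C 0 h, b.C_anti n 0 hn (by omega) (by omega), neg_mul]
  · rw [a.σ_Y 0 h, map_neg, S.ι_Y 0 h, b.C_Y_anti n 0 hn (by omega) (by omega), neg_mul]

theorem ι_mul_C (x : A) : S.ι x * b.C n = b.C n * S.ι (a.σ x) := by
  rw [S.C_ι, a.σ_σ]

theorem σ_ι (x : A) : b.σ (S.ι x) = S.ι (a.σ x) := by
  refine a.induction (p := fun x => b.σ (S.ι x) = S.ι (a.σ x)) (fun c => ?_)
    (fun x y hx hy => ?_) (fun x y hx hy => ?_) (fun i hi => ?_) (fun h => ?_) (fun h => ?_) x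
  · rw [AlgHom.commutes, AlgHom.commutes, AlgHom.commutes, AlgHom.commutes]
  · rw [map_add, map_add, map_add, map_add, hx, hy]
  · rw [map_mul, map_mul, map_mul, map_mul, hx, hy]
  · rw [a.σ_T i hi, S.ι_T i hi, b.σ_T i (by omega)]
  · rw [a.σ_C 0 h, map_neg, S.ι_C 0 h, b.σ_C 0 (by omega)]
  · rw [a.σ_Y 0 h, map_neg, S.ι_Y 0 h, b.σ_Y 0 (by omega)]

theorem π_ι (h : 0 < r) (x : A) : S.π (S.ι x) = x := by
  have h0 := S.π_X 0 h
  rw [pow_zero, if_pos rfl] at h0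
  rw [← mul_one (S.ι x), S.π_left, h0, mul_one]

/-- The words of the Mackey decomposition. -/
inductive IsWord : B → Prop
  | T (i : ℕ) (h : i + 1 = n) (x y : A) : IsWord (S.ι x * b.T i * S.ι y)
  | X (k : ℕ) (h : k < r) (x : A) : IsWord (b.X n ^ k * S.ι x)
  | CX (k : ℕ) (h : k < r) (x : A) : IsWord (b.C n * b.X n ^ k * S.ι x)

/-- The sums of words. -/
def words : AddSubmonoid B := AddSubmonoid.closure {x | S.IsWord x}

/-- Every element is a sum of words. -/
def Spans : Prop := ∀ x, x ∈ S.words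

variable {S}

theorem Spans.induction (h : S.Spans) (hr : 0 < r) {p : B → Prop}
    (hadd : ∀ x y, p x → p y → p (x + y))
    (hT : ∀ i, i + 1 = n → ∀ x y, p (S.ι x * b.T i * S.ι y))
    (hX : ∀ k < r, ∀ x, p (b.X n ^ k * S.ι x)) (hC : ∀ k < r, ∀ x, p (b.C n * b.X n ^ k * S.ι x))
    (x : B) : p x := by
  refine AddSubmonoid.closure_induction (motive := fun x _ => p x) ?_ ?_ (fun x y _ _ => hadd x y) (h x)
  · intro x hx
    cases hx with
    | T i h x y => exact hT i h x y
    | X k h x => exact hX k h x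
    | CX k h x => exact hC k h x
  · have := hX 0 hr 0
    rwa [map_zero, mul_zero] at this

theorem ι_mul_words {x : B} (h : x ∈ S.words) (y : A) : S.ι y * x ∈ S.words := by
  refine AddSubmonoid.closure_induction (motive := fun x _ => S.ι y * x ∈ S.words) (fun x h => ?_)
    ?_ (fun x z _ _ h h' => ?_) h
  · cases h with
    | T i h x z =>
      rw [← mul_assoc, ← mul_assoc, ← map_mul]
      exact AddSubmonoid.subset_closure (IsWord.T i h _ _)
    | X k h x =>
      rw [← mul_assoc, ← b.Xp_natCast, ← S.Xp_ι, mul_assoc, ← map_mul, b.Xp_natCast]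
      exact AddSubmonoid.subset_closure (IsWord.X k h _)
    | CX k h x =>
      rw [← mul_assoc, ← mul_assoc, S.ι_mul_C, mul_assoc _ _ (b.X n ^ k), ← b.Xp_natCast, ← S.Xp_ι,
        mul_assoc, mul_assoc, ← map_mul, b.Xp_natCast, ← mul_assoc]
      exact AddSubmonoid.subset_closure (IsWord.CX k h _)
  · rw [mul_zero]; exact zero_mem _
  · rw [mul_add]; exact add_mem h h'

theorem words_mul_ι {x : B} (h : x ∈ S.words) (y : A) : x * S.ι y ∈ S.words := by
  refine AddSubmonoid.closure_induction (motive := fun x _ => x *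
      S.ι y ∈ S.words) (fun x h => ?_) ?_
    (fun x z _ _ h h' => ?_) h
  · cases h with
    | T i h x z =>
      rw [mul_assoc, ← map_mul]
      exact AddSubmonoid.subset_closure (IsWord.T i h _ _)
    | X k h x =>
      rw [mul_assoc, ← map_mul]
      exact AddSubmonoid.subset_closure (IsWord.X k h _)
    | CX k h x =>
      rw [mul_assoc, ← map_mul]
      exact AddSubmonoid.subset_closure (IsWord.CX k h _)
  · rw [zero_mul]; exact zero_mem _
  · rw [add_mul]; exact add_mem h h'

/-- The sums of words form everything as soon as they are stable under the generators that are not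
in the image of `ι`. -/
theorem spans_of (hr : 0 < r) (hT : ∀ i, i + 1 = n → ∀ x, S.IsWord x → b.T i * x ∈ S.words)
    (h0 : n = 0 → ∀ x, S.IsWord x → b.C n * x ∈ S.words ∧ b.X n * x ∈ S.words) : S.Spans := by
  have hlift : ∀ y : B, (∀ x, S.IsWord x → y * x ∈ S.words) → ∀ x ∈ S.words, y * x ∈ S.words :=
    fun y hy x hx => by
      refine AddSubmonoid.closure_induction (motive := fun x _ => y * x ∈ S.words)
        (fun x h => hy x h) ?_ (fun x z _ _ h h' => ?_) hx
      · rw [mul_zero]; exact zero_mem _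
      · rw [mul_add]; exact add_mem h h'
  have hall : ∀ y : B, ∀ x ∈ S.words, y * x ∈ S.words := fun y => by
    refine b.induction (p := fun y => ∀ x ∈ S.words, y * x ∈ S.words) (fun c => ?_)
      (fun x y hx hy z hz => ?_) (fun x y hx hy z hz => ?_) (fun i hi => ?_) (fun _ => ?_)
      (fun _ => ?_) y
    · rw [← S.ι.commutes]
      exact fun x hx => ι_mul_words hx _
    · rw [add_mul]; exact add_mem (hx z hz) (hy z hz)
    · rw [mul_assoc]; exact hx _ (hy z hz)
    · rcases Nat.lt_or_ge (i + 1) n with h | h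
      · rw [← S.ι_T i h]
        exact fun x hx => ι_mul_words hx _
      · exact hlift _ (hT i (by omega))
    · rcases Nat.eq_zero_or_pos n with h | h
      · have := hlift _ fun x hx => (h0 h x hx).1
        rwa [congrArg b.C h] at this
      · rw [← S.ι_C 0 h]
        exact fun x hx => ι_mul_words hx _
    · rcases Nat.eq_zero_or_pos n with h | h
      · have h1 := hlift _ fun x hx => (h0 h x hx).1
        have h2 := hlift _ fun x hx => (h0 h x hx).2
        intro x hx
        rw [← b.C_X (Nat.succ_pos n), mul_assoc, congrArg b.C h.symm,
          congrArg b.X h.symm]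
        exact h1 _ (h2 x hx)
      · rw [← S.ι_Y 0 h]
        exact fun x hx => ι_mul_words hx _
  intro x
  have h1 : (1 : B) ∈ S.words := by
    have := AddSubmonoid.subset_closure (IsWord.X (S := S) 0 hr 1)
    rwa [pow_zero, map_one, mul_one] at this
  have := hall x 1 h1
  rwa [mul_one] at this

end HCStep

/-! ### Spanning by words -/

namespace HCStep

section Rank

variable {R : Type*} [CommRing R] {e : R} {P : R[X]} {n r : ℕ} {A B : Type*} [Ring A]
  [Algebra R A] [Ring B] [Algebra R B] {a : HCAlg e P (n + 1) A} {b : HCAlg e P (n + 2) B}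
  (S : HCStep r a b)

theorem T_T : b.T n * b.T n = e • b.T n + 1 := b.T_sq n (Nat.lt_succ_self _)

theorem T_X : b.T n * b.X (n + 1) = S.ι (a.X n) * b.T n +
    e • (b.X (n + 1) - S.ι (a.C n) * b.C (n + 1) * b.X (n + 1)) := by
  rw [b.T_X_succ (Nat.lt_succ_self _), S.ι_X (Nat.lt_succ_self _), S.ι_C n (Nat.lt_succ_self _),
    sub_mul, one_mul]

theorem X_T : b.X (n + 1) * b.T n = b.T n * S.ι (a.X n) +
    e • (b.X (n + 1) + S.ι (a.C n) * b.C (n + 1) * S.ι (a.X n)) := by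
  rw [S.ι_X (Nat.lt_succ_self _), S.ι_C n (Nat.lt_succ_self _),
    b.toHCSystem.T_X (Nat.lt_succ_self _), sub_add_cancel]

theorem T_C : b.T n * b.C (n + 1) =
    S.ι (a.C n) * b.T n - e • (S.ι (a.C n) - b.C (n + 1)) := by
  rw [b.T_C_succ (Nat.lt_succ_self _), S.ι_C n (Nat.lt_succ_self _)]

theorem C_T : b.C (n + 1) * b.T n = b.T n * S.ι (a.C n) := by
  rw [S.ι_C n (Nat.lt_succ_self _), b.toHCSystem.T_C n (Nat.lt_succ_self _)]

theorem T_C_X : b.T n * b.C (n + 1) * b.X (n + 1) = S.ι (a.C n * a.X n) * b.T n := by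
  rw [mul_assoc, b.C_X (Nat.lt_succ_self _), b.T_Y n (Nat.lt_succ_self _),
    a.C_X (Nat.lt_succ_self _), S.ι_Y n (Nat.lt_succ_self _)]

theorem Xp_succ (b : HCAlg e P (n + 1) B) (k : ℤ) : b.Xp (k + 1) = b.X n * b.Xp k := by
  rw [add_comm, b.Xp_add, b.Xp_one]

theorem T_Xp_succ (k : ℤ) : b.T n * b.Xp (k + 1) = S.ι (a.X n) * b.T n * b.Xp k +
    e • (b.Xp (k + 1) - S.ι (a.C n) * (b.C (n + 1) * b.Xp (k + 1))) := by
  rw [Xp_succ, ← mul_assoc, S.T_X, add_mul, smul_mul_assoc, sub_mul]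
  simp only [mul_assoc]

theorem T_C_Xp_succ (k : ℤ) : b.T n * (b.C (n + 1) * b.Xp (k + 1)) =
    S.ι (a.C n * a.X n) * (b.T n * b.Xp k) := by
  rw [Xp_succ, ← mul_assoc, ← mul_assoc, S.T_C_X, mul_assoc]

/-- The passage of one factor `X` through the second `T` of `T x T X ^ k`. -/
theorem T_ι_T_Xp_succ (x : A) (k : ℤ) : b.T n * S.ι x * b.T n * b.Xp (k + 1) =
    b.T n * S.ι (x * a.X n) * b.T n * b.Xp k + e • (b.T n * b.Xp (k + 1) * S.ι x) +
      e • (b.T n * (b.C (n + 1) * b.Xp (k + 1)) * S.ι (a.σ x * a.C n)) := by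
  have h1 : S.ι x * b.Xp (k + 1) = b.Xp (k + 1) * S.ι x := (S.Xp_ι _ _).symm
  have h2 : S.ι x * S.ι (a.C n) * (b.C (n + 1) * b.Xp (k + 1)) =
      -(b.C (n + 1) * b.Xp (k + 1) * S.ι (a.σ x * a.C n)) := by
    rw [← map_mul, ← mul_assoc, S.ι_mul_C, mul_assoc, ← S.Xp_ι, map_mul a.σ,
      a.σ_C n (Nat.lt_succ_self n), mul_neg, map_neg, mul_neg, mul_neg, mul_assoc]
  rw [mul_assoc _ (b.T n)]
  conv_lhs => rw [S.T_Xp_succ]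
  rw [mul_add, mul_smul_comm, mul_sub, mul_assoc (b.T n) (S.ι x),
    mul_assoc (b.T n) (S.ι x) (b.Xp _), mul_assoc (b.T n) (S.ι x) (S.ι _ * _), h1,
    ← mul_assoc (S.ι x) (S.ι _), h2, mul_neg, sub_neg_eq_add, smul_add, map_mul S.ι x]
  simp only [mul_assoc, add_assoc]

variable {A₀ : Type*} [Ring A₀] [Algebra R A₀] {a₀ : HCAlg e P n A₀} {S}

theorem ι_ι_T (S' : HCStep r a₀ a) (x : A₀) :
    b.T n * S.ι (S'.ι x) = S.ι (S'.ι x) * b.T n := by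
  refine a₀.induction (p := fun x => b.T n * S.ι (S'.ι x) = S.ι (S'.ι x) * b.T n) (fun c => ?_)
    (fun x y hx hy => ?_) (fun x y hx hy => ?_) (fun i hi => ?_) (fun h => ?_) (fun h => ?_) x
  · rw [AlgHom.commutes, AlgHom.commutes, Algebra.commutes]
  · rw [map_add, map_add, mul_add, add_mul, hx, hy]
  · rw [map_mul, map_mul, ← mul_assoc, hx, mul_assoc, hy, mul_assoc]
  · rw [S'.ι_T i hi, S.ι_T i (by omega), b.T_comm i n (by omega) (by omega) hi]
  · rw [S'.ι_C 0 h, S.ι_C 0 (by omega), b.T_C_comm n 0 (by omega) (by omega) (by omega) (by omega)]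
  · rw [S'.ι_Y 0 h, S.ι_Y 0 (by omega), b.T_Y_comm n 0 (by omega) (by omega) (by omega) (by omega)]

theorem smul_mem_words {x : B} (h : x ∈ S.words) (c : R) : c • x ∈ S.words := by
  rw [Algebra.smul_def, ← S.ι.commutes]
  exact ι_mul_words h _

theorem neg_mem_words {x : B} (h : x ∈ S.words) : -x ∈ S.words := by
  rw [← neg_one_smul R]
  exact smul_mem_words h _

theorem sub_mem_words {x y : B} (h : x ∈ S.words) (h' : y ∈ S.words) : x - y ∈ S.words := by
  rw [sub_eq_add_neg]
  exact add_mem h (neg_mem_words h')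

theorem Xp_mem_words {k : ℕ} (h : k < r) : b.Xp k ∈ S.words := by
  have := AddSubmonoid.subset_closure (IsWord.X (S := S) k h 1)
  rwa [map_one, mul_one, ← b.Xp_natCast] at this

theorem C_Xp_mem_words {k : ℕ} (h : k < r) : b.C (n + 1) * b.Xp k ∈ S.words := by
  have := AddSubmonoid.subset_closure (IsWord.CX (S := S) k h 1)
  rwa [map_one, mul_one, ← b.Xp_natCast] at this

theorem T_mem_words : b.T n ∈ S.words := by
  have := AddSubmonoid.subset_closure (IsWord.T (S := S) n rfl 1 1)
  rwa [map_one, mul_one, one_mul] at this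

theorem T_Xp_mem_words {k : ℕ} (h : k < r) : b.T n * b.Xp k ∈ S.words := by
  induction k with
  | zero => rw [Nat.cast_zero, b.Xp_zero, mul_one]; exact T_mem_words
  | succ k ih =>
    have h1 := Xp_mem_words (S := S) h
    have h2 := C_Xp_mem_words (S := S) h
    rw [Nat.cast_succ] at h1 h2 ⊢
    rw [S.T_Xp_succ, mul_assoc]
    exact add_mem (ι_mul_words (ih (by omega)) _)
      (smul_mem_words (sub_mem_words h1 (ι_mul_words h2 _)) _)

theorem T_C_Xp_mem_words {k : ℕ} (h : k < r) :
    b.T n * (b.C (n + 1) * b.Xp k) ∈ S.words := by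
  rw [← mul_assoc, S.T_C, sub_mul, smul_mul_assoc, sub_mul, mul_assoc]
  exact sub_mem_words (ι_mul_words (T_Xp_mem_words h) _)
    (smul_mem_words (sub_mem_words (ι_mul_words (Xp_mem_words h) _) (C_Xp_mem_words h)) _)

theorem T_ι_T_mem_words {x : A} (h : ∀ k < r, b.T n * S.ι x * b.T n * b.Xp (k : ℕ) ∈ S.words)
    {j k : ℕ} (hjk : j + k < r) : b.T n * S.ι (x * a.Xp j) * b.T n * b.Xp k ∈ S.words := by
  induction j generalizing k with
  | zero => rw [Nat.cast_zero, a.Xp_zero, mul_one]; exact h k (by omega)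
  | succ j ih =>
    have h1 := S.T_ι_T_Xp_succ (x * a.Xp j) k
    have h2 := ih (k := k + 1) (by omega)
    have h3 := T_Xp_mem_words (S := S) (k := k + 1) (by omega)
    have h4 := T_C_Xp_mem_words (S := S) (k := k + 1) (by omega)
    rw [Nat.cast_succ] at h2 h3 h4 ⊢
    rw [a.Xp_add, a.Xp_one, ← mul_assoc, ← add_sub_cancel_right (b.T n * S.ι (_ * a.X n) * _ * _)
      (e • (b.T n * b.Xp (k + 1) * S.ι (x * a.Xp j))), ← add_sub_cancel_right (_ + _)
      (e • (b.T n * (b.C (n + 1) * b.Xp (k + 1)) * S.ι (a.σ (x * a.Xp j) * a.C n))), sub_right_comm,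
      ← h1]
    exact sub_mem_words (sub_mem_words h2 (smul_mem_words (words_mul_ι h3 _) _))
      (smul_mem_words (words_mul_ι h4 _) _)

/-- If the words span in one rank, then they do in the next. -/
theorem Spans.succ {S' : HCStep r a₀ a} (h : S'.Spans) (hr : 0 < r) : S.Spans := by
  have h1 : ∀ k < r, b.T n * S.ι 1 * b.T n * b.Xp (k : ℕ) ∈ S.words := fun k hk => by
    rw [map_one, mul_one, T_T, add_mul, smul_mul_assoc, one_mul]
    exact add_mem (smul_mem_words (T_Xp_mem_words hk) _) (Xp_mem_words hk)
  have h2 : ∀ k < r, b.T n * S.ι (a.C n) * b.T n * b.Xp (k : ℕ) ∈ S.words := fun k hk => by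
    rw [← S.C_T, mul_assoc (b.C _), T_T, mul_add, add_mul, mul_one, mul_smul_comm, S.C_T,
      smul_mul_assoc, mul_assoc (b.T n), ← S.Xp_ι, ← mul_assoc]
    exact add_mem (smul_mem_words (words_mul_ι (T_Xp_mem_words hk) _) _) (C_Xp_mem_words hk)
  have hTT : ∀ x, b.T n * S.ι x * b.T n ∈ S.words := fun x => by
    refine h.induction hr (p := fun x => b.T n * S.ι x * b.T n ∈ S.words) (fun x y hx hy => ?_)
      (fun i hi x y => ?_) (fun k hk x => ?_) (fun k hk x => ?_) x
    · rw [map_add, mul_add, add_mul]; exact add_mem hx hy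
    · have hb : b.T n * S.ι (a.T i) * b.T n = S.ι (a.T i) * b.T n * S.ι (a.T i) := by
        subst hi
        rw [S.ι_T i (by omega), b.T_braid i (by omega)]
      have h3 : b.T n * S.ι (S'.ι x * a.T i * S'.ι y) * b.T n =
          S.ι (S'.ι x * a.T i) * b.T n * S.ι (a.T i * S'.ι y) := by
        calc _ = b.T n * S.ι (S'.ι x) * S.ι (a.T i) * (S.ι (S'.ι y) * b.T n) := by
              rw [map_mul, map_mul]; simp only [mul_assoc]
          _ = S.ι (S'.ι x) * (b.T n * S.ι (a.T i) * b.T n) * S.ι (S'.ι y) := by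
              rw [← ι_ι_T, ι_ι_T]; simp only [mul_assoc]
          _ = _ := by rw [hb, map_mul, map_mul]; simp only [mul_assoc]
      rw [h3]
      exact AddSubmonoid.subset_closure (IsWord.T n rfl _ _)
    · have h3 := T_ι_T_mem_words (S := S) h1 (j := k) (k := 0) (by omega)
      rw [map_mul, mul_assoc, mul_assoc, ← ι_ι_T, ← mul_assoc, ← mul_assoc]
      refine words_mul_ι ?_ _
      rwa [one_mul, Nat.cast_zero, b.Xp_zero, mul_one, a.Xp_natCast] at h3
    · have h3 := T_ι_T_mem_words (S := S) h2 (j := k) (k := 0) (by omega)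
      rw [map_mul, mul_assoc, mul_assoc, ← ι_ι_T, ← mul_assoc, ← mul_assoc]
      refine words_mul_ι ?_ _
      rwa [Nat.cast_zero, b.Xp_zero, mul_one, a.Xp_natCast] at h3
  refine spans_of hr (fun i hi x hx => ?_) (fun h => by omega)
  obtain rfl : i = n := by omega
  cases hx with
  | T j hj x y =>
    obtain rfl : j = i := by omega
    rw [← mul_assoc, ← mul_assoc]
    exact words_mul_ι (hTT x) _
  | X k hk x =>
    rw [← mul_assoc, ← b.Xp_natCast]
    exact words_mul_ι (T_Xp_mem_words hk) _
  | CX k hk x =>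
    rw [← mul_assoc, ← b.Xp_natCast]
    exact words_mul_ι (T_C_Xp_mem_words hk) _

end Rank

end HCStep

/-! ### Regular projections and rank one -/

namespace HCStep

section General

variable {R : Type*} [CommRing R] {e : R} {P : R[X]} {n r : ℕ} {A B : Type*} [Ring A]
  [Algebra R A] [Ring B] [Algebra R B] {a : HCAlg e P n A} {b : HCAlg e P (n + 1) B}
  (S : HCStep r a b)

/-- The properties of the projection `π` that are passed on from one rank to the next. The
vanishing `v` and the symmetry `u` describe `π` on all integral powers of the last `X`. -/
structure Regular (s' : R) : Prop where
  spans : S.Spans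
  comm : ∀ x, S.π (b.X n * x) = S.π (x * b.X n)
  v : ∀ k : ℤ, S.π (b.C n * b.Xp k) = 0
  u : ∀ k : ℕ, S.π (b.Xp (r + k)) = s' • S.π (b.Xp (-k))

/-- The values of `π` at the powers of the last `X` are central, since `X` commutes with the lower
rank. -/
theorem u_central (k : ℤ) (x : A) : S.π (b.Xp k) * x = x * S.π (b.Xp k) := by
  rw [← S.π_right, S.Xp_ι, S.π_left]

theorem u_of_lt {k : ℕ} (hk : k < r) : S.π (b.Xp k) = if k = 0 then 1 else 0 := by
  rw [b.Xp_natCast, S.π_X k hk]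

theorem u_zero (hr : 0 < r) : S.π (b.Xp 0) = 1 := by
  have := S.u_of_lt hr
  rwa [if_pos rfl] at this

theorem v_of_lt {k : ℕ} (hk : k < r) : S.π (b.C n * b.Xp k) = 0 := by
  rw [b.Xp_natCast, S.π_CX k hk]

theorem v_zero (hr : 0 < r) : S.π (b.C n * b.Xp 0) = 0 := S.v_of_lt hr

theorem π_C (hr : 0 < r) : S.π (b.C n) = 0 := by
  have := S.v_zero hr
  rwa [b.Xp_zero, mul_one] at this

variable {S}

/-- Multiplications by the last `X` from the left and from the right agree under `π`. -/
theorem π_X_comm (hs : S.Spans) (hr : 0 < r) (h1 : S.π (b.C n * b.Xp (-1)) = 0)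
    (hvr : S.π (b.C n * b.Xp r) = 0)
    (hT : ∀ i, i + 1 = n → S.π (b.X n * b.T i) = S.π (b.T i * b.X n)) (x : B) :
    S.π (b.X n * x) = S.π (x * b.X n) := by
  refine hs.induction hr (p := fun x => S.π (b.X n * x) = S.π (x * b.X n))
    (fun x y hx hy => ?_) (fun i hi x y => ?_) (fun k hk x => ?_) (fun k hk x => ?_) x
  · rw [mul_add, map_add, add_mul, map_add, hx, hy]
  · rw [← mul_assoc, ← mul_assoc, S.X_ι, S.π_right, mul_assoc, S.π_left, hT i hi,
      mul_assoc _ _ (b.X n), ← S.X_ι, mul_assoc _ (b.T i), ← mul_assoc (b.T i), S.π_left,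
      S.π_right, mul_assoc]
  · rw [mul_assoc, ← S.X_ι, ← mul_assoc, ← mul_assoc, ← pow_succ, ← pow_succ']
  · have hm : S.π (b.C n * b.Xp (k - 1)) = 0 := by
      cases k with
      | zero => exact h1
      | succ k => rw [Nat.cast_succ, add_sub_cancel_right]; exact S.v_of_lt (by omega)
    have hp : S.π (b.C n * b.Xp (k + 1)) = 0 := by
      obtain h | h := eq_or_lt_of_le (Nat.succ_le_of_lt hk)
      · rwa [show (r : ℤ) = k + 1 by omega] at hvr
      · exact_mod_cast S.v_of_lt h
    rw [mul_assoc _ (S.ι x), ← S.X_ι, ← b.Xp_natCast, ← mul_assoc, ← mul_assoc, ← mul_assoc,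
      S.π_right, S.π_right, mul_assoc (b.C n), ← b.Xp_one, b.Xp_mul, hp, b.Xp_C, mul_assoc (b.C n),
      b.Xp_mul, neg_add_eq_sub, hm]

/-- Commutation with the last `X` under `π` makes `k ↦ π (C X ^ k)` two-periodic. -/
theorem v_eq_zero (hr : 0 < r) (hN : ∀ x, S.π (b.X n * x) = S.π (x * b.X n))
    (h1 : S.π (b.C n * b.Xp (-1)) = 0) (k : ℤ) : S.π (b.C n * b.Xp k) = 0 := by
  have hstep : ∀ k, S.π (b.C n * b.Xp (k - 1)) = S.π (b.C n * b.Xp (k + 1)) := fun k => by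
    have := hN (b.C n * b.Xp k)
    rwa [mul_assoc, ← b.Xp_one, b.Xp_mul, ← mul_assoc, b.Xp_C, mul_assoc, b.Xp_mul,
      neg_add_eq_sub] at this
  have key : ∀ k : ℤ, S.π (b.C n * b.Xp k) = 0 ∧ S.π (b.C n * b.Xp (k - 1)) = 0 := fun k => by
    induction k using Int.induction_on with
    | zero => exact ⟨S.v_zero hr, h1⟩
    | succ k ih => exact ⟨by rw [← hstep, ih.2], by rw [add_sub_cancel_right, ih.1]⟩
    | pred k ih =>
      refine ⟨ih.2, ?_⟩
      rw [hstep, sub_add_cancel, ih.1]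
  exact (key k).1

theorem comm_Xp (hN : ∀ x, S.π (b.X n * x) = S.π (x * b.X n)) (k : ℤ) (x : B) :
    S.π (b.Xp k * x) = S.π (x * b.Xp k) := by
  have h1 : ∀ x, S.π (b.Xp (-1) * x) = S.π (x * b.Xp (-1)) := fun x => by
    have := hN (b.Xp (-1) * x * b.Xp (-1))
    rw [mul_assoc _ _ (b.X n), ← mul_assoc (b.X n), ← mul_assoc (b.X n), ← b.Xp_one, b.Xp_mul,
      b.Xp_mul, show (1 + -1 : ℤ) = 0 by norm_num, show (-1 + 1 : ℤ) = 0 by norm_num, b.Xp_zero,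
      one_mul, mul_one] at this
    exact this.symm
  induction k using Int.induction_on generalizing x with
  | zero => rw [b.Xp_zero, one_mul, mul_one]
  | succ k ih => rw [b.Xp_add, mul_assoc, ih, b.Xp_one, mul_assoc, hN, mul_assoc]
  | pred k ih =>
    rw [sub_eq_add_neg, b.Xp_add, mul_assoc, ih, mul_assoc, h1, mul_assoc, b.Xp_mul]

theorem π_σ (hs : S.Spans) (hr : 0 < r) (x : B) : S.π (b.σ x) = a.σ (S.π x) := by
  have hn : n < n + 1 := Nat.lt_succ_self n
  refine hs.induction hr (p := fun x => S.π (b.σ x) = a.σ (S.π x))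
    (fun x y hx hy => ?_) (fun i hi x y => ?_) (fun k hk x => ?_) (fun k hk x => ?_) x
  · rw [map_add, map_add, map_add, map_add, hx, hy]
  · rw [map_mul b.σ, map_mul b.σ, S.σ_ι, S.σ_ι, b.σ_T i (by omega), S.π_right, S.π_left, S.π_right,
      S.π_left, S.π_T i hi, mul_zero, mul_zero, zero_mul, zero_mul, map_zero]
  · rw [map_mul b.σ, map_pow, b.σ_X hn, S.σ_ι, S.π_right, S.π_right, S.π_X k hk, map_mul]
    split_ifs
    · rw [map_one]
    · rw [map_zero]
  · rw [map_mul b.σ, map_mul b.σ, map_pow, b.σ_X hn, S.σ_ι, b.σ_C n hn, S.π_right, S.π_right,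
      neg_mul,
      map_neg, S.π_CX k hk, neg_zero, zero_mul, zero_mul, map_zero]

end General

section Base

variable {R : Type*} [CommRing R] {e : R} {P : R[X]} {r : ℕ} {A B : Type*} [Ring A]
  [Algebra R A] [Ring B] [Algebra R B] {a : HCAlg e P 0 A} {b : HCAlg e P 1 B}
  {S : HCStep r a b} {s : R}

/-- The cyclotomic relation as a linear recursion for the powers of `X`. -/
theorem sum_coeff_Xp (hP : IsPalindromic P r s) (k : ℤ) :
    ∑ i ∈ Finset.range (r + 1), P.coeff i • b.Xp (k + i) = 0 := by
  have h := b.cyc Nat.one_pos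
  rw [Polynomial.aeval_eq_sum_range' (Nat.lt_succ_of_le hP.natDegree_le)] at h
  have h2 := congrArg (b.Xp k * ·) h
  simp only [Finset.mul_sum, mul_zero] at h2
  rw [← h2]
  refine Finset.sum_congr rfl fun i _ => ?_
  rw [mul_smul_comm, b.Xp_add, b.Xp_natCast]
  rfl

theorem spans_base (hr : 0 < r) (hP : IsPalindromic P r s) : S.Spans := by
  have hsm : ∀ {x : B}, x ∈ S.words → ∀ c : R, c • x ∈ S.words := fun {x} h c => by
    rw [Algebra.smul_def, ← S.ι.commutes]
    exact ι_mul_words h _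
  have hng : ∀ {x : B}, x ∈ S.words → -x ∈ S.words := fun {x} h => by
    rw [← neg_one_smul R]
    exact hsm h _
  have hX : ∀ k < r, ∀ x, b.Xp (k : ℕ) * S.ι x ∈ S.words := fun k hk x => by
    rw [b.Xp_natCast]
    exact AddSubmonoid.subset_closure (IsWord.X k hk x)
  have hC : ∀ k < r, ∀ x, b.C 0 * b.Xp (k : ℕ) * S.ι x ∈ S.words := fun k hk x => by
    rw [b.Xp_natCast]
    exact AddSubmonoid.subset_closure (IsWord.CX k hk x)
  have hXr : b.Xp r = -∑ i ∈ Finset.range r, P.coeff i • b.Xp i := by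
    have := sum_coeff_Xp (b := b) hP 0
    simp only [zero_add] at this
    rw [Finset.sum_range_succ, hP.coeff_top, one_smul] at this
    rw [eq_neg_iff_add_eq_zero, add_comm, this]
  have hXm : b.Xp (-1) = -(s • ∑ i ∈ Finset.range r, P.coeff (i + 1) • b.Xp i) := by
    have := sum_coeff_Xp (b := b) hP (-1)
    rw [Finset.sum_range_succ', hP.coeff_zero, Nat.cast_zero, add_zero] at this
    have h1 : ∀ i : ℕ, (-1 + ((i + 1 : ℕ) : ℤ)) = i := fun i => by push_cast; ring
    have h2 := congrArg (s • ·) this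
    simp only [h1, smul_add, smul_zero] at h2
    rw [smul_smul s s, hP.sq, one_smul] at h2
    exact eq_neg_of_add_eq_zero_right h2
  refine spans_of hr (fun i hi => by omega) (fun _ x hx => ?_)
  cases hx with
  | T i h => omega
  | X k hk x =>
    refine ⟨?_, ?_⟩
    · rw [← b.Xp_natCast, ← mul_assoc]
      exact hC k hk x
    · rw [← mul_assoc, ← pow_succ', ← b.Xp_natCast]
      obtain h | h := eq_or_lt_of_le (Nat.succ_le_of_lt hk)
      · rw [show k + 1 = r from h, hXr, neg_mul, Finset.sum_mul]
        refine hng (sum_mem fun i hi => ?_)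
        rw [smul_mul_assoc]
        exact hsm (hX i (Finset.mem_range.1 hi) x) _
      · exact hX _ h x
  | CX k hk x =>
    refine ⟨?_, ?_⟩
    · rw [← mul_assoc, ← mul_assoc, b.C_C, one_mul, ← b.Xp_natCast]
      exact hX k hk x
    · rw [← mul_assoc, ← mul_assoc, ← b.Xp_natCast, ← b.Xp_one, b.Xp_C, mul_assoc (b.C 0), b.Xp_mul]
      cases k with
      | zero =>
        rw [Nat.cast_zero, add_zero, hXm, mul_neg, neg_mul, mul_smul_comm, smul_mul_assoc,
          Finset.mul_sum, Finset.sum_mul]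
        refine hng (hsm (sum_mem fun i hi => ?_) _)
        rw [mul_smul_comm, smul_mul_assoc]
        exact hsm (hC i (Finset.mem_range.1 hi) x) _
      | succ k =>
        rw [Nat.cast_succ, add_comm, add_neg_cancel_right]
        exact hC k (by omega) x

/-- In rank one the projection is regular: it kills the odd elements, and the symmetry of `u` is
that of the recursion with the coefficients of the palindromic polynomial `P`. -/
theorem regular_base (hr : 0 < r) (hP : IsPalindromic P r s) (hσ : ∀ x, a.σ x = x)
    (h2 : ∀ x : A, x + x = 0 → x = 0) : S.Regular (-s) := by
  have hs : S.Spans := spans_base hr hP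
  have hv : ∀ k : ℤ, S.π (b.C 0 * b.Xp k) = 0 := fun k => by
    have h := π_σ hs hr (b.C 0 * b.Xp k)
    rw [map_mul, b.σ_C 0 Nat.one_pos, b.σ_Xp, neg_mul, map_neg, hσ] at h
    exact h2 _ (by nth_rewrite 1 [← h]; exact neg_add_cancel _)
  refine ⟨hs, π_X_comm hs hr (hv _) (hv _) (fun i hi => by omega), hv, ?_⟩
  have hrec : ∀ k : ℤ, ∑ i ∈ Finset.range (r + 1), P.coeff i • S.π (b.Xp (k + i)) = 0 := fun k => by
    have := congrArg S.π (sum_coeff_Xp (b := b) hP k)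
    rw [map_sum, map_zero] at this
    rw [← this]
    exact Finset.sum_congr rfl fun i _ => (map_smul _ _ _).symm
  have hur : S.π (b.Xp r) = (-s) • 1 := by
    have h := hrec 0
    obtain ⟨r, rfl⟩ : ∃ m, r = m + 1 := ⟨r - 1, by omega⟩
    rw [Finset.sum_range_succ, Finset.sum_range_succ', hP.coeff_top, one_smul, hP.coeff_zero,
      Finset.sum_eq_zero, Nat.cast_zero, zero_add, zero_add, zero_add, S.u_zero hr] at h
    · rw [neg_smul, eq_neg_iff_add_eq_zero, add_comm, h]
    · intro i hi
      have := Finset.mem_range.1 hi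
      rw [zero_add, S.u_of_lt (by omega), if_neg (by omega), smul_zero]
  have hsym : ∀ k : ℤ, ∑ i ∈ Finset.range (r + 1), P.coeff i • (-s) • S.π (b.Xp (r - (k + i))) =
      0 := by
    intro k
    rw [← Finset.sum_range_reflect]
    have h := congrArg (fun x => (-s) • s • x) (hrec (-k))
    simp only [smul_zero, Finset.smul_sum] at h
    rw [← h]
    refine Finset.sum_congr rfl fun i hi => ?_
    have hi' := Finset.mem_range.1 hi
    rw [show r + 1 - 1 - i = r - i by omega, hP.coeff_sub i (by omega), Nat.cast_sub (by omega),
      show (r : ℤ) - (k + (r - i)) = -k + i by ring, smul_smul, smul_smul, smul_smul]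
    congr 1
    ring
  have key : ∀ k : ℕ, S.π (b.Xp k) = (-s) • S.π (b.Xp (r - k)) := by
    intro k
    induction k using Nat.strong_induction_on with
    | _ k ih =>
      rcases lt_or_ge k r with h | h
      · rcases Nat.eq_zero_or_pos k with rfl | h0
        · rw [Nat.cast_zero, sub_zero, hur, smul_smul, neg_mul_neg, hP.sq, one_smul, S.u_zero hr]
        · rw [S.u_of_lt h, if_neg (by omega), ← Nat.cast_sub h.le, S.u_of_lt (by omega),
            if_neg (by omega), smul_zero]
      · obtain ⟨j, rfl⟩ := Nat.exists_eq_add_of_le' h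
        have h1 := hrec j
        have h3 := hsym j
        rw [Finset.sum_range_succ, hP.coeff_top, one_smul] at h1 h3
        rw [Nat.cast_add, eq_neg_of_add_eq_zero_right h1, eq_neg_of_add_eq_zero_right h3]
        refine congrArg _ (Finset.sum_congr rfl fun i hi => ?_)
        have := ih (j + i) (by have := Finset.mem_range.1 hi; omega)
        rw [Nat.cast_add] at this
        rw [this]
  intro k
  have := key (r + k)
  rw [Nat.cast_add, sub_add_cancel_left] at this
  exact this

end Base

end HCStep

/-! ### Regularity in the next rank -/

namespace HCStep

variable {R : Type*} [CommRing R] {e : R} {P : R[X]} {n r : ℕ} {A B : Type*} [Ring A]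
  [Algebra R A] [Ring B] [Algebra R B] {a : HCAlg e P (n + 1) A} {b : HCAlg e P (n + 2) B}
  (S : HCStep r a b)

theorem α_zero : S.π (b.T n * b.Xp 0) = 0 := by
  rw [b.Xp_zero, mul_one, S.π_T n rfl]

/-- The recursion for the values `π (T X ^ k)`. -/
theorem α_succ (k : ℤ) : S.π (b.T n * b.Xp (k + 1)) = a.X n * S.π (b.T n * b.Xp k) +
    e • (S.π (b.Xp (k + 1)) - a.C n * S.π (b.C (n + 1) * b.Xp (k + 1))) := by
  rw [S.T_Xp_succ, map_add, mul_assoc, S.π_left, map_smul, map_sub, S.π_left]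

/-- The values `π (T C X ^ k)` are determined by the `π (T X ^ k)`. -/
theorem β_succ (k : ℤ) : S.π (b.T n * (b.C (n + 1) * b.Xp (k + 1))) =
    a.C n * a.X n * S.π (b.T n * b.Xp k) := by
  rw [S.T_C_Xp_succ, S.π_left]

theorem β_zero (hr : 0 < r) : S.π (b.T n * (b.C (n + 1) * b.Xp 0)) = -(e • a.C n) := by
  have h : S.ι (a.C n) = S.ι (a.C n) * 1 := (mul_one _).symm
  rw [b.Xp_zero, mul_one, S.T_C, map_sub, S.π_left, S.π_T n rfl, mul_zero, zero_sub, map_smul,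
    map_sub, S.π_C hr, S.π_ι hr, sub_zero]

theorem α_of_lt {k : ℕ} (hk : k < r) : S.π (b.T n * b.Xp k) = 0 := by
  induction k with
  | zero => exact S.α_zero
  | succ k ih =>
    have h1 := S.u_of_lt hk
    have h2 := S.v_of_lt hk
    rw [Nat.cast_succ] at h1 h2 ⊢
    rw [S.α_succ, ih (by omega), h1, h2, if_neg (by omega), mul_zero, mul_zero, sub_zero, smul_zero,
      add_zero]

theorem β_of_le {k : ℕ} (hk : k < r) : S.π (b.T n * (b.C (n + 1) * b.Xp (k + 1))) = 0 := by
  rw [S.β_succ, S.α_of_lt hk, mul_zero]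

theorem π_X_T (hr : 0 < r) (hv : S.π (b.C (n + 1) * b.Xp 1) = 0) :
    S.π (b.X (n + 1) * b.T n) = S.π (b.T n * b.X (n + 1)) := by
  have h1 := S.α_succ 0
  rw [zero_add, S.α_zero, mul_zero, zero_add, hv, mul_zero, sub_zero, b.Xp_one] at h1
  rw [h1, S.X_T, map_add, S.π_right, S.π_T n rfl, zero_mul, zero_add, map_smul, map_add,
    S.π_right, S.π_left, S.π_C hr, mul_zero, zero_mul, add_zero]

/-- The recursion for the values `π (T x T X ^ k)`. -/
theorem η_succ (x : A) (k : ℤ) : S.π (b.T n * S.ι x * b.T n * b.Xp (k + 1)) =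
    S.π (b.T n * S.ι (x * a.X n) * b.T n * b.Xp k) + e • (S.π (b.T n * b.Xp (k + 1)) * x) +
      e • (S.π (b.T n * (b.C (n + 1) * b.Xp (k + 1))) * (a.σ x * a.C n)) := by
  rw [S.T_ι_T_Xp_succ, map_add, map_add, map_smul, map_smul, S.π_right, S.π_right]

theorem η_one (k : ℤ) : S.π (b.T n * S.ι 1 * b.T n * b.Xp k) =
    S.π (b.Xp k) + e • S.π (b.T n * b.Xp k) := by
  rw [map_one, mul_one, T_T, add_mul, smul_mul_assoc, one_mul, map_add, map_smul, add_comm]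

theorem η_C (k : ℤ) : S.π (b.T n * S.ι (a.C n) * b.T n * b.Xp k) =
    S.π (b.C (n + 1) * b.Xp k) + e • (S.π (b.T n * b.Xp k) * a.C n) := by
  rw [← S.C_T, mul_assoc (b.C _), T_T, mul_add, add_mul, mul_one, mul_smul_comm, S.C_T,
    smul_mul_assoc, mul_assoc (b.T n), ← S.Xp_ι, ← mul_assoc, map_add, map_smul, S.π_right,
    add_comm]

/-- For `0 ≤ k ≤ r` the correction terms of `η_succ` add up to a single one, which vanishes for `k <
r`. -/
theorem η_range (x : A) {k : ℕ} (hk : k ≤ r) : S.π (b.T n * S.ι x * b.T n * b.Xp k) =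
    S.π (b.T n * S.ι (x * a.Xp k) * b.T n) + e • (S.π (b.T n * b.Xp k) * x) := by
  induction k generalizing x with
  | zero =>
    rw [Nat.cast_zero, S.α_zero, zero_mul, smul_zero, add_zero, a.Xp_zero, b.Xp_zero, mul_one,
      mul_one]
  | succ k ih =>
    rw [Nat.cast_succ, S.η_succ, ih _ (by omega), S.α_of_lt (by omega), S.β_of_le (by omega),
      zero_mul, zero_mul, smul_zero, add_zero, add_zero, mul_assoc x, add_comm (k : ℤ),
      a.Xp_add, a.Xp_one]

variable {S} {A₀ : Type*} [Ring A₀] [Algebra R A₀] {a₀ : HCAlg e P n A₀} {S' : HCStep r a₀ a}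

/-- The Mackey formula: `π (T x T)` is the projection of `x` to the rank before. -/
theorem π_T_ι_T (hs : S'.Spans) (hr : 0 < r) (x : A) :
    S.π (b.T n * S.ι x * b.T n) = S'.ι (S'.π x) := by
  refine hs.induction hr (p := fun x => S.π (b.T n * S.ι x * b.T n) = S'.ι (S'.π x))
    (fun x y hx hy => ?_) (fun i hi x y => ?_) (fun k hk x => ?_) (fun k hk x => ?_) x
  · rw [map_add, mul_add, add_mul, map_add, map_add, map_add, hx, hy]
  · have hb : b.T n * S.ι (a.T i) * b.T n = S.ι (a.T i) * b.T n * S.ι (a.T i) := by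
      subst hi
      rw [S.ι_T i (by omega), b.T_braid i (by omega)]
    have h3 : b.T n * S.ι (S'.ι x * a.T i * S'.ι y) * b.T n =
        S.ι (S'.ι x * a.T i) * b.T n * S.ι (a.T i * S'.ι y) := by
      calc _ = b.T n * S.ι (S'.ι x) * S.ι (a.T i) * (S.ι (S'.ι y) * b.T n) := by
            rw [map_mul, map_mul]; simp only [mul_assoc]
        _ = S.ι (S'.ι x) * (b.T n * S.ι (a.T i) * b.T n) * S.ι (S'.ι y) := by
            rw [← ι_ι_T, ι_ι_T]; simp only [mul_assoc]
        _ = _ := by rw [hb, map_mul, map_mul]; simp only [mul_assoc]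
    rw [h3, S.π_right, S.π_left, S.π_T n rfl, mul_zero, zero_mul, S'.π_right, S'.π_left,
      S'.π_T i hi, mul_zero, zero_mul, map_zero]
  · have h3 := S.η_range 1 hk.le
    rw [S.η_one, S.α_of_lt hk, smul_zero, add_zero, zero_mul, smul_zero, add_zero, one_mul,
      S.u_of_lt hk, a.Xp_natCast] at h3
    rw [map_mul S.ι, mul_assoc, mul_assoc, ← ι_ι_T, ← mul_assoc, ← mul_assoc, S.π_right, ← h3,
      S'.π_right, S'.π_X k hk]
    split_ifs
    · rw [one_mul, one_mul]
    · rw [zero_mul, zero_mul, map_zero]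
  · have h3 := S.η_range (a.C n) hk.le
    rw [S.η_C, S.α_of_lt hk, zero_mul, smul_zero, add_zero, add_zero, S.v_of_lt hk,
      a.Xp_natCast] at h3
    rw [map_mul S.ι, mul_assoc, mul_assoc, ← ι_ι_T, ← mul_assoc, ← mul_assoc, S.π_right, ← h3,
      S'.π_right, S'.π_CX k hk, zero_mul, zero_mul, map_zero]

/-- Regularity passes to the next rank. The symmetry of `u` cannot be proved by itself: the
recursions couple it with the values `π (T X ^ k)` and `π (T x T X ^ k)`, for which analogous
symmetries are proved along with it. -/
theorem Regular.succ {s' : R} (h : S'.Regular s') (hr : 0 < r) : S.Regular s' := by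
  have hs : S.Spans := h.spans.succ hr
  have L1 := fun x => π_T_ι_T (S := S) h.spans hr x
  have hcc : a.C n * a.C n = 1 := a.C_C
  have hcZ : a.C n * a.X n * (a.C n * a.X n) = 1 := by
    rw [a.C_X (Nat.lt_succ_self n), a.Y_sq n (Nat.lt_succ_self n)]
  have hvr : S.π (b.C (n + 1) * b.Xp r) = 0 := by
    have h1 := S.η_range (a.C n) le_rfl
    rw [S.η_C, L1, h.v, map_zero, zero_add] at h1
    exact add_eq_right.1 h1
  have hαm : a.X n * S.π (b.T n * b.Xp (-1)) = -(e • 1) := by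
    have h1 := S.α_succ (-1)
    rw [neg_add_cancel, S.α_zero, S.u_zero hr, S.v_zero hr, mul_zero, sub_zero] at h1
    exact eq_neg_of_add_eq_zero_left h1.symm
  have hβ0 : S.π (b.T n * b.C (n + 1)) = -(e • a.C n) := by
    have h1 := S.β_zero hr
    rwa [b.Xp_zero, mul_one] at h1
  have hvm : S.π (b.C (n + 1) * b.Xp (-1)) = 0 := by
    have h1 := S.η_succ (a.C n * a.Xp (-1)) (-1)
    have h2 : a.Xp (-1) * a.X n = 1 := by rw [← a.Xp_one, a.Xp_mul, neg_add_cancel, a.Xp_zero]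
    have h4 : S.π (b.T n * b.Xp (-1)) = -(e • a.Xp (-1)) := by
      rw [← one_mul (S.π _), ← h2, mul_assoc, hαm, mul_neg, mul_smul_comm, mul_one]
    have h3 : a.C n * (a.C n * a.Xp (-1) * a.C n) = a.Xp (-1) * a.C n := by
      rw [← mul_assoc, ← mul_assoc, hcc, one_mul]
    rw [neg_add_cancel, b.Xp_zero, mul_one (_ * b.T n), L1, h.v, map_zero, mul_assoc _ _ (a.X n),
      h2, mul_one,
      S.η_C, mul_one (b.T n), S.π_T n rfl, zero_mul, smul_zero, add_zero,
      mul_one (b.C _), hβ0, map_mul a.σ, a.σ_C n (Nat.lt_succ_self n), a.σ_Xp, neg_mul, neg_mul,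
      neg_mul,
      mul_neg, neg_neg, smul_mul_assoc, h3, h4, neg_mul, smul_mul_assoc, smul_neg,
      neg_add_cancel_right] at h1
    exact h1.symm
  have hv1 : S.π (b.C (n + 1) * b.Xp 1) = 0 := by
    obtain h1 | h1 := eq_or_lt_of_le (Nat.succ_le_of_lt hr)
    · rwa [show (r : ℤ) = 1 by omega] at hvr
    · exact_mod_cast S.v_of_lt h1
  have hN := π_X_comm hs hr hvm hvr fun i hi => by
    obtain rfl : i = n := by omega
    exact S.π_X_T hr hv1
  have hv := v_eq_zero hr hN hvm
  refine ⟨hs, hN, hv, ?_⟩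
  have hα : ∀ k : ℤ, S.π (b.T n * b.Xp (k + 1)) = a.X n * S.π (b.T n * b.Xp k) +
      e • S.π (b.Xp (k + 1)) := fun k => by rw [S.α_succ, hv, mul_zero, sub_zero]
  have hη : ∀ j k : ℤ, S.π (b.T n * S.ι (a.Xp j) * b.T n * b.Xp (k + 1)) =
      S.π (b.T n * S.ι (a.Xp (j + 1)) * b.T n * b.Xp k) +
      e • (S.π (b.T n * b.Xp (k + 1)) * a.Xp j) +
      e • (a.C n * a.X n * S.π (b.T n * b.Xp k) * (a.Xp j * a.C n)) := fun j k => by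
    rw [S.η_succ, a.σ_Xp, S.β_succ, a.Xp_add, a.Xp_one]
  have hur : S.π (b.Xp r) = s' • 1 := by
    have h1 := S.η_range 1 le_rfl
    rw [S.η_one, L1, one_mul, mul_one] at h1
    have h2 := h.u 0
    rw [Nat.cast_zero, add_zero, neg_zero, S'.u_zero hr] at h2
    rw [add_right_cancel h1, h2, map_smul, map_one]
  -- The symmetry for `T`, which has to be carried along.
  have key : ∀ k : ℕ, S.π (b.T n * b.Xp (r + k)) =
      -(s' • (S.π (b.T n * (b.C (n + 1) * b.Xp (-k))) * a.C n)) ∧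
      ∀ j : ℕ, S.π (b.T n * S.ι (a.Xp j) * b.T n * b.Xp (r + k)) -
          e • (S.π (b.T n * b.Xp (r + k)) * a.Xp j) =
        s' • (S.π (b.T n * S.ι (a.Xp (-j)) * b.T n * b.Xp (-k)) -
          e • (S.π (b.T n * b.Xp (-k)) * a.Xp (-j))) := by
    intro k
    induction k with
    | zero =>
      refine ⟨?_, fun j => ?_⟩
      · rw [Nat.cast_zero, add_zero, neg_zero, S.β_zero hr, neg_mul, smul_neg, neg_neg,
          smul_mul_assoc, hcc]
        have h1 := hα (r - 1)
        rw [sub_add_cancel] at h1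
        have h2 := S.α_of_lt (k := r - 1) (by omega)
        rw [Nat.cast_sub hr, Nat.cast_one] at h2
        rw [h1, h2, mul_zero, zero_add, hur, smul_comm]
      · have h1 := S.η_range (a.Xp j) (k := r) le_rfl
        rw [Nat.cast_zero, add_zero, neg_zero, h1, add_sub_cancel_right, L1, S.α_zero, zero_mul,
          smul_zero, sub_zero, b.Xp_zero, mul_one, L1, a.Xp_mul, add_comm, h.u, map_smul]
    | succ k ih =>
      obtain ⟨ih1, ih2⟩ := ih
      have hj : ∀ j : ℕ, S.π (b.T n * S.ι (a.Xp j) * b.T n * b.Xp (r + (k + 1 : ℕ))) -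
          e • (S.π (b.T n * b.Xp (r + (k + 1 : ℕ))) * a.Xp j) =
        s' • (S.π (b.T n * S.ι (a.Xp (-j)) * b.T n * b.Xp (-(k + 1 : ℕ))) -
          e • (S.π (b.T n * b.Xp (-(k + 1 : ℕ))) * a.Xp (-j))) := fun j => by
        have h1 := hη j (r + k)
        have h2 := hη (-(j + 1)) (-(k + 1))
        have h3 := ih2 (j + 1)
        have h4 := S.β_succ (-(k + 1))
        rw [show (-((k : ℤ) + 1) + 1) = -k by ring] at h2 h4
        rw [show (-((j : ℤ) + 1) + 1) = -j by ring] at h2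
        rw [show ((r : ℤ) + (k : ℕ) + 1) = r + (k + 1 : ℕ) by push_cast; ring] at h1
        rw [h1]
        rw [Nat.cast_succ] at h3
        rw [eq_add_of_sub_eq h3, h2]
        have h5 : S.π (b.T n * b.Xp (r + k)) * a.Xp (j + 1) +
            a.C n * a.X n * S.π (b.T n * b.Xp (r + k)) * (a.Xp j * a.C n) =
            -(s' • (a.C n * a.X n * S.π (b.T n * b.Xp (-(k + 1))) *
              (a.Xp (-(j + 1)) * a.C n) + S.π (b.T n * b.Xp (-(k + 1))) * a.Xp (-j))) := by
          rw [ih1, h4]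
          have h6 : a.C n * a.Xp (j + 1) = a.Xp (-(j + 1)) * a.C n := a.C_Xp _
          have h7 : a.C n * (a.Xp j * a.C n) = a.Xp (-j) := by
            rw [a.Xp_C, ← mul_assoc, hcc, one_mul]
          rw [neg_mul, mul_neg, neg_mul, smul_mul_assoc, mul_smul_comm, smul_mul_assoc,
            mul_assoc _ _ (a.Xp (j + 1)), h6,
            ← mul_assoc (a.C n * a.X n) (_ * _) (a.C n), ← mul_assoc (a.C n * a.X n) (a.C n *
                a.X n),
            hcZ, one_mul, mul_assoc _ (a.C n) (_ * _), h7, smul_add]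
          exact (neg_add _ _).symm
        rw [Nat.cast_succ]
        linear_combination (norm := module) e • h5
      refine ⟨?_, hj⟩
      have hu : S.π (b.Xp (r + (k + 1 : ℕ))) = s' • S.π (b.Xp (-(k + 1 : ℕ))) := by
        have h1 := hj 0
        rwa [Nat.cast_zero, neg_zero, a.Xp_zero, S.η_one, S.η_one, mul_one, mul_one,
          add_sub_cancel_right, add_sub_cancel_right] at h1
      have h1 := hα (r + k)
      have h2 := hα (-(k + 1) - 1)
      have h3 := S.β_succ (-(k + 1))
      have h4 := S.β_succ (-(k + 1) - 1)
      rw [sub_add_cancel] at h2 h4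
      rw [show (-((k : ℤ) + 1) + 1) = -k by ring] at h3
      rw [show ((r : ℤ) + (k : ℕ) + 1) = r + (k + 1 : ℕ) by push_cast; ring, hu, ih1, h3] at h1
      rw [h1, Nat.cast_succ, h4, mul_assoc (a.C n) (a.X n) (S.π (b.T n * b.Xp (-(k + 1) - 1))),
        ← sub_eq_of_eq_add h2]
      have h5 : a.X n * (a.C n * a.X n) = a.C n := by
        calc _ = a.C n * (a.C n * a.X n * (a.C n * a.X n)) := by
              simp only [← mul_assoc, hcc, one_mul]
          _ = _ := by rw [hcZ, mul_one]
      rw [mul_neg, mul_smul_comm, ← mul_assoc (a.X n), ← mul_assoc (a.X n), h5, mul_sub, sub_mul,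
        mul_smul_comm, smul_mul_assoc, mul_assoc, mul_assoc (a.C n) (S.π _), S.u_central,
        ← mul_assoc (a.C n) (a.C n), hcc, one_mul, smul_sub, neg_sub, smul_comm s' e,
        sub_eq_add_neg,
        add_comm]
  intro k
  have h1 := (key k).2 0
  rw [Nat.cast_zero, neg_zero, a.Xp_zero, S.η_one, S.η_one, mul_one, mul_one, add_sub_cancel_right,
    add_sub_cancel_right] at h1
  exact h1

end HCStep

/-! ### Conjugation by `C` and dual words -/

namespace HCStep

section General

variable {R : Type*} [CommRing R] {e : R} {P : R[X]} {n r : ℕ} {A B : Type*} [Ring A]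
  [Algebra R A] [Ring B] [Algebra R B] {a : HCAlg e P n A} {b : HCAlg e P (n + 1) B}
  (S : HCStep r a b) {s' : R}

/-- A regular projection for which moreover the conjugation by the last `C` is governed by the
sign `s'`, up to the factor `X ^ r`. -/
structure Frobenius (s' : R) : Prop extends S.Regular s' where
  T_X : ∀ i, i + 1 = n → ∀ k : ℕ, k < r → S.π (b.T i * b.Xp k) = 0
  C_C : ∀ x, S.π (b.C n * x * b.C n) = s' • a.σ (S.π (b.Xp r * x))

variable {S}

/-- The rule for the conjugation by `C` has to be checked only on `T`: on the words `X ^ k` and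
`C X ^ k` it is the symmetry of `u` and the vanishing of `v`. -/
theorem Regular.frobenius (h : S.Regular s') (hr : 0 < r) (hs' : s' * s' = 1)
    (hX : ∀ i, i + 1 = n → ∀ k : ℕ, k < r → S.π (b.T i * b.Xp k) = 0)
    (hC : ∀ i, i + 1 = n → S.π (b.C n * b.T i * b.C n) = s' • a.σ (S.π (b.Xp r * b.T i))) :
    S.Frobenius s' := by
  have hv' : ∀ k : ℤ, S.π (b.Xp k * b.C n) = 0 := fun k => by rw [b.Xp_C, h.v]
  refine ⟨h, hX, fun x => ?_⟩
  refine h.spans.induction hr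
    (p := fun x => S.π (b.C n * x * b.C n) = s' • a.σ (S.π (b.Xp r * x)))
    (fun x y hx hy => ?_) (fun i hi x y => ?_) (fun k hk x => ?_) (fun k hk x => ?_) x
  · rw [mul_add, add_mul, map_add, hx, hy, mul_add, map_add, map_add, smul_add]
  · have h1 : b.C n * (S.ι x * b.T i * S.ι y) * b.C n =
        S.ι (a.σ x) * (b.C n * b.T i * b.C n) * S.ι (a.σ y) := by
      rw [← mul_assoc, ← mul_assoc, S.C_ι x, mul_assoc _ (S.ι y), S.ι_mul_C y]
      simp only [mul_assoc]
    have h2 : b.Xp r * (S.ι x * b.T i * S.ι y) = S.ι x * (b.Xp r * b.T i) * S.ι y := by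
      rw [← mul_assoc, ← mul_assoc, S.Xp_ι]
      simp only [mul_assoc]
    rw [h1, h2, S.π_right, S.π_left, S.π_right, S.π_left, hC i hi, map_mul a.σ, map_mul a.σ,
      mul_smul_comm, smul_mul_assoc]
  · rw [← b.Xp_natCast, mul_assoc, mul_assoc, S.ι_mul_C, ← mul_assoc (b.Xp _), b.Xp_C, ← mul_assoc,
      ← mul_assoc, b.C_C, one_mul, ← mul_assoc, b.Xp_mul, S.π_right, S.π_right, h.u, map_mul,
      map_smul, ← π_σ h.spans hr, b.σ_Xp, smul_mul_assoc, smul_smul, hs', one_smul]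
  · rw [← b.Xp_natCast, mul_assoc, mul_assoc, mul_assoc _ (b.Xp _), ← mul_assoc (b.C n), b.C_C,
      one_mul, mul_assoc, S.ι_mul_C, ← mul_assoc, ← mul_assoc (b.Xp _), ← mul_assoc (_ * b.C n),
      S.π_right, S.π_right, hv', b.Xp_C, mul_assoc, b.Xp_mul, h.v, zero_mul, zero_mul, map_zero,
      smul_zero]

variable (S)

/-- The additive group generated by the `ι x * X ^ k` with `0 ≤ k < r`. -/
def low : AddSubgroup B := AddSubgroup.closure {z | ∃ k : ℕ, k < r ∧ ∃ x, z = S.ι x * b.Xp k}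

variable {S}

theorem ι_mul_Xp_mem_low (x : A) {k : ℕ} (hk : k < r) : S.ι x * b.Xp k ∈ S.low :=
  AddSubgroup.subset_closure ⟨k, hk, x, rfl⟩

theorem Xp_mem_low {k : ℕ} (hk : k < r) : b.Xp k ∈ S.low := by
  have h := ι_mul_Xp_mem_low (S := S) 1 hk
  rwa [map_one, one_mul] at h

theorem low_induction {p : B → Prop} (h0 : p 0) (hadd : ∀ x y, p x → p y → p (x + y))
    (hneg : ∀ x, p x → p (-x)) (h : ∀ k : ℕ, k < r → ∀ x, p (S.ι x * b.Xp k)) {y : B}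
    (hy : y ∈ S.low) : p y := by
  refine AddSubgroup.closure_induction (p := fun x _ => p x) ?_ h0 (fun x y _ _ => hadd x y)
    (fun x _ => hneg x) hy
  rintro _ ⟨k, hk, x, rfl⟩
  exact h k hk x

theorem ι_mul_mem_low (x : A) {y : B} (hy : y ∈ S.low) : S.ι x * y ∈ S.low := by
  refine low_induction (p := fun y => S.ι x * y ∈ S.low) ?_ (fun y z hy hz => ?_) (fun y hy => ?_)
    (fun k hk z => ?_) hy
  · rw [mul_zero]; exact zero_mem _
  · rw [mul_add]; exact add_mem hy hz
  · rw [mul_neg]; exact neg_mem hy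
  · rw [← mul_assoc, ← map_mul]; exact ι_mul_Xp_mem_low _ hk

theorem π_low_mul {z : B} (hz : ∀ k : ℕ, k < r → S.π (b.Xp k * z) = 0) {y : B} (hy : y ∈ S.low) :
    S.π (y * z) = 0 := by
  refine low_induction (p := fun y => S.π (y * z) = 0) ?_ (fun y z hy hz => ?_) (fun y hy => ?_)
    (fun k hk x => ?_) hy
  · rw [zero_mul, map_zero]
  · rw [add_mul, map_add, hy, hz, add_zero]
  · rw [neg_mul, map_neg, hy, neg_zero]
  · rw [mul_assoc, S.π_left, hz k hk, mul_zero]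

theorem Frobenius.X_T (h : S.Frobenius s') {i : ℕ} (hi : i + 1 = n) {k : ℕ} (hk : k < r) :
    S.π (b.Xp k * b.T i) = 0 := by
  rw [comm_Xp h.comm, h.T_X i hi k hk]

theorem Frobenius.π_low_T (h : S.Frobenius s') {i : ℕ} (hi : i + 1 = n) (x z : A) {y : B}
    (hy : y ∈ S.low) : S.π (y * (S.ι x * b.T i * S.ι z)) = 0 := by
  refine π_low_mul (fun k hk => ?_) hy
  rw [← mul_assoc, ← mul_assoc, S.Xp_ι, S.π_right, mul_assoc, S.π_left, h.X_T hi hk, mul_zero,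
    zero_mul]

theorem Frobenius.π_low_C_T (h : S.Frobenius s') {i : ℕ} (hi : i + 1 = n) (x z : A) {y : B}
    (hy : y ∈ S.low) : S.π (y * b.C n * (S.ι x * b.T i * S.ι z)) = 0 := by
  rw [mul_assoc]
  refine π_low_mul (fun k hk => ?_) hy
  have h1 : b.C n * b.T i = b.T i * S.ι (a.C i) := by
    subst hi
    rw [S.ι_C i (Nat.lt_succ_self i), b.toHCSystem.T_C i (Nat.lt_succ_self _)]
  have h2 : b.Xp k * (b.C n * (S.ι x * b.T i * S.ι z)) =
      S.ι (a.σ x) * (b.Xp k * b.T i) * S.ι (a.C i * z) := by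
    rw [← mul_assoc (b.C n), ← mul_assoc (b.C n), S.C_ι, mul_assoc _ (b.C n), h1, ← mul_assoc,
      ← mul_assoc, S.Xp_ι, map_mul]
    simp only [mul_assoc]
  rw [h2, S.π_right, S.π_left, h.X_T hi hk, mul_zero, zero_mul]

theorem Regular.π_low_C_Xp (h : S.Regular s') (k : ℤ) {y : B} (hy : y ∈ S.low) :
    S.π (y * b.C n * b.Xp k) = 0 := by
  rw [mul_assoc]
  refine π_low_mul (fun j hj => ?_) hy
  rw [← mul_assoc, b.Xp_C, mul_assoc, b.Xp_mul, h.v]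

theorem Regular.π_low_Xp_C (h : S.Regular s') (k : ℤ) {y : B} (hy : y ∈ S.low) :
    S.π (y * (b.Xp k * b.C n)) = 0 := by
  rw [b.Xp_C, ← mul_assoc, h.π_low_C_Xp _ hy]

/-- A triangular family of functionals can be turned into a dual one. -/
theorem exists_dual_of_triangular {z w : ℕ → B} (hz : ∀ j < r, z j ∈ S.low)
    (h0 : ∀ j < r, ∀ k < j, S.π (z j * w k) = 0) (h1 : ∀ j < r, S.π (z j * w j) = 1) (j : ℕ)
    (hj : j < r) : ∃ y ∈ S.low, ∀ k < r, S.π (y * w k) = if j = k then 1 else 0 := by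
  obtain ⟨d, hd⟩ : ∃ d, r - j ≤ d := ⟨_, le_rfl⟩
  induction d generalizing j with
  | zero => omega
  | succ d ih =>
    have ih' : ∀ k : ℕ, ∃ y ∈ S.low, j < k → k < r →
        ∀ l < r, S.π (y * w l) = if k = l then 1 else 0 := fun k => by
      by_cases hk : j < k ∧ k < r
      · obtain ⟨y, hy, hy'⟩ := ih k hk.2 (by omega)
        exact ⟨y, hy, fun _ _ => hy'⟩
      · exact ⟨0, zero_mem _, fun h h' => absurd ⟨h, h'⟩ hk⟩
    choose y hy hy' using ih'
    refine ⟨z j - ∑ k ∈ Finset.Ioo j r, S.ι (S.π (z j * w k)) * y k,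
      sub_mem (hz j hj) (sum_mem fun k _ => ι_mul_mem_low _ (hy k)), fun l hl => ?_⟩
    have h3 : ∀ k ∈ Finset.Ioo j r, S.π (S.ι (S.π (z j * w k)) * y k * w l) =
        if k = l then S.π (z j * w k) else 0 := fun k hk => by
      obtain ⟨hk, hk'⟩ := Finset.mem_Ioo.1 hk
      rw [mul_assoc, S.π_left, hy' k hk hk' l hl, mul_ite, mul_one, mul_zero]
    rw [sub_mul, Finset.sum_mul, map_sub, map_sum, Finset.sum_congr rfl h3, Finset.sum_ite_eq']
    rcases lt_trichotomy j l with h | rfl | h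
    · rw [if_pos (Finset.mem_Ioo.2 ⟨h, hl⟩), sub_self, if_neg h.ne]
    · rw [if_neg (by simp), h1 _ hj, sub_zero, if_pos rfl]
    · rw [if_neg (by rw [Finset.mem_Ioo]; omega), h0 j hj l h, sub_zero, if_neg h.ne']

/-- The functionals dual to `X ^ k`. The `X ^ (r - j)`, with `1` for `j = 0`, are a triangular
family, as `π (X ^ r) = s'`; the element for `j = 0` can be taken to be `1`. -/
theorem Regular.exists_dual_pos (h : S.Regular s') (hs' : s' * s' = 1) :
    ∃ y : ℕ → B, y 0 = 1 ∧ ∀ j < r, y j ∈ S.low ∧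
      ∀ k : ℕ, k < r → S.π (y j * b.Xp k) = if j = k then 1 else 0 := by
  have key : ∀ j < r, ∃ y ∈ S.low, ∀ k < r, S.π (y * b.Xp (k : ℕ)) = if j = k then 1 else 0 := by
    refine exists_dual_of_triangular
      (z := fun j => if j = 0 then 1 else S.ι (s' • 1) * b.Xp (r - j : ℕ)) (fun j hj => ?_)
      (fun j hj k hk => ?_) (fun j hj => ?_)
    · split_ifs with h0
      · rw [← b.Xp_zero]
        exact Xp_mem_low (S := S) (k := 0) (by omega)
      · exact ι_mul_Xp_mem_low _ (by omega)
    · rw [if_neg (by omega), mul_assoc, b.Xp_mul, S.π_left, ← Nat.cast_add, S.u_of_lt (by omega),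
        if_neg (by omega), mul_zero]
    · split_ifs with h0
      · rw [h0, one_mul, S.u_of_lt (by omega), if_pos rfl]
      · rw [mul_assoc, b.Xp_mul, S.π_left, ← Nat.cast_add, Nat.sub_add_cancel hj.le]
        have h2 := h.u 0
        rw [Nat.cast_zero, add_zero, neg_zero, S.u_zero (by omega)] at h2
        rw [h2, smul_mul_smul_comm, hs', one_smul, mul_one]
  choose! y hy hy' using key
  refine ⟨fun j => if j = 0 then 1 else y j, if_pos rfl, fun j hj => ?_⟩
  dsimp only
  split_ifs with h0
  · refine ⟨?_, fun k hk => ?_⟩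
    · rw [← b.Xp_zero]
      exact Xp_mem_low (S := S) (k := 0) (by omega)
    · rw [one_mul, S.u_of_lt hk, h0]
      simp only [eq_comm]
  · exact ⟨hy j hj, hy' j hj⟩

/-- The functionals dual to the negative powers `X ^ (-k)`, for which the `X ^ j` are triangular. -/
theorem exists_dual_neg :
    ∃ y : ℕ → B, ∀ j < r, y j ∈ S.low ∧
      ∀ k : ℕ, k < r → S.π (y j * b.Xp (-k)) = if j = k then 1 else 0 := by
  have key : ∀ j < r, ∃ y ∈ S.low, ∀ k < r,
      S.π (y * (fun k : ℕ => b.Xp (-k)) k) = if j = k then 1 else 0 := by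
    refine exists_dual_of_triangular (z := fun j => b.Xp j) (fun j hj => Xp_mem_low hj)
      (fun j hj k hk => ?_) (fun j hj => ?_)
    · rw [b.Xp_mul, ← sub_eq_add_neg, ← Nat.cast_sub hk.le, S.u_of_lt (by omega),
        if_neg (by omega)]
    · rw [b.Xp_mul, add_neg_cancel, S.u_zero (by omega)]
  choose! y hy hy' using key
  exact ⟨y, fun j hj => ⟨hy j hj, hy' j hj⟩⟩

variable (S)

/-- The span of the words `x T y`. -/
def wordsT : Submodule R B :=
  Submodule.span R {z | ∃ (i : ℕ) (_ : i + 1 = n) (x y : A), z = S.ι x * b.T i * S.ι y}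

/-- Elements `g k c` such that the functionals `π (g k c * ·)` are dual to the words `X ^ k C ^ c`
and kill the words `x T y`. -/
structure DualWords (g : Fin r → Fin 2 → B) : Prop where
  word : ∀ k c (j : Fin r) (d : Fin 2), S.π (g k c * (b.X n ^ (j : ℕ) * b.C n ^ (d : ℕ))) =
    if k = j ∧ c = d then 1 else 0
  T : ∀ k c, ∀ z ∈ S.wordsT, S.π (g k c * z) = 0
  zero : ∀ hr : 0 < r, g ⟨0, hr⟩ 0 = 1

variable {S}

theorem wordsT_induction {p : B → Prop} (hadd : ∀ x y, p x → p y → p (x + y)) (h0 : p 0)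
    (h : ∀ i, i + 1 = n → ∀ x y, p (S.ι x * b.T i * S.ι y)) {z : B} (hz : z ∈ S.wordsT) : p z := by
  refine Submodule.span_induction (p := fun z _ => (∀ c : R, p (c • z))) ?_ ?_ ?_ ?_ hz |>
    fun h => by simpa using h 1
  · rintro _ ⟨i, hi, x, y, rfl⟩ c
    rw [← smul_mul_assoc, ← smul_mul_assoc, ← map_smul]
    exact h i hi _ _
  · intro c; rwa [smul_zero]
  · intro x y _ _ hx hy c
    rw [smul_add]
    exact hadd _ _ (hx c) (hy c)
  · intro d x _ hx c
    rw [smul_smul]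
    exact hx _

theorem wordsT_mul_ι {z : B} (hz : z ∈ S.wordsT) (x : A) : z * S.ι x ∈ S.wordsT := by
  refine wordsT_induction (p := fun z => z * S.ι x ∈ S.wordsT) (fun y z hy hz => ?_) ?_
    (fun i hi y z => ?_) hz
  · rw [add_mul]; exact add_mem hy hz
  · rw [zero_mul]; exact zero_mem _
  · rw [mul_assoc, ← map_mul]
    exact Submodule.subset_span ⟨i, hi, _, _, rfl⟩

theorem Frobenius.exists_dualWords (h : S.Frobenius s') (hs' : s' * s' = 1) :
    ∃ g, S.DualWords g := by
  obtain ⟨y, hy0, hy⟩ := h.exists_dual_pos hs'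
  obtain ⟨y', hy'⟩ := S.exists_dual_neg
  refine ⟨fun k c => if c = 0 then y k else y' k * b.C n, fun k c j d => ?_, fun k c z hz => ?_,
    fun hr => ?_⟩
  · rw [← b.Xp_natCast]
    have hk := k.isLt
    have hj := j.isLt
    fin_cases c <;> fin_cases d
    · have h1 := (hy k hk).2 j hj
      simpa [Fin.ext_iff] using h1
    · have h1 := h.π_low_Xp_C j (hy k hk).1
      simpa using h1
    · have h1 := h.π_low_C_Xp j (hy' k hk).1
      simpa using h1
    · have h1 := (hy' k hk).2 j hj
      rw [← mul_one (b.Xp _), ← b.C_C, ← mul_assoc (b.Xp _), b.Xp_C, neg_neg] at h1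
      simpa [Fin.ext_iff, mul_assoc] using h1
  · refine wordsT_induction (p := fun z => S.π (_ * z) = 0) (fun x y hx hy => ?_) ?_
      (fun i hi x z => ?_) hz
    · rw [mul_add, map_add, hx, hy, add_zero]
    · rw [mul_zero, map_zero]
    · split_ifs
      · exact h.π_low_T hi x z (hy k k.isLt).1
      · exact h.π_low_C_T hi x z (hy' k k.isLt).1
  · rw [if_pos rfl]; exact hy0

end General

end HCStep

/-! ### Mackey decompositions and dual bases -/

namespace HCStep

section Expansion

variable {R : Type*} [CommRing R] {e : R} {P : R[X]} {n r : ℕ} {A B : Type*} [Ring A]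
  [Algebra R A] [Ring B] [Algebra R B] {a : HCAlg e P n A} {b : HCAlg e P (n + 1) B}
  {S : HCStep r a b} {s' : R}

theorem Spans.exists_eq_sum (h : S.Spans) (hr : 0 < r) (x : B) : ∃ t ∈ S.wordsT, ∃ p p' : ℕ → A,
    x = t + ∑ k ∈ Finset.range r, b.Xp k * S.ι (p k) +
      ∑ k ∈ Finset.range r, b.C n * b.Xp k * S.ι (p' k) := by
  refine h.induction hr (p := fun x => ∃ t ∈ S.wordsT, ∃ p p' : ℕ → A,
    x = t + ∑ k ∈ Finset.range r, b.Xp k * S.ι (p k) +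
      ∑ k ∈ Finset.range r, b.C n * b.Xp k * S.ι (p' k)) ?_ (fun i hi y z => ?_) (fun k hk y => ?_)
      (fun k hk y => ?_) x
  · rintro x y ⟨t, ht, p, p', hx⟩ ⟨u, hu, q, q', hy⟩
    refine ⟨t + u, add_mem ht hu, p + q, p' + q', ?_⟩
    simp only [Pi.add_apply, map_add, mul_add, Finset.sum_add_distrib]
    rw [hx, hy]
    abel
  · refine ⟨_, Submodule.subset_span ⟨i, hi, y, z, rfl⟩, 0, 0, ?_⟩
    simp
  · refine ⟨0, zero_mem _, Pi.single k y, 0, ?_⟩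
    rw [Finset.sum_eq_single_of_mem k (Finset.mem_range.2 hk), Finset.sum_eq_zero,
      Pi.single_eq_same,
      b.Xp_natCast, zero_add, add_zero]
    · intro j _
      rw [Pi.zero_apply, map_zero, mul_zero]
    · intro j _ hj
      rw [Pi.single_eq_of_ne hj, map_zero, mul_zero]
  · refine ⟨0, zero_mem _, 0, Pi.single k y, ?_⟩
    rw [Finset.sum_eq_zero, Finset.sum_eq_single_of_mem k (Finset.mem_range.2 hk),
      Pi.single_eq_same, b.Xp_natCast, zero_add, zero_add]
    · intro j _ hj
      rw [Pi.single_eq_of_ne hj, map_zero, mul_zero]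
    · intro j _
      rw [Pi.zero_apply, map_zero, mul_zero]

/-- The powers of `X`, the negative ones included, are expressible without `C`. -/
theorem Frobenius.Xp_eq_sum (h : S.Frobenius s') (hr : 0 < r) (hs' : s' * s' = 1) (k : ℤ) :
    ∃ t ∈ S.wordsT, ∃ p : ℕ → A, b.Xp k = t + ∑ k ∈ Finset.range r, b.Xp k * S.ι (p k) := by
  obtain ⟨t, ht, p, p', hx⟩ := h.spans.exists_eq_sum hr (b.Xp k)
  refine ⟨t, ht, p, ?_⟩
  rw [hx, add_eq_left]
  obtain ⟨y, -, hy⟩ := h.exists_dual_pos hs'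
  refine Finset.sum_eq_zero fun j hj => ?_
  have hj' := Finset.mem_range.1 hj
  obtain ⟨hl, hd⟩ := hy j hj'
  have h1 := h.π_low_C_Xp k hl
  have h2 : S.π (y j * b.C n * t) = 0 := by
    refine wordsT_induction (p := fun z => S.π (y j * b.C n * z) = 0) (fun x y hx hy => ?_) ?_
      (fun i hi x z => h.π_low_C_T hi x z hl) ht
    · rw [mul_add, map_add, hx, hy, add_zero]
    · rw [mul_zero, map_zero]
  have h3 : ∀ i ∈ Finset.range r, S.π (y j * b.C n * (b.C n * b.Xp i * S.ι (p' i))) =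
      if j = i then p' i else 0 := fun i hi => by
    rw [mul_assoc, ← mul_assoc (b.C n), ← mul_assoc (b.C n), b.C_C, one_mul, ← mul_assoc,
      S.π_right, hd i (Finset.mem_range.1 hi), ite_mul, one_mul, zero_mul]
  rw [hx, mul_add, mul_add, map_add, map_add, h2, Finset.mul_sum, Finset.mul_sum, map_sum, map_sum,
    Finset.sum_congr rfl h3, Finset.sum_eq_zero, Finset.sum_ite_eq, if_pos hj, zero_add, zero_add]
    at h1
  · rw [h1, map_zero, mul_zero]
  · intro i _
    rw [← mul_assoc, S.π_right, h.π_low_C_Xp _ hl, zero_mul]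

/-- Multiplication by `C` from the right leads out of the words `x T y` only by words of degree `0`
in `X`. -/
theorem wordsT_mul_C {z : B} (hz : z ∈ S.wordsT) :
    ∃ t ∈ S.wordsT, ∃ x y, z * b.C n = t + S.ι x + b.C n * S.ι y := by
  refine wordsT_induction (p := fun z => ∃ t ∈ S.wordsT, ∃ x y,
    z * b.C n = t + S.ι x + b.C n * S.ι y) ?_ ?_ (fun i hi x z => ?_) hz
  · rintro x y ⟨t, ht, p, q, hx⟩ ⟨t', ht', p', q', hy⟩
    refine ⟨t + t', add_mem ht ht', p + p', q + q', ?_⟩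
    rw [add_mul, hx, hy, map_add, map_add, mul_add]
    abel
  · exact ⟨0, zero_mem _, 0, 0, by simp⟩
  · refine ⟨_, Submodule.subset_span ⟨i, hi, x * a.C i, a.σ z, rfl⟩, -(e • (x * a.C i * a.σ z)),
      e • (a.σ x * a.σ z), ?_⟩
    subst hi
    rw [mul_assoc, S.ι_mul_C, ← mul_assoc, mul_assoc _ (b.T i),
      b.T_C_succ (Nat.lt_succ_self _), ← S.ι_C i (Nat.lt_succ_self _), map_neg, map_smul, map_smul,
      map_mul S.ι (x * _), map_mul S.ι x, map_mul S.ι (a.σ x), mul_smul_comm, ← mul_assoc (b.C _),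
      S.C_ι, a.σ_σ, mul_sub, mul_smul_comm, mul_sub, sub_mul, smul_mul_assoc, sub_mul, ← mul_assoc,
      smul_sub]
    abel

/-- Existence of the Mackey decomposition, with explicit coefficients. -/
theorem DualWords.expand {g : Fin r → Fin 2 → B} (hg : S.DualWords g) (h : S.Frobenius s')
    (hr : 0 < r) (hs' : s' * s' = 1) (x : B) :
    x - ∑ k : Fin r, ∑ c : Fin 2, b.X n ^ (k : ℕ) * b.C n ^ (c : ℕ) * S.ι (S.π (g k c *
        x)) ∈ S.wordsT := by
  set p : B → Prop := fun x =>
    x - ∑ k : Fin r, ∑ c : Fin 2, b.X n ^ (k : ℕ) * b.C n ^ (c : ℕ) * S.ι (S.π (g k c *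
        x)) ∈ S.wordsT with hp
  have hadd : ∀ x y, p x → p y → p (x + y) := fun x y hx hy => by
    have h1 := add_mem hx hy
    simp only [hp, mul_add, map_add, Finset.sum_add_distrib]
    rwa [add_sub_add_comm]
  have hT : ∀ x ∈ S.wordsT, p x := fun x hx => by
    simp only [hp]
    rwa [Finset.sum_eq_zero, sub_zero]
    intro k _
    refine Finset.sum_eq_zero fun c _ => ?_
    rw [hg.T k c x hx, map_zero, mul_zero]
  have hι : ∀ x y, p x → p (x * S.ι y) := fun x y hx => by
    have h1 := wordsT_mul_ι hx y
    rw [sub_mul, Finset.sum_mul] at h1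
    simp only [Finset.sum_mul] at h1
    simp only [hp, ← mul_assoc, S.π_right, map_mul S.ι] at h1 ⊢
    exact h1
  have hw : ∀ (k : Fin r) (c : Fin 2), p (b.X n ^ (k : ℕ) * b.C n ^ (c : ℕ)) := fun k c => by
    simp only [hp]
    rw [Finset.sum_eq_single_of_mem k (Finset.mem_univ k),
      Finset.sum_eq_single_of_mem c (Finset.mem_univ c), hg.word, if_pos ⟨rfl, rfl⟩, map_one,
      mul_one, sub_self]
    · exact zero_mem _
    · intro d _ hd
      rw [hg.word, if_neg (fun h => hd h.2), map_zero, mul_zero]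
    · intro j _ hj
      refine Finset.sum_eq_zero fun d _ => ?_
      rw [hg.word, if_neg (fun h => hj h.1), map_zero, mul_zero]
  have hX : ∀ k : ℕ, k < r → p (b.Xp k) := fun k hk => by
    have := hw ⟨k, hk⟩ 0
    rwa [Fin.val_zero, pow_zero, mul_one, ← b.Xp_natCast] at this
  have hXC : ∀ k : ℕ, k < r → p (b.Xp k * b.C n) := fun k hk => by
    have := hw ⟨k, hk⟩ 1
    rwa [Fin.val_one, pow_one, ← b.Xp_natCast] at this
  have h1 : p 1 := by
    have := hX 0 hr
    rwa [Nat.cast_zero, b.Xp_zero] at this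
  have hC : p (b.C n) := by
    have := hXC 0 hr
    rwa [Nat.cast_zero, b.Xp_zero, one_mul] at this
  have hsum : ∀ (s : Finset ℕ) (f : ℕ → B), (∀ i ∈ s, p (f i)) → p (∑ i ∈ s, f i) :=
    fun s f hf => Finset.sum_induction f p hadd (hT 0 (zero_mem _)) hf
  refine h.spans.induction hr (p := p) hadd
    (fun i hi y z => hT _ (Submodule.subset_span ⟨i, hi, y, z, rfl⟩)) (fun k hk y => ?_)
    (fun k hk y => ?_) x
  · rw [← b.Xp_natCast]
    exact hι _ _ (hX k hk)
  · refine hι _ _ ?_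
    obtain ⟨t, ht, q, hq⟩ := h.Xp_eq_sum hr hs' (-k)
    obtain ⟨u, hu, v, w, hv⟩ := wordsT_mul_C ht
    rw [← b.Xp_natCast, b.C_Xp, hq, add_mul, hv, Finset.sum_mul]
    refine hadd _ _ (hadd _ _ (hadd _ _ (hT u hu) ?_) (hι _ _ hC)) (hsum _ _ fun i hi => ?_)
    · rw [← one_mul (S.ι v)]
      exact hι _ _ h1
    · rw [mul_assoc, S.ι_mul_C, ← mul_assoc]
      exact hι _ _ (hXC i (Finset.mem_range.1 hi))

/-- Uniqueness of the Mackey decomposition. -/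
theorem DualWords.unique {g : Fin r → Fin 2 → B} (hg : S.DualWords g) {x : B}
    {p : Fin r → Fin 2 → A}
    (hp : x - ∑ k : Fin r, ∑ c : Fin 2, b.X n ^ (k : ℕ) * b.C n ^ (c : ℕ) * S.ι (p k c) ∈ S.wordsT)
    (k : Fin r) (c : Fin 2) : p k c = S.π (g k c * x) := by
  have h := hg.T k c _ hp
  rw [mul_sub, map_sub, sub_eq_zero] at h
  rw [h, Finset.mul_sum, map_sum, Finset.sum_eq_single_of_mem k (Finset.mem_univ k), Finset.mul_sum,
    map_sum, Finset.sum_eq_single_of_mem c (Finset.mem_univ c), ← mul_assoc, S.π_right, hg.word,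
    if_pos ⟨rfl, rfl⟩, one_mul]
  · intro d _ hd
    rw [← mul_assoc, S.π_right, hg.word, if_neg (fun h => hd h.2.symm), zero_mul]
  · intro j _ hj
    rw [Finset.mul_sum, map_sum]
    refine Finset.sum_eq_zero fun d _ => ?_
    rw [← mul_assoc, S.π_right, hg.word, if_neg (fun h => hj h.1.symm), zero_mul]

variable (S)

/-- A finite dual basis of the right module over the lower rank, with functionals of the form
`π (f * ·)`. -/
def HasDualBasis : Prop := ∃ (I : Type) (_ : Fintype I) (E F : I → B),
  ∀ x, ∑ i, E i * S.ι (S.π (F i * x)) = x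

end Expansion

section Base

variable {R : Type*} [CommRing R] {e : R} {P : R[X]} {r : ℕ} {A B : Type*} [Ring A]
  [Algebra R A] [Ring B] [Algebra R B] {a : HCAlg e P 0 A} {b : HCAlg e P 1 B}
  {S : HCStep r a b} {s' : R}

theorem Regular.frobenius_base (h : S.Regular s') (hr : 0 < r) (hs' : s' * s' = 1) :
    S.Frobenius s' :=
  h.frobenius hr hs' (fun i hi => by omega) (fun i hi => by omega)

theorem Frobenius.hasDualBasis_base (h : S.Frobenius s') (hr : 0 < r) (hs' : s' * s' = 1) :
    S.HasDualBasis := by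
  obtain ⟨g, hg⟩ := h.exists_dualWords hs'
  refine ⟨Fin r × Fin 2, inferInstance, fun w => b.X 0 ^ (w.1 : ℕ) * b.C 0 ^ (w.2 : ℕ),
    fun w => g w.1 w.2, fun x => ?_⟩
  have h1 := hg.expand h hr hs' x
  have h2 : ∀ z ∈ S.wordsT, z = 0 := fun z hz => by
    refine wordsT_induction (p := fun z => z = 0) (fun x y hx hy => ?_) ?_ (fun i hi => by omega) hz
    · rw [hx, hy, add_zero]
    · rfl
  rw [Fintype.sum_prod_type]
  exact (sub_eq_zero.1 (h2 _ h1)).symm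

end Base

section Pair

variable {R : Type*} [CommRing R] {e : R} {P : R[X]} {n r : ℕ} {A₀ A B : Type*} [Ring A₀]
  [Algebra R A₀] [Ring A] [Algebra R A] [Ring B] [Algebra R B] {a₀ : HCAlg e P n A₀}
  {a : HCAlg e P (n + 1) A} {b : HCAlg e P (n + 2) B} {S' : HCStep r a₀ a} {S : HCStep r a b}
  {s' : R}

theorem Regular.α_level (h : S.Regular s') (hr : 0 < r) :
    S.π (b.T n * b.Xp r) = (e * s') • 1 := by
  have h1 := S.α_succ (r - 1)
  have h2 := S.α_of_lt (k := r - 1) (by omega)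
  have h3 := h.u 0
  rw [Nat.cast_zero, add_zero, neg_zero, S.u_zero hr] at h3
  rw [Nat.cast_sub hr, Nat.cast_one] at h2
  rw [sub_add_cancel, h2, mul_zero, zero_add, h.v, mul_zero, sub_zero, h3, smul_smul] at h1
  exact h1

theorem Frobenius.succ (h : S'.Frobenius s') (hr : 0 < r) (hs' : s' * s' = 1) :
    S.Frobenius s' := by
  have hreg : S.Regular s' := h.toRegular.succ hr
  refine hreg.frobenius hr hs' (fun i hi k hk => ?_) (fun i hi => ?_)
  · obtain rfl : i = n := by omega
    exact S.α_of_lt hk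
  · obtain rfl : i = n := by omega
    have h1 := S.β_zero hr
    rw [b.Xp_zero, mul_one] at h1
    rw [comm_Xp hreg.comm, hreg.α_level hr, S.C_T, mul_assoc, S.ι_mul_C,
      a.σ_C i (Nat.lt_succ_self i), map_neg, mul_neg, mul_neg, ← mul_assoc, map_neg, S.π_right, h1,
      neg_mul, neg_neg, smul_mul_assoc, a.C_C, map_smul, map_one, smul_smul, mul_left_comm, hs',
      mul_one]

/-- By the Mackey formula a dual basis over the rank before gives a dual basis for the words `x T
y`, which the dual words complete. -/
theorem HasDualBasis.succ (hd : S'.HasDualBasis) (h : S'.Frobenius s') (hr : 0 < r)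
    (hs' : s' * s' = 1) : S.HasDualBasis := by
  obtain ⟨I, _, E, F, hEF⟩ := hd
  have hS : S.Frobenius s' := h.succ hr hs'
  obtain ⟨g, hg⟩ := hS.exists_dualWords hs'
  -- The words `x T y` by themselves, by the Mackey formula.
  have hT : ∀ z ∈ S.wordsT,
      ∑ i, S.ι (E i) * b.T n * S.ι (S.π (b.T n * S.ι (F i) * z)) = z := fun z hz => by
    refine wordsT_induction
      (p := fun z => ∑ i, S.ι (E i) * b.T n * S.ι (S.π (b.T n * S.ι (F i) * z)) = z)
      (fun x y hx hy => ?_) ?_ (fun j hj x y => ?_) hz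
    · simp only [mul_add, map_add, Finset.sum_add_distrib]
      rw [hx, hy]
    · simp only [mul_zero, map_zero, Finset.sum_const_zero]
    · obtain rfl : j = n := by omega
      have h1 : ∀ i, S.ι (E i) * b.T j * S.ι (S.π (b.T j * S.ι (F i) * (S.ι x * b.T j * S.ι y))) =
          S.ι (E i * S'.ι (S'.π (F i * x))) * (b.T j * S.ι y) := fun i => by
        have h2 : b.T j * S.ι (F i) * (S.ι x * b.T j * S.ι y) =
            b.T j * S.ι (F i * x) * b.T j * S.ι y := by
          rw [map_mul]; simp only [mul_assoc]
        rw [h2, S.π_right, π_T_ι_T h.spans hr, map_mul S.ι, map_mul S.ι, ← mul_assoc,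
          mul_assoc _ (b.T j),
          ι_ι_T]
        simp only [mul_assoc]
      rw [Finset.sum_congr rfl fun i _ => h1 i, ← Finset.sum_mul, ← map_sum, hEF, mul_assoc]
  refine ⟨I ⊕ Fin r × Fin 2, inferInstance,
    Sum.elim (fun i => S.ι (E i) * b.T n)
      (fun w => b.X (n + 1) ^ (w.1 : ℕ) * b.C (n + 1) ^ (w.2 : ℕ)),
    Sum.elim (fun i => b.T n * S.ι (F i) - ∑ k : Fin r, ∑ c : Fin 2, S.ι (S.π (b.T n * S.ι (F i) *
      (b.X (n + 1) ^ (k : ℕ) * b.C (n + 1) ^ (c : ℕ)))) * g k c) (fun w => g w.1 w.2),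
    fun x => ?_⟩
  have h1 := hT _ (hg.expand hS hr hs' x)
  rw [Fintype.sum_sum_type, Fintype.sum_prod_type]
  simp only [Sum.elim_inl, Sum.elim_inr]
  rw [← eq_sub_iff_add_eq, ← h1]
  refine Finset.sum_congr rfl fun i _ => ?_
  congr 2
  rw [sub_mul, mul_sub, map_sub, map_sub, Finset.sum_mul, Finset.mul_sum, map_sum, map_sum]
  congr 1
  refine Finset.sum_congr rfl fun k _ => ?_
  rw [Finset.sum_mul, Finset.mul_sum, map_sum, map_sum]
  refine Finset.sum_congr rfl fun c _ => ?_
  rw [mul_assoc (S.ι _), S.π_left, ← mul_assoc (_ * _) (_ * _), S.π_right]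

end Pair

end HCStep

/-! ### The trace property -/

namespace HCAlg

variable {R : Type*} [CommRing R] {e : R} {P : R[X]} {n : ℕ} {B : Type*} [Ring B] [Algebra R B]

/-- The automorphism that governs the exchange of factors under the form: the supersymmetry and the
symmetry are the identity `t (x * y) = t (twist y * x)`. -/
def twist (b : HCAlg e P n B) : Kind → B →ₐ[R] B
  | Kind.zero => b.σ
  | Kind.s => AlgHom.id R B

theorem twist_even (b : HCAlg e P n B) (κ : Kind) {x : B} (hx : b.σ x = x) :
    b.twist κ x = x := by
  cases κ
  · exact hx
  · rfl

theorem twist_odd (b : HCAlg e P n B) (κ : Kind) {x : B} (hx : b.σ x = -x) :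
    b.twist κ x = kindSign R κ • x := by
  cases κ
  · exact hx.trans (neg_one_smul R x).symm
  · exact (one_smul R x).symm

variable (b : HCAlg e P (n + 1) B) (κ : Kind) (m : ℕ)

/-- The factor by which the projection to the coefficient of `1` has to be corrected. -/
def mid : B :=
  match κ with
  | Kind.zero => b.Xp m
  | Kind.s => b.Xp m + b.Xp (m + 1)

theorem Xp_mid (k : ℤ) : b.Xp k * b.mid κ m = b.mid κ m * b.Xp k := by
  cases κ
  · change b.Xp k * b.Xp m = b.Xp m * b.Xp k
    rw [b.Xp_mul, b.Xp_mul, add_comm]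
  · change b.Xp k * (b.Xp m + b.Xp (m + 1)) = (b.Xp m + b.Xp (m + 1)) * b.Xp k
    rw [mul_add, add_mul, b.Xp_mul, b.Xp_mul, b.Xp_mul, b.Xp_mul, add_comm k, add_comm k]

theorem σ_mid : b.σ (b.mid κ m) = b.mid κ m := by
  cases κ
  · exact b.σ_Xp _
  · change b.σ (b.Xp m + b.Xp (m + 1)) = b.Xp m + b.Xp (m + 1)
    rw [map_add, b.σ_Xp, b.σ_Xp]

/-- The factor is palindromic with respect to the level. -/
theorem mid_C : b.mid κ m * b.C n = b.C n * (b.Xp (-(level κ m : ℕ)) * b.mid κ m) := by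
  cases κ
  · change b.Xp m * b.C n = b.C n * (b.Xp (-(2 * m : ℕ)) * b.Xp m)
    rw [b.Xp_C, b.Xp_mul]
    congr 2
    push_cast
    ring
  · change (b.Xp m + b.Xp (m + 1)) * b.C n =
      b.C n * (b.Xp (-(2 * m + 1 : ℕ)) * (b.Xp m + b.Xp (m + 1)))
    rw [add_mul, b.Xp_C, b.Xp_C, mul_add, b.Xp_mul, b.Xp_mul, mul_add, add_comm]
    congr 3 <;> (push_cast; ring)

theorem mid_C' : b.Xp (-(level κ m : ℕ)) * b.mid κ m * b.C n = b.C n * b.mid κ m := by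
  rw [mul_assoc, b.mid_C, ← mul_assoc, b.Xp_C, neg_neg, mul_assoc, ← mul_assoc (b.Xp _), b.Xp_mul,
    add_neg_cancel, b.Xp_zero, one_mul]

end HCAlg

namespace HCStep

section General

variable {R : Type*} [CommRing R] {e : R} {P : R[X]} {n : ℕ} {κ : Kind} {m : ℕ} {A B : Type*}
  [Ring A] [Algebra R A] [Ring B] [Algebra R B] {a : HCAlg e P n A} {b : HCAlg e P (n + 1) B}
  (S : HCStep (level κ m) a b)

theorem mid_ι (x : A) : b.mid κ m * S.ι x = S.ι x * b.mid κ m := by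
  cases κ
  · exact S.Xp_ι _ _
  · change (b.Xp m + b.Xp (m + 1)) * S.ι x = S.ι x * (b.Xp m + b.Xp (m + 1))
    rw [add_mul, mul_add, S.Xp_ι, S.Xp_ι]

theorem twist_ι (x : A) : b.twist κ (S.ι x) = S.ι (a.twist κ x) := by
  cases κ
  · exact S.σ_ι x
  · rfl

/-- The projection, corrected by the factor `mid`. -/
def proj : B →ₗ[R] A := S.π ∘ₗ LinearMap.mulRight R (b.mid κ m)

theorem proj_apply (x : B) : S.proj x = S.π (x * b.mid κ m) := rfl

theorem proj_left (x : A) (y : B) : S.proj (S.ι x * y) = x * S.proj y := by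
  rw [proj_apply, mul_assoc, S.π_left, proj_apply]

theorem proj_right (x : A) (y : B) : S.proj (y * S.ι x) = S.proj y * x := by
  rw [proj_apply, mul_assoc, ← S.mid_ι, ← mul_assoc, S.π_right, proj_apply]

variable {S}

theorem proj_σ (hs : S.Spans) (hr : 0 < level κ m) (x : B) :
    S.proj (b.σ x) = a.σ (S.proj x) := by
  rw [proj_apply, proj_apply, ← π_σ hs hr, map_mul b.σ, b.σ_mid]

theorem proj_comm_Xp (h : S.Regular (kindSign R κ)) (k : ℤ) (x : B) :
    S.proj (b.Xp k * x) = S.proj (x * b.Xp k) := by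
  rw [proj_apply, mul_assoc, comm_Xp h.comm, mul_assoc, ← b.Xp_mid, ← mul_assoc, proj_apply]

/-- The last `C` moves around under the corrected projection: this is where the factor `mid` is
needed, as it turns the `X ^ r` of `Frobenius.C_C` into a symmetric rule. -/
theorem proj_mul_C (h : S.Frobenius (kindSign R κ)) (x : B) :
    S.proj (x * b.C n) = kindSign R κ • a.σ (S.proj (b.C n * x)) := by
  have h1 : x * b.C n * b.mid κ m =
      b.C n * (b.C n * x * (b.Xp (-(level κ m : ℕ)) * b.mid κ m)) * b.C n := by
    rw [mul_assoc, ← b.mid_C', ← mul_assoc (b.C n), ← mul_assoc (b.C n), b.C_C, one_mul]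
    simp only [mul_assoc]
  have h2 : b.C n * x * (b.Xp (-(level κ m : ℕ)) * b.mid κ m) * b.Xp (level κ m : ℕ) =
      b.C n * x * b.mid κ m := by
    rw [mul_assoc, mul_assoc (b.Xp _), ← b.Xp_mid, ← mul_assoc (b.Xp _), b.Xp_mul, neg_add_cancel,
      b.Xp_zero, one_mul]
  rw [proj_apply, h1, h.C_C, comm_Xp h.comm, h2, proj_apply]

/-- The trace property passes to the next rank as soon as it holds for the last `T`. -/
theorem trace_of (h : S.Frobenius (kindSign R κ)) {t : A →ₗ[R] R}
    (hσ : ∀ x, t (a.σ x) = t x) (ht : ∀ x y, t (x * y) = t (a.twist κ y * x))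
    (hT : ∀ i, i + 1 = n → ∀ x, t (S.proj (x * b.T i)) = t (S.proj (b.T i * x))) (x y : B) :
    t (S.proj (x * y)) = t (S.proj (b.twist κ y * x)) := by
  have hn : n < n + 1 := Nat.lt_succ_self n
  have hι : ∀ y x, t (S.proj (x * S.ι y)) = t (S.proj (b.twist κ (S.ι y) * x)) := fun y x => by
    rw [S.proj_right, ht, S.twist_ι, S.proj_left]
  have hmul : ∀ y z, (∀ x, t (S.proj (x * y)) = t (S.proj (b.twist κ y * x))) →
      (∀ x, t (S.proj (x * z)) = t (S.proj (b.twist κ z * x))) →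
      ∀ x, t (S.proj (x * (y * z))) = t (S.proj (b.twist κ (y * z) * x)) := fun y z hy hz x => by
    rw [← mul_assoc, hz, ← mul_assoc, hy, map_mul (b.twist κ), mul_assoc]
  have hC : ∀ x, t (S.proj (x * b.C n)) = t (S.proj (b.twist κ (b.C n) * x)) := fun x => by
    rw [b.twist_odd κ (b.σ_C n hn), proj_mul_C h, map_smul, hσ, smul_mul_assoc, map_smul, map_smul]
  have hX : ∀ x, t (S.proj (x * b.X n)) = t (S.proj (b.twist κ (b.X n) * x)) := fun x => by
    rw [b.twist_even κ (b.σ_X hn), ← b.Xp_one, proj_comm_Xp h.toRegular]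
  refine b.induction (p := fun y => ∀ x, t (S.proj (x * y)) = t (S.proj (b.twist κ y * x)))
    (fun c x => ?_) (fun y z hy hz x => ?_) hmul (fun i hi x => ?_) (fun h0 => ?_) (fun h0 => ?_) y x
  · rw [AlgHom.commutes, Algebra.commutes]
  · rw [mul_add, map_add, map_add, hy, hz, map_add (b.twist κ), add_mul, map_add S.proj, map_add t]
  · rcases Nat.lt_or_ge (i + 1) n with h1 | h1
    · rw [← S.ι_T i h1]
      exact hι _ x
    · rw [b.twist_even κ (b.σ_T i hi)]
      exact hT i (by omega) x
  · rcases Nat.eq_zero_or_pos n with h1 | h1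
    · rw [← congrArg b.C h1]
      exact hC
    · rw [← S.ι_C 0 h1]
      exact hι _
  · rcases Nat.eq_zero_or_pos n with h1 | h1
    · rw [← congrArg b.Y h1, ← b.C_X hn]
      exact hmul _ _ hC hX
    · rw [← S.ι_Y 0 h1]
      exact hι _

end General

section Pair

variable {R : Type*} [CommRing R] {e : R} {P : R[X]} {n : ℕ} {κ : Kind} {m : ℕ} {A₀ A B : Type*}
  [Ring A₀] [Algebra R A₀] [Ring A] [Algebra R A] [Ring B] [Algebra R B] {a₀ : HCAlg e P n A₀}
  {a : HCAlg e P (n + 1) A} {b : HCAlg e P (n + 2) B} {S' : HCStep (level κ m) a₀ a}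
  {S : HCStep (level κ m) a b}

/-- The Mackey formula for the corrected projection. -/
theorem proj_T_ι_T (h : S'.Frobenius (kindSign R κ)) (hr : 0 < level κ m) :
    ∃ c : R, ∀ x, S.proj (b.T n * S.ι x * b.T n) = S'.ι (S'.proj x) + c • x := by
  have hreg : S.Regular (kindSign R κ) := h.toRegular.succ hr
  have hα : ∀ k : ℕ, k ≤ level κ m → ∃ c : R, S.π (b.T n * b.Xp k) = c • 1 := fun k hk => by
    rcases eq_or_lt_of_le hk with rfl | hk
    · exact ⟨_, hreg.α_level hr⟩
    · exact ⟨0, by rw [S.α_of_lt hk, zero_smul]⟩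
  have hη : ∀ k : ℕ, k ≤ level κ m → ∃ c : R, ∀ x, S.π (b.T n * S.ι x * b.T n * b.Xp k) =
      S'.ι (S'.π (x * a.Xp k)) + c • x := fun k hk => by
    obtain ⟨c, hc⟩ := hα k hk
    refine ⟨e * c, fun x => ?_⟩
    rw [S.η_range x hk, π_T_ι_T h.spans hr, hc, smul_mul_assoc, one_mul, smul_smul]
  cases κ
  · obtain ⟨c, hc⟩ := hη m (by change m ≤ 2 * m; omega)
    exact ⟨c, hc⟩
  · obtain ⟨c, hc⟩ := hη m (by change m ≤ 2 * m + 1; omega)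
    obtain ⟨d, hd⟩ := hη (m + 1) (by change m + 1 ≤ 2 * m + 1; omega)
    refine ⟨c + d, fun x => ?_⟩
    change S.π (_ * (b.Xp m + b.Xp (m + 1))) = S'.ι (S'.π (x * (a.Xp m + a.Xp (m + 1)))) + _
    rw [Nat.cast_succ] at hd
    rw [mul_add, map_add, hc, hd, mul_add, map_add, map_add, add_smul]
    abel

/-- The trace property for the last `T`. -/
theorem trace_T (h : S'.Frobenius (kindSign R κ)) (hr : 0 < level κ m)
    {t₀ : A₀ →ₗ[R] R}
    (hσ : ∀ x, t₀ (S'.proj (a.σ x)) = t₀ (S'.proj x))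
    (ht : ∀ x y, t₀ (S'.proj (x * y)) = t₀ (S'.proj (a.twist κ y * x))) (x : B) :
    t₀ (S'.proj (S.proj (x * b.T n))) = t₀ (S'.proj (S.proj (b.T n * x))) := by
  have hs' : kindSign R κ * kindSign R κ = 1 := kindSign_mul_self κ
  have hS : S.Frobenius (kindSign R κ) := h.succ hr hs'
  have hn : n + 1 < n + 2 := Nat.lt_succ_self _
  refine hS.spans.induction hr (p := fun x => t₀ (S'.proj (S.proj (x * b.T n))) =
    t₀ (S'.proj (S.proj (b.T n * x)))) (fun x y hx hy => ?_) (fun i hi x y => ?_)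
    (fun k hk x => ?_) (fun k hk x => ?_) x
  · rw [add_mul, map_add, map_add, map_add, hx, hy, mul_add, map_add S.proj, map_add S'.proj,
      map_add t₀]
  · obtain rfl : i = n := by omega
    obtain ⟨c, hc⟩ := proj_T_ι_T (S := S) h hr
    have h1 : S.ι x * b.T i * S.ι y * b.T i = S.ι x * (b.T i * S.ι y * b.T i) := by
      simp only [mul_assoc]
    have h2 : b.T i * (S.ι x * b.T i * S.ι y) = b.T i * S.ι x * b.T i * S.ι y := by
      simp only [mul_assoc]
    rw [h1, h2, S.proj_left, S.proj_right, hc, hc, mul_add, add_mul, map_add, map_add, map_add,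
      map_add, S'.proj_right, S'.proj_left, mul_smul_comm, smul_mul_assoc]
  · have h1 : S.proj (b.X (n + 1) ^ k * b.T n) = S.proj (b.T n * b.X (n + 1) ^ k) := by
      rw [← b.Xp_natCast, proj_comm_Xp hS.toRegular]
    have h2 : a.σ (S.proj (b.T n * b.X (n + 1) ^ k)) = S.proj (b.T n * b.X (n + 1) ^ k) := by
      rw [← proj_σ hS.spans hr, map_mul b.σ, b.σ_T n hn, map_pow, b.σ_X hn]
    have h3 : b.X (n + 1) ^ k * S.ι x * b.T n = S.ι x * (b.X (n + 1) ^ k * b.T n) := by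
      rw [← b.Xp_natCast, S.Xp_ι, mul_assoc]
    rw [h3, S.proj_left, ← mul_assoc, S.proj_right, h1, ht, a.twist_even κ h2]
  · set γ := S.proj (b.T n * b.C (n + 1) * b.X (n + 1) ^ k) with hγ
    have h2 : a.σ γ = -γ := by
      rw [hγ, ← proj_σ hS.spans hr, map_mul b.σ, map_mul b.σ, b.σ_T n hn, map_pow, b.σ_X hn,
        b.σ_C _ hn, mul_neg, neg_mul, map_neg]
    have h1 : γ = -(kindSign R κ • S.proj (b.C (n + 1) * b.X (n + 1) ^ k * b.T n)) := by
      have h4 : S.proj (b.X (n + 1) ^ k * b.T n * b.C (n + 1)) = γ := by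
        rw [hγ, ← b.Xp_natCast, mul_assoc, proj_comm_Xp hS.toRegular]
      rw [proj_mul_C hS] at h4
      rw [← neg_neg γ, ← h2, ← h4, map_smul, a.σ_σ, mul_assoc]
    have h3 : b.C (n + 1) * b.X (n + 1) ^ k * S.ι x * b.T n =
        S.ι (a.σ x) * (b.C (n + 1) * b.X (n + 1) ^ k * b.T n) := by
      rw [← b.Xp_natCast, mul_assoc (b.C _), S.Xp_ι, ← mul_assoc, S.C_ι]
      simp only [mul_assoc]
    have h5 : S.proj (b.C (n + 1) * b.X (n + 1) ^ k * b.T n) = kindSign R κ • a.σ γ := by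
      rw [h2, h1, neg_neg, smul_smul, hs', one_smul]
    rw [h3, S.proj_left, h5, mul_smul_comm, ← map_mul a.σ, map_smul, map_smul, hσ, ← mul_assoc,
      ← mul_assoc, S.proj_right, ht, a.twist_odd κ h2, smul_mul_assoc, map_smul, map_smul,
      smul_smul,
      hs', one_smul]

end Pair

end HCStep

/-! ### The projections of the cyclotomic algebras -/

section OfTower

open Window Tower MulOpposite

variable {R : Type*} [CommRing R] {e : R} {P : R[X]} {n r : ℕ} {A B : Type*} [Ring A]
  [Algebra R A] [Ring B] [Algebra R B]

namespace Tower

theorem coeffZero_rsmul (hr : 0 < r) (c : R) (v : Tower A n r) :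
    coeffZero hr (c • v) = c • coeffZero hr v := rfl

theorem coeffZero_of_emb {hr : 0 < r} {φ : TowerEnd A n r} {x : A}
    (h : ∀ j, j < n → ∀ w, coeffZero hr (φ (emb n j w)) = 0)
    (h' : ∀ w, coeffZero hr (φ (emb n n w)) = x * w.1 ⟨0, hr⟩) (v : Tower A n r) :
    coeffZero hr (φ v) = x * coeffZero hr v := by
  rw [eq_sum_emb v, map_sum, map_sum, map_sum, Finset.mul_sum]
  refine Finset.sum_congr rfl fun j _ => ?_
  rcases eq_or_lt_of_le (Nat.le_of_lt_succ j.2) with hj | hj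
  · rw [hj, h', coeffZero_emb_last]
  · rw [h _ hj, coeffZero_emb_of_ne hr hj.ne, mul_zero]

theorem coeffZero_opT (hr : 0 < r) (d : HCSystem e P n A) {i : ℕ} (hi : i + 1 < n)
    (v : Tower A n r) : coeffZero hr (opT r d i v) = d.T i * coeffZero hr v := by
  refine coeffZero_of_emb (fun j hj w => ?_) (fun w => ?_) v
  · rcases lt_trichotomy j i with h | rfl | h
    · rw [opT_emb_of_lt h hj.le, coeffZero_emb_of_ne hr hj.ne]
    · rw [opT_emb_self hj.le, map_add, coeffZero_emb_of_ne hr hi.ne, coeffZero_emb_of_ne hr hj.ne,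
        add_zero]
    · rcases eq_or_lt_of_le (Nat.succ_le_of_lt h) with rfl | h
      · rw [opT_emb_succ hj.le, map_add, coeffZero_emb_of_ne hr hj.ne,
          coeffZero_emb_of_ne hr (by omega), add_zero]
      · rw [opT_emb_of_gt h hj.le, coeffZero_emb_of_ne hr hj.ne]
  · rw [opT_emb_of_gt hi le_rfl, coeffZero_emb_last]
    rfl

theorem coeffZero_opC (hr : 0 < r) (d : HCSystem e P n A) {i : ℕ} (hi : i < n)
    (v : Tower A n r) : coeffZero hr (opC r d i v) = d.C i * coeffZero hr v := by
  refine coeffZero_of_emb (fun j hj w => ?_) (fun w => ?_) v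
  · rcases lt_trichotomy j i with h | rfl | h
    · rw [opC_emb_of_lt h hj.le, coeffZero_emb_of_ne hr hj.ne]
    · rw [opC_emb_self hj.le, coeffZero_emb_of_ne hr hj.ne]
    · rw [opC_emb_of_gt h hj.le, coeffZero_emb_of_ne hr hj.ne]
  · rw [opC_emb_of_gt hi le_rfl, coeffZero_emb_last]
    rfl

theorem coeffZero_opY (hr : 0 < r) (d : HCSystem e P n A) (hn : 0 < n)
    (v : Tower A n r) : coeffZero hr (opY r d v) = d.Y 0 * coeffZero hr v := by
  refine coeffZero_of_emb (fun j hj w => ?_) (fun w => ?_) v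
  · rcases Nat.eq_zero_or_pos j with rfl | h
    · rw [opY_emb_zero, coeffZero_emb_of_ne hr hj.ne]
    · rw [opY_emb_of_pos h hj.le, coeffZero_emb_of_ne hr hj.ne]
  · rw [opY_emb_of_pos hn le_rfl, coeffZero_emb_last]
    rfl

end Tower

/-- Two consecutive ranks, the higher one with a representation on the tower over the lower one. -/
structure TowerRep {s : R} (hr : 0 < r) (hP : IsPalindromic P r s) (a : HCAlg e P n A)
    (b : HCAlg e P (n + 1) B) where
  ι : A →ₐ[R] B
  ι_T : ∀ i, i + 1 < n → ι (a.T i) = b.T i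
  ι_C : ∀ j, j < n → ι (a.C j) = b.C j
  ι_Y : ∀ j, j < n → ι (a.Y j) = b.Y j
  Φ : B →ₐ[R] TowerEnd A n r
  Φ_T : ∀ i, i + 1 < n + 1 → Φ (b.T i) = opT r a.toHCSystem i
  Φ_C : ∀ j, j < n + 1 → Φ (b.C j) = opC r a.toHCSystem j
  Φ_Y : ∀ j, j < n + 1 → Φ (b.Y j) = (Tower.system hr hP a.toHCSystem).Y j

namespace TowerRep

variable {s : R} {hr : 0 < r} {hP : IsPalindromic P r s} {a : HCAlg e P n A}
  {b : HCAlg e P (n + 1) B} (S : TowerRep hr hP a b)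

theorem coeffZero_Φ_ι (x : A) (v : Tower A n r) :
    coeffZero hr (S.Φ (S.ι x) v) = x * coeffZero hr v := by
  refine a.induction (p := fun x => ∀ v, coeffZero hr (S.Φ (S.ι x) v) = x * coeffZero hr v)
    (fun c v => ?_) (fun x y hx hy v => ?_) (fun x y hx hy v => ?_) (fun i hi v => ?_)
    (fun h v => ?_) (fun h v => ?_) x v
  · rw [AlgHom.commutes, AlgHom.commutes, Module.algebraMap_end_apply, coeffZero_rsmul,
      Algebra.smul_def]
  · rw [map_add, map_add, LinearMap.add_apply, map_add, hx, hy, add_mul]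
  · rw [map_mul, map_mul, Module.End.mul_apply, hx, hy, mul_assoc]
  · rw [S.ι_T i hi, S.Φ_T i (by omega), coeffZero_opT hr _ hi]
  · rw [S.ι_C 0 h, S.Φ_C 0 (by omega), coeffZero_opC hr _ h]
  · rw [S.ι_Y 0 h, S.Φ_Y 0 (by omega)]
    exact coeffZero_opY hr _ h v

theorem Φ_ι_vacuum (x : A) : S.Φ (S.ι x) (vacuum A n r) = op x • vacuum A n r := by
  refine a.induction (p := fun x => S.Φ (S.ι x) (vacuum A n r) = op x • vacuum A n r)
    (fun c => ?_) (fun x y hx hy => ?_) (fun x y hx hy => ?_) (fun i hi => ?_) (fun h => ?_)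
    (fun h => ?_) x
  · rw [AlgHom.commutes, AlgHom.commutes, Module.algebraMap_end_apply,
      Algebra.algebraMap_eq_smul_one, op_smul, op_one, smul_assoc, one_smul]
  · rw [map_add, map_add, LinearMap.add_apply, hx, hy, op_add, add_smul]
  · rw [map_mul, map_mul, Module.End.mul_apply, hy, map_smul, hx, smul_smul, op_mul]
  · rw [S.ι_T i hi, S.Φ_T i (by omega), vacuum, opT_emb_of_gt hi le_rfl, lam_xw, map_smul]
  · rw [S.ι_C 0 h, S.Φ_C 0 (by omega), vacuum, opC_emb_of_gt h le_rfl, lo_xw, map_smul]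
  · rw [S.ι_Y 0 h, S.Φ_Y 0 (by omega), vacuum, system_Y_emb_of_gt hr hP h le_rfl, lo_xw, map_smul]

theorem Φ_X_pow {k : ℕ} (hk : k < r) :
    S.Φ (b.X n ^ k) (vacuum A n r) = emb n n (xw A r k) := by
  induction k with
  | zero => rw [pow_zero, map_one]; rfl
  | succ k ih =>
    rw [pow_succ', map_mul, Module.End.mul_apply, ih (by omega), HCSystem.X, map_mul,
      Module.End.mul_apply, S.Φ_Y n (Nat.lt_succ_self n), S.Φ_C n (Nat.lt_succ_self n),
      system_Y_emb_self hr hP le_rfl hk, opC_emb_self le_rfl, cl_cw]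

/-- The projection is the coefficient of the empty word in the image of the vacuum. -/
def step : HCStep r a b where
  ι := S.ι
  ι_T := S.ι_T
  ι_C := S.ι_C
  ι_Y := S.ι_Y
  π :=
    { toFun := fun x => coeffZero hr (S.Φ x (vacuum A n r))
      map_add' := fun x y => by rw [map_add, LinearMap.add_apply, map_add]
      map_smul' := fun c x => by
        rw [map_smul, LinearMap.smul_apply, coeffZero_rsmul, RingHom.id_apply] }
  π_left x y := by
    change coeffZero hr (S.Φ (S.ι x * y) _) = x * coeffZero hr (S.Φ y _)
    rw [map_mul, Module.End.mul_apply, S.coeffZero_Φ_ι]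
  π_right x y := by
    change coeffZero hr (S.Φ (y * S.ι x) _) = coeffZero hr (S.Φ y _) * x
    rw [map_mul, Module.End.mul_apply, S.Φ_ι_vacuum, map_smul, map_smul]
    rfl
  π_T i hi := by
    subst hi
    change coeffZero hr (S.Φ (b.T i) _) = 0
    rw [S.Φ_T i (by omega), vacuum, opT_emb_succ le_rfl, D_xw_zero, map_zero, zero_add,
      coeffZero_emb_of_ne hr (Nat.succ_ne_self i).symm]
  π_X k hk := by
    change coeffZero hr (S.Φ (b.X n ^ k) _) = _
    rw [S.Φ_X_pow hk, coeffZero_emb_last, xw_fst]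
    simp only [eq_comm]
  π_CX k hk := by
    change coeffZero hr (S.Φ (b.C n * b.X n ^ k) _) = _
    rw [map_mul, Module.End.mul_apply, S.Φ_X_pow hk, S.Φ_C n (Nat.lt_succ_self n),
      opC_emb_self le_rfl, cl_xw, coeffZero_emb_last, cw_fst]

end TowerRep

end OfTower

section Cyclotomic

variable {R : Type*} [CommRing R] (q : Rˣ) (κ : Kind) {m : ℕ} (Q : Fin m → Rˣ)

/-- The cyclotomic Hecke-Clifford algebra, with its generators and its parity automorphism. -/
def cycAlg (n : ℕ) : HCAlg (eps q) (defPoly q κ Q) n (Cyc q κ Q n) where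
  toHCSystem := cycSys q κ Q n
  generates := cycSys_generates q κ Q n
  σ := parityHom q κ Q n
  σ_T _ h := parityHom_T q κ Q h
  σ_C _ h := parityHom_C q κ Q h
  σ_Y _ h := parityHom_Y q κ Q h

variable {q κ Q} in
/-- The representation of the next cyclotomic Hecke-Clifford algebra on the tower. -/
def cycTowerRep [Nontrivial R] (hr : 0 < level κ m) {n : ℕ} {A : Type*} [Ring A] [Algebra R A]
    (a : HCAlg (eps q) (defPoly q κ Q) n A) (ι : A →ₐ[R] Cyc q κ Q (n + 1))
    (ι_T : ∀ i, i + 1 < n → ι (a.T i) = (cycSys q κ Q (n + 1)).T i)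
    (ι_C : ∀ j, j < n → ι (a.C j) = (cycSys q κ Q (n + 1)).C j)
    (ι_Y : ∀ j, j < n → ι (a.Y j) = (cycSys q κ Q (n + 1)).Y j) :
    TowerRep hr (isPalindromic_defPoly q κ Q) a (cycAlg q κ Q (n + 1)) where
  ι := ι
  ι_T := ι_T
  ι_C := ι_C
  ι_Y := ι_Y
  Φ := (Tower.system hr (isPalindromic_defPoly q κ Q) a.toHCSystem).lift
  Φ_T i h := by
    change HCSystem.lift _ ((cycSys q κ Q (n + 1)).T i) = _
    rw [cycSys_T q κ Q h, HCSystem.lift_gen]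
    rfl
  Φ_C j h := by
    change HCSystem.lift _ ((cycSys q κ Q (n + 1)).C j) = _
    rw [cycSys_C q κ Q h, HCSystem.lift_gen]
    rfl
  Φ_Y j h := by
    change HCSystem.lift _ ((cycSys q κ Q (n + 1)).Y j) = _
    rw [cycSys_Y_eq q κ Q h, map_mul, HCSystem.lift_gen, HCSystem.lift_gen]
    exact HCSystem.C_X _ h

/-- The step from one cyclotomic Hecke-Clifford algebra to the next. -/
def cycStep [Nontrivial R] (hr : 0 < level κ m) (n : ℕ) :
    HCStep (level κ m) (cycAlg q κ Q n) (cycAlg q κ Q (n + 1)) :=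
  (cycTowerRep hr (cycAlg q κ Q n) (incl q κ Q n) (fun _ h => incl_T q κ Q h)
    (fun _ h => incl_C q κ Q h) fun _ h => incl_Y q κ Q h).step

theorem algebraMap_base (x : Cyc q κ Q 0) : algebraMap R _ (base q κ Q x) = x := by
  refine (cycAlg q κ Q 0).induction (p := fun x => algebraMap R _ (base q κ Q x) = x) (fun c => ?_)
    (fun x y hx hy => ?_) (fun x y hx hy => ?_) (fun i hi => by omega) (fun h => by omega)
    (fun h => by omega) x
  · rw [AlgHom.commutes]; rfl
  · rw [map_add, map_add, hx, hy]
  · rw [map_mul, map_mul, hx, hy]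

theorem cyc_zero_eq_zero [IsDomain R] (hR : ringChar R ≠ 2) {x : Cyc q κ Q 0} (h : x + x = 0) :
    x = 0 := by
  have h1 := congrArg (base q κ Q) h
  rw [map_add, map_zero, ← two_mul] at h1
  have h2 : (2 : R) ≠ 0 := Ring.two_ne_zero hR
  rw [← algebraMap_base q κ Q x, (mul_eq_zero.1 h1).resolve_left h2, map_zero]

theorem parityHom_zero (x : Cyc q κ Q 0) : parityHom q κ Q 0 x = x := by
  rw [← algebraMap_base q κ Q x, AlgHom.commutes]

variable {κ}

theorem cycStep_frobenius [IsDomain R] (hR : ringChar R ≠ 2) (hr : 0 < level κ m) (n : ℕ) :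
    (cycStep q κ Q hr n).Frobenius (kindSign R κ) := by
  induction n with
  | zero =>
    have h := HCStep.regular_base (S := cycStep q κ Q hr 0) hr (isPalindromic_defPoly q κ Q)
      (parityHom_zero q κ Q) fun x => cyc_zero_eq_zero q κ Q hR
    rw [neg_neg] at h
    exact h.frobenius_base hr (kindSign_mul_self κ)
  | succ n ih => exact ih.succ hr (kindSign_mul_self κ)

theorem cycStep_hasDualBasis [IsDomain R] (hR : ringChar R ≠ 2) (hr : 0 < level κ m) (n : ℕ) :
    (cycStep q κ Q hr n).HasDualBasis := by
  induction n with
  | zero => exact (cycStep_frobenius q Q hR hr 0).hasDualBasis_base hr (kindSign_mul_self κ)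
  | succ n ih => exact ih.succ (cycStep_frobenius q Q hR hr n) hr (kindSign_mul_self κ)

end Cyclotomic

end HeckeClifford

/-! ### Forms with a dual basis -/

namespace Superalgebra

open HeckeClifford

variable {R : Type*} [CommRing R] {A : Type*} [Ring A] [Algebra R A] {t : A →ₗ[R] R}

/-- A finite dual basis with functionals of the form `t (f * ·)`. -/
def HasFormBasis (t : A →ₗ[R] R) : Prop := ∃ (I : Type) (_ : Fintype I) (E F : I → A),
  ∀ x, ∑ i, t (F i * x) • E i = x

theorem HasFormBasis.finite_projective (h : HasFormBasis t) :
    Module.Finite R A ∧ Module.Projective R A := by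
  obtain ⟨I, _, E, F, h⟩ := h
  let f : (I → R) →ₗ[R] A := Fintype.linearCombination R E
  let g : A →ₗ[R] (I → R) := LinearMap.pi fun i => t ∘ₗ LinearMap.mulLeft R (F i)
  have hfg : f ∘ₗ g = LinearMap.id := LinearMap.ext fun x => h x
  refine ⟨Module.Finite.of_surjective f fun x => ⟨g x, h x⟩, Module.Projective.of_split g f hfg⟩

theorem HasFormBasis.exists_eq (h : HasFormBasis t) (φ : A →ₗ[R] R) :
    ∃ a, ∀ x, t (a * x) = φ x := by
  obtain ⟨I, _, E, F, h⟩ := h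
  refine ⟨∑ i, φ (E i) • F i, fun x => ?_⟩
  rw [Finset.sum_mul, map_sum, ← congrArg φ (h x), map_sum]
  refine Finset.sum_congr rfl fun i _ => ?_
  rw [smul_mul_assoc, map_smul, map_smul, smul_eq_mul, smul_eq_mul, mul_comm]

theorem HasFormBasis.eq_of (h : HasFormBasis t) {a b : A} (hab : ∀ x, t (x * a) = t (x * b)) :
    a = b := by
  obtain ⟨I, _, E, F, h⟩ := h
  rw [← h a, ← h b]
  exact Finset.sum_congr rfl fun i _ => by rw [hab]

/-- A form that differs from `t` by an invertible factor has a dual basis as well. -/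
theorem HasFormBasis.of_mul_unit (h : HasFormBasis t) {t' : A →ₗ[R] R} {w w' : A}
    (hw : w' * w = 1) (ht' : ∀ x, t' x = t (x * w)) {ρ : A → A}
    (hρ : ∀ x y, t' (x * y) = t' (ρ y * x)) : HasFormBasis t' := by
  obtain ⟨I, _, E, F, h⟩ := h
  refine ⟨I, inferInstance, E, fun i => ρ w' * F i, fun x => ?_⟩
  refine (Finset.sum_congr rfl fun i _ => ?_).trans (h x)
  rw [mul_assoc, ← hρ, ht', mul_assoc, hw, mul_one]

variable {𝒜 : ZMod 2 → Submodule R A} {σ : A →ₐ[R] A}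

theorem eq_zero_or_one (i : ZMod 2) : i = 0 ∨ i = 1 := by
  revert i
  decide

theorem sum_zmod_two {M : Type*} [AddCommMonoid M] (f : ZMod 2 → M) : ∑ i, f i = f 0 + f 1 :=
  Fin.sum_univ_two f

/-- An invariant form kills the odd part, since `2` is not a zero divisor. -/
theorem form_odd [IsDomain R] (hR : ringChar R ≠ 2)
    (hσ : ∀ i, ∀ x ∈ 𝒜 i, σ x = paritySign R i • x) (ht : ∀ x, t (σ x) = t x) {x : A}
    (hx : x ∈ 𝒜 1) : t x = 0 := by
  have h1 := ht x
  rw [hσ 1 x hx, paritySign, if_neg (by decide), neg_one_smul, map_neg, neg_eq_iff_add_eq_zero,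
    ← two_mul] at h1
  exact (mul_eq_zero.1 h1).resolve_left (Ring.two_ne_zero hR)

variable [GradedAlgebra 𝒜]

theorem sum_comp (a : A) : comp 𝒜 0 a + comp 𝒜 1 a = a := by
  classical
  have h := DirectSum.sum_support_decompose 𝒜 a
  rw [Finset.sum_subset (Finset.subset_univ _)] at h
  · exact (sum_zmod_two fun i => comp 𝒜 i a).symm.trans h
  · intro i _ hi
    rw [DFinsupp.notMem_support_iff.1 hi]
    rfl

theorem comp_mem (i : ZMod 2) (a : A) : comp 𝒜 i a ∈ 𝒜 i := SetLike.coe_mem _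

theorem comp_of_mem {i j : ZMod 2} {a : A} (ha : a ∈ 𝒜 i) :
    comp 𝒜 j a = if i = j then a else 0 := by
  split_ifs with h
  · subst h
    exact DirectSum.decompose_of_mem_same 𝒜 ha
  · exact DirectSum.decompose_of_mem_ne 𝒜 ha h

theorem isSymmetrizingForm [IsDomain R] (hR : ringChar R ≠ 2)
    (hσ : ∀ i, ∀ x ∈ 𝒜 i, σ x = paritySign R i • x) (ht : ∀ x, t (σ x) = t x)
    (hsymm : ∀ x y, t (x * y) = t (y * x)) (hb : HasFormBasis t) : IsSymmetrizingForm 𝒜 t where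
  finite := hb.finite_projective.1
  projective := hb.finite_projective.2
  odd x hx := form_odd hR hσ ht hx
  symm := hsymm
  hat_parity i a ha j hj x hx := by
    have h1 : j + i = 1 := (show ∀ i j : ZMod 2, j ≠ i → j + i = 1 by decide) i j hj
    have h2 := SetLike.GradedMul.mul_mem hx ha
    rw [h1] at h2
    exact form_odd hR hσ ht h2
  hat_left a' a := LinearMap.ext fun x => congrArg t (mul_assoc x a' a).symm
  hat_right a a' := LinearMap.ext fun x => by
    change t (x * (a * a')) = t (a' * x * a)
    rw [← mul_assoc, hsymm, mul_assoc]
  hat_bijective := by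
    refine ⟨fun a b hab => hb.eq_of fun x => LinearMap.congr_fun hab x, fun φ => ?_⟩
    obtain ⟨a, ha⟩ := hb.exists_eq φ
    exact ⟨a, LinearMap.ext fun x => (hsymm x a).trans (ha x)⟩

theorem supersymm_of_twist [IsDomain R] (hR : ringChar R ≠ 2)
    (hσ : ∀ i, ∀ x ∈ 𝒜 i, σ x = paritySign R i • x) (ht : ∀ x, t (σ x) = t x)
    (hsymm : ∀ x y, t (x * y) = t (σ y * x)) {i j : ZMod 2} {x y : A} (hx : x ∈ 𝒜 i)
    (hy : y ∈ 𝒜 j) : t (x * y) = sgn R i j * t (y * x) := by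
  have hm := SetLike.GradedMul.mul_mem hy hx
  rw [hsymm, hσ j y hy, smul_mul_assoc, map_smul, smul_eq_mul]
  rcases eq_zero_or_one i with rfl | rfl <;> rcases eq_zero_or_one j with rfl | rfl
  · simp [paritySign, sgn]
  · rw [show t (y * x) = 0 from form_odd hR hσ ht hm, mul_zero, mul_zero]
  · rw [show t (y * x) = 0 from form_odd hR hσ ht hm, mul_zero, mul_zero]
  · simp [paritySign, sgn, ZMod.val_one]

/-- The signs in the definition of the map `a ↦ (-1) ^ (|a||x|) t (x a)` are those of the
supersymmetry. -/
theorem superHat_apply [IsDomain R] (hR : ringChar R ≠ 2)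
    (hσ : ∀ i, ∀ x ∈ 𝒜 i, σ x = paritySign R i • x) (ht : ∀ x, t (σ x) = t x)
    (hsymm : ∀ x y, t (x * y) = t (σ y * x)) (a x : A) : superHat 𝒜 t a x = t (a * x) := by
  have h1 : superHat 𝒜 t a x = ∑ i, ∑ j, t (comp 𝒜 i a * comp 𝒜 j x) := by
    rw [superHat, LinearMap.sum_apply, LinearMap.sum_apply]
    refine Finset.sum_congr rfl fun i _ => ?_
    rw [LinearMap.sum_apply, LinearMap.sum_apply]
    refine Finset.sum_congr rfl fun j _ => ?_
    rw [supersymm_of_twist hR hσ ht hsymm (comp_mem i a) (comp_mem j x)]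
    rfl
  simp only [h1]
  simp only [sum_zmod_two]
  rw [← map_add, ← map_add, ← map_add,
    ← mul_add, ← mul_add, ← add_mul, sum_comp, sum_comp]

/-- The left action on the functional `t (a * ·)`, whose signs cancel likewise. -/
theorem superLeftAct_apply
    (hσ : ∀ i, ∀ x ∈ 𝒜 i, σ x = paritySign R i • x)
    (hsymm : ∀ x y, t (x * y) = t (σ y * x)) {f : A →ₗ[R] R} {a : A} (hf : ∀ x, f x = t (a * x))
    (a' x : A) : superLeftAct 𝒜 a' f x = t (a' * a * x) := by
  have h1 : superLeftAct 𝒜 a' f x = ∑ i, ∑ j, ∑ k,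
      sgn R i j * sgn R i k * f (comp 𝒜 j (comp 𝒜 k x * comp 𝒜 i a')) := by
    simp [superLeftAct]
  have h2 : ∀ i k : ZMod 2, ∑ j,
      sgn R i j * sgn R i k * f (comp 𝒜 j (comp 𝒜 k x * comp 𝒜 i a')) =
        t (comp 𝒜 i a' * (a * comp 𝒜 k x)) := fun i k => by
    have hm := SetLike.GradedMul.mul_mem (comp_mem (𝒜 := 𝒜) k x) (comp_mem (𝒜 := 𝒜) i a')
    have h3 : sgn R i (k + i) * sgn R i k * paritySign R i = 1 := by
      rcases eq_zero_or_one i with rfl | rfl <;> rcases eq_zero_or_one k with rfl | rfl <;>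
        simp [sgn, paritySign, ZMod.val_one, show (1 + 1 : ZMod 2) = 0 by decide]
    rw [Finset.sum_eq_single (k + i), comp_of_mem hm, if_pos rfl, hf, ← mul_assoc, hsymm,
      hσ i _ (comp_mem i a'), smul_mul_assoc, map_smul, smul_eq_mul, ← mul_assoc, h3, one_mul]
    · intro j _ hj
      rw [comp_of_mem hm, if_neg hj.symm, map_zero, mul_zero]
    · exact fun h => absurd (Finset.mem_univ _) h
  rw [h1, Finset.sum_congr rfl fun i _ => Finset.sum_comm.trans
    (Finset.sum_congr rfl fun k _ => h2 i k)]
  simp only [sum_zmod_two]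
  rw [← map_add, ← map_add, ← map_add,
    ← mul_add, ← mul_add, ← mul_add, ← mul_add, ← add_mul, sum_comp, sum_comp, mul_assoc]

theorem isSupersymmetrizingForm [IsDomain R] (hR : ringChar R ≠ 2)
    (hσ : ∀ i, ∀ x ∈ 𝒜 i, σ x = paritySign R i • x) (hσσ : ∀ x, σ (σ x) = x)
    (ht : ∀ x, t (σ x) = t x) (hsymm : ∀ x y, t (x * y) = t (σ y * x)) (hb : HasFormBasis t) :
    IsSupersymmetrizingForm 𝒜 t where
  finite := hb.finite_projective.1
  projective := hb.finite_projective.2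
  odd x hx := form_odd hR hσ ht hx
  supersymm i j x hx y hy := supersymm_of_twist hR hσ ht hsymm hx hy
  hat_parity i a ha j hj x hx := by
    have h1 : i + j = 1 := (show ∀ i j : ZMod 2, j ≠ i → i + j = 1 by decide) i j hj
    have h2 := SetLike.GradedMul.mul_mem ha hx
    rw [h1] at h2
    rw [superHat_apply hR hσ ht hsymm]
    exact form_odd hR hσ ht h2
  hat_left a' a := LinearMap.ext fun x => by
    rw [superHat_apply hR hσ ht hsymm, superLeftAct_apply hσ hsymm
      (superHat_apply hR hσ ht hsymm a)]
  hat_right a a' := LinearMap.ext fun x => by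
    rw [superHat_apply hR hσ ht hsymm, mul_assoc]
    exact (superHat_apply hR hσ ht hsymm a (a' * x)).symm
  hat_bijective := by
    refine ⟨fun a b hab => hb.eq_of fun x => ?_, fun φ => ?_⟩
    · have h1 := LinearMap.congr_fun hab (σ x)
      rwa [superHat_apply hR hσ ht hsymm, superHat_apply hR hσ ht hsymm, hsymm a,
        hsymm b, hσσ] at h1
    · obtain ⟨a, ha⟩ := hb.exists_eq φ
      exact ⟨a, LinearMap.ext fun x => (superHat_apply hR hσ ht hsymm a x).trans (ha x)⟩

end Superalgebra

/-! ### The standard Frobenius form and its correction -/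

namespace HeckeClifford

open Superalgebra

section General

variable {R : Type*} [CommRing R] {e : R} {P : R[X]} {n : ℕ} {A B : Type*} [Ring A] [Algebra R A]
  [Ring B] [Algebra R B]

/-- The properties of a form that are passed on from one rank to the next: invariance under the
parity automorphism and the (super)trace property. -/
structure HCAlg.IsTrace (b : HCAlg e P n B) (κ : Kind) (t : B →ₗ[R] R) : Prop where
  σ : ∀ x, t (b.σ x) = t x
  trace : ∀ x y, t (x * y) = t (b.twist κ y * x)

variable {κ : Kind} {m : ℕ} {a : HCAlg e P n A} {b : HCAlg e P (n + 1) B}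
  {S : HCStep (level κ m) a b}

theorem HCStep.isTrace_of (h : S.Frobenius (kindSign R κ)) (hr : 0 < level κ m) {t : A →ₗ[R] R}
    (ht : a.IsTrace κ t)
    (hT : ∀ i, i + 1 = n → ∀ x, t (S.proj (x * b.T i)) = t (S.proj (b.T i * x))) :
    b.IsTrace κ (t ∘ₗ S.proj) :=
  ⟨fun x => (congrArg t (HCStep.proj_σ h.spans hr x)).trans (ht.σ _),
    HCStep.trace_of h ht.σ ht.trace hT⟩

theorem HCStep.HasDualBasis.hasFormBasis (h : S.HasDualBasis) {t : A →ₗ[R] R}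
    (ht : HasFormBasis t) : HasFormBasis (t ∘ₗ S.π) := by
  obtain ⟨I, _, E, F, h⟩ := h
  obtain ⟨J, _, E', F', h'⟩ := ht
  refine ⟨I × J, inferInstance, fun k => E k.1 * S.ι (E' k.2), fun k => S.ι (F' k.2) * F k.1,
    fun x => ?_⟩
  refine Eq.trans ?_ (h x)
  rw [Fintype.sum_prod_type]
  refine Finset.sum_congr rfl fun i _ => ?_
  conv_rhs => rw [← h' (S.π (F i * x))]
  rw [map_sum, Finset.mul_sum]
  refine Finset.sum_congr rfl fun j _ => ?_
  rw [map_smul, mul_smul_comm, LinearMap.comp_apply, mul_assoc, S.π_left]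

theorem HCStep.proj_comp_apply {t : A →ₗ[R] R} {t' : A →ₗ[R] R} {w : A}
    (h : ∀ x, t' x = t (x * w)) (x : B) :
    t' (S.proj x) = t (S.π (x * (S.ι w * b.mid κ m))) := by
  rw [h, ← S.mid_ι, ← mul_assoc, S.π_right, HCStep.proj_apply]

end General

section Cyclotomic

variable {R : Type*} [CommRing R] (q : Rˣ) {κ : Kind} {m : ℕ} (Q : Fin m → Rˣ)

theorem wordsT_cycStep [Nontrivial R] (hr : 0 < level κ m) (n : ℕ) :
    (cycStep q κ Q hr n).wordsT = mackeyT q κ Q n := by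
  have h1 : ∀ i (hi : i + 1 = n), (cycAlg q κ Q (n + 1)).T i =
      gen q κ Q (Gen.T i (by omega)) := fun i hi => cycSys_T q κ Q (by omega)
  refine congrArg (Submodule.span R) (Set.ext fun z => ⟨?_, ?_⟩)
  · rintro ⟨i, hi, x, y, rfl⟩
    exact ⟨i, hi, x, y, by rw [h1 i hi]; rfl⟩
  · rintro ⟨i, hi, x, y, rfl⟩
    exact ⟨i, hi, x, y, by rw [h1 i hi]; rfl⟩

/-- The decomposition in the statement is the one of `DualWords.expand`. -/
theorem isMackey_iff [Nontrivial R] (hr : 0 < level κ m) {n : ℕ} (h : Cyc q κ Q (n + 1))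
    (p : Fin (level κ m) → Fin 2 → Cyc q κ Q n) : IsMackey q κ Q h p ↔
      h - ∑ k : Fin (level κ m), ∑ c : Fin 2, (cycAlg q κ Q (n + 1)).X n ^ (k : ℕ) *
          (cycAlg q κ Q (n + 1)).C n ^ (c : ℕ) *
        (cycStep q κ Q hr n).ι (p k c) ∈ (cycStep q κ Q hr n).wordsT := by
  have h1 : (cycAlg q κ Q (n + 1)).X n = gen q κ Q (Gen.X (Fin.last n)) :=
    cycSys_X q κ Q (Nat.lt_succ_self n)
  have h2 : (cycAlg q κ Q (n + 1)).C n = gen q κ Q (Gen.C (Fin.last n)) :=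
    cycSys_C q κ Q (Nat.lt_succ_self n)
  rw [wordsT_cycStep, h1, h2]
  rfl

/-- At level `0` the polynomial `f` is `1`. -/
theorem cyc_subsingleton (hr : level κ m = 0) (n : ℕ) : Subsingleton (Cyc q κ Q (n + 1)) := by
  have h1 := gen_rel q κ Q (Rel.cyc (q := q) (κ := κ) (Q := Q) (n := n + 1) (Nat.succ_pos n))
  cases κ
  · obtain rfl : m = 0 := by change 2 * m = 0 at hr; omega
    refine subsingleton_of_zero_eq_one ?_
    rw [map_zero] at h1
    rw [← h1]
    simp [cycPoly]
  · exact absurd hr (Nat.succ_ne_zero _)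

theorem existsUnique_isMackey [IsDomain R] (hR : ringChar R ≠ 2) {n : ℕ} (h : Cyc q κ Q (n + 1)) :
    ∃! p, IsMackey q κ Q h p := by
  rcases Nat.eq_zero_or_pos (level κ m) with hr | hr
  · have := cyc_subsingleton q Q hr n
    have h0 : ∀ p, IsMackey q κ Q h p := fun p => by
      rw [IsMackey, Subsingleton.elim (_ - _) (0 : Cyc q κ Q (n + 1))]
      exact zero_mem _
    refine ⟨fun _ _ => 0, h0 _, fun p _ => funext fun k => ?_⟩
    have hk := k.2
    omega
  · have hF := cycStep_frobenius q Q hR hr n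
    obtain ⟨g, hg⟩ := hF.exists_dualWords (kindSign_mul_self κ)
    refine ⟨fun k c => (cycStep q κ Q hr n).π (g k c * h),
      (isMackey_iff q Q hr h _).2 (hg.expand hF hr (kindSign_mul_self κ) h), fun p hp => ?_⟩
    exact funext fun k => funext fun c => hg.unique ((isMackey_iff q Q hr h p).1 hp) k c

/-- The first coefficient of the Mackey decomposition is the projection given by the tower, because
the first of the dual words is `1`. -/
theorem mackeyProj_eq [IsDomain R] (hR : ringChar R ≠ 2) (hr : 0 < level κ m) {n : ℕ}
    (h : Cyc q κ Q (n + 1)) : mackeyProj q κ Q h = (cycStep q κ Q hr n).π h := by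
  have hF := cycStep_frobenius q Q hR hr n
  obtain ⟨g, hg⟩ := hF.exists_dualWords (kindSign_mul_self κ)
  have h1 : IsMackey q κ Q h (mackeyCoeff q κ Q h) :=
    Classical.epsilon_spec (existsUnique_isMackey q Q hR h).exists
  rw [mackeyProj, dif_pos hr]
  refine (hg.unique ((isMackey_iff q Q hr h _).1 h1) ⟨0, hr⟩ 0).trans ?_
  rw [hg.zero hr, one_mul]

variable (κ)

/-- The element by which the standard Frobenius form is corrected. -/
def weight (n : ℕ) : Cyc q κ Q n :=
  match κ with
  | Kind.zero => prodX q Kind.zero Q n ^ m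
  | Kind.s => prodX q Kind.s Q n ^ m * prodOneAddX q Kind.s Q n

variable {κ}

theorem weight_zero : weight q κ Q 0 = 1 := by
  cases κ <;> simp [weight, prodX, prodOneAddX]

theorem prodX_succ (n : ℕ) : prodX q κ Q (n + 1) =
    incl q κ Q n (prodX q κ Q n) * gen q κ Q (Gen.X (Fin.last n)) := by
  rw [prodX, List.ofFn_succ', List.concat_eq_append, List.prod_append, List.prod_singleton, prodX,
    map_list_prod, List.map_ofFn]
  congr 3
  exact funext fun j => (incl_gen q κ Q (Gen.X j)).symm

theorem prodOneAddX_succ (n : ℕ) : prodOneAddX q κ Q (n + 1) =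
    incl q κ Q n (prodOneAddX q κ Q n) * (1 + gen q κ Q (Gen.X (Fin.last n))) := by
  rw [prodOneAddX, List.ofFn_succ', List.concat_eq_append, List.prod_append, List.prod_singleton,
    prodOneAddX, map_list_prod, List.map_ofFn]
  congr 3
  refine funext fun j => ?_
  rw [Function.comp_apply, map_add, map_one, incl_gen]
  rfl

theorem pow_mul_aux {B : Type*} [Monoid B] {p x : B} (h : x * p = p * x) (m : ℕ) :
    (p * x) ^ m = p ^ m * x ^ m :=
  Commute.mul_pow (show Commute p x from h.symm) m

theorem weight_aux {B : Type*} [Ring B] {p p' x : B} (h : x * p' = p' * x) (m : ℕ) :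
    p ^ m * x ^ m * (p' * (1 + x)) = p ^ m * p' * (x ^ m + x ^ (m + 1)) := by
  have h1 : x ^ m * p' = p' * x ^ m := (Commute.pow_left (show Commute x p' from h) m)
  rw [mul_assoc, ← mul_assoc (x ^ m), h1, mul_assoc p', mul_add, mul_one, ← pow_succ, mul_assoc]

theorem weight_succ [Nontrivial R] (hr : 0 < level κ m) (n : ℕ) : weight q κ Q (n + 1) =
    (cycStep q κ Q hr n).ι (weight q κ Q n) * (cycAlg q κ Q (n + 1)).mid κ m := by
  have h1 : (cycAlg q κ Q (n + 1)).X n = gen q κ Q (Gen.X (Fin.last n)) :=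
    cycSys_X q κ Q (Nat.lt_succ_self n)
  have h2 : ∀ x, gen q κ Q (Gen.X (Fin.last n)) * incl q κ Q n x =
      incl q κ Q n x * gen q κ Q (Gen.X (Fin.last n)) := fun x => by
    have := (cycStep q κ Q hr n).X_ι x
    rw [h1] at this
    exact this
  cases κ
  · change prodX q Kind.zero Q (n + 1) ^ m = incl q Kind.zero Q n (prodX q Kind.zero Q n ^ m) *
      (cycAlg q Kind.zero Q (n + 1)).Xp m
    rw [HCAlg.Xp_natCast, h1, prodX_succ, map_pow]
    exact pow_mul_aux (h2 _) m
  · change prodX q Kind.s Q (n + 1) ^ m * prodOneAddX q Kind.s Q (n + 1) =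
      incl q Kind.s Q n (prodX q Kind.s Q n ^ m * prodOneAddX q Kind.s Q n) *
      ((cycAlg q Kind.s Q (n + 1)).Xp m + (cycAlg q Kind.s Q (n + 1)).Xp (m + 1))
    rw [← Nat.cast_succ, HCAlg.Xp_natCast, HCAlg.Xp_natCast, h1, prodX_succ, prodOneAddX_succ,
      map_mul, map_pow]
    exact (congrArg (· * _) (pow_mul_aux (h2 _) m)).trans (weight_aux (h2 _) m)

variable (κ)

/-- The standard Frobenius form as a linear map. -/
def tauLin [Nontrivial R] (hr : 0 < level κ m) : (n : ℕ) → Cyc q κ Q n →ₗ[R] R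
  | 0 => (base q κ Q).toLinearMap
  | n + 1 => tauLin hr n ∘ₗ (cycStep q κ Q hr n).π

/-- The corrected form. -/
def cycForm [Nontrivial R] (hr : 0 < level κ m) : (n : ℕ) → Cyc q κ Q n →ₗ[R] R
  | 0 => (base q κ Q).toLinearMap
  | n + 1 => cycForm hr n ∘ₗ (cycStep q κ Q hr n).proj

variable {κ}

theorem tauLin_apply [IsDomain R] (hR : ringChar R ≠ 2) (hr : 0 < level κ m) {n : ℕ}
    (x : Cyc q κ Q n) : tauLin q κ Q hr n x = tau q κ Q n x := by
  induction n with
  | zero => rfl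
  | succ n ih => rw [tau, mackeyProj_eq q Q hR hr, ← ih]; rfl

theorem cycForm_apply [Nontrivial R] (hr : 0 < level κ m) {n : ℕ} (x : Cyc q κ Q n) :
    cycForm q κ Q hr n x = tauLin q κ Q hr n (x * weight q κ Q n) := by
  induction n with
  | zero => rw [weight_zero, mul_one]; rfl
  | succ n ih =>
    rw [weight_succ q Q hr]
    exact HCStep.proj_comp_apply ih x

theorem base_isTrace : (cycAlg q κ Q 0).IsTrace κ (base q κ Q).toLinearMap where
  σ x := congrArg (base q κ Q) (parityHom_zero q κ Q x)
  trace x y := by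
    rw [HCAlg.twist_even _ κ (parityHom_zero q κ Q y)]
    change base q κ Q (x * y) = base q κ Q (y * x)
    rw [map_mul, map_mul, mul_comm]

theorem base_hasFormBasis : HasFormBasis (base q κ Q).toLinearMap := by
  refine ⟨Unit, inferInstance, fun _ => 1, fun _ => 1, fun x => ?_⟩
  rw [Fintype.sum_unique, one_mul, ← Algebra.algebraMap_eq_smul_one]
  exact algebraMap_base q κ Q x

theorem cycForm_isTrace [IsDomain R] (hR : ringChar R ≠ 2) (hr : 0 < level κ m) (n : ℕ) :
    (cycAlg q κ Q n).IsTrace κ (cycForm q κ Q hr n) := by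
  induction n with
  | zero => exact base_isTrace q Q
  | succ n ih =>
    refine HCStep.isTrace_of (cycStep_frobenius q Q hR hr n) hr ih fun i hi x => ?_
    subst hi
    exact HCStep.trace_T (cycStep_frobenius q Q hR hr i) hr ih.σ ih.trace x

theorem tauLin_hasFormBasis [IsDomain R] (hR : ringChar R ≠ 2) (hr : 0 < level κ m) (n : ℕ) :
    HasFormBasis (tauLin q κ Q hr n) := by
  induction n with
  | zero => exact base_hasFormBasis q Q
  | succ n ih => exact (cycStep_hasDualBasis q Q hR hr n).hasFormBasis ih

variable (κ) in
/-- The form `tau (- * weight)`, at all levels. -/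
theorem exists_cycForm [IsDomain R] (hR : ringChar R ≠ 2) (n : ℕ) :
    ∃ t : Cyc q κ Q n →ₗ[R] R, (∀ x, t x = tau q κ Q n (x * weight q κ Q n)) ∧
      (cycAlg q κ Q n).IsTrace κ t ∧ (IsUnit (weight q κ Q n) → HasFormBasis t) := by
  rcases Nat.eq_zero_or_pos (level κ m) with hr | hr
  · cases n with
    | zero =>
      refine ⟨(base q κ Q).toLinearMap, fun x => ?_, base_isTrace q Q,
        fun _ => base_hasFormBasis q Q⟩
      rw [weight_zero, mul_one]
      rfl
    | succ n =>
      have := cyc_subsingleton q Q hr n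
      have h0 : ∀ k, tau q κ Q k 0 = 0 := fun k => by
        induction k with
        | zero => exact map_zero (base q κ Q)
        | succ k ih =>
          rw [tau, mackeyProj, dif_neg (by omega), ih]
      refine ⟨0, fun x => ?_, ⟨fun _ => rfl, fun _ _ => rfl⟩, fun _ =>
        ⟨Empty, inferInstance, Empty.elim, Empty.elim, fun x => Subsingleton.elim _ _⟩⟩
      rw [Subsingleton.elim (x * _) (0 : Cyc q κ Q (n + 1)), h0]
      rfl
  · have h1 := fun x => cycForm_apply q Q hr (n := n) x
    have h2 := cycForm_isTrace q Q hR hr n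
    refine ⟨cycForm q κ Q hr n, fun x => ?_, h2, fun hw => ?_⟩
    · rw [h1, tauLin_apply q Q hR hr]
    · obtain ⟨w, hw⟩ := hw.exists_left_inv
      exact (tauLin_hasFormBasis q Q hR hr n).of_mul_unit hw h1 h2.trace

theorem isUnit_prodX (n : ℕ) : IsUnit (prodX q κ Q n) := by
  have h : ∀ l : List (Cyc q κ Q n), (∀ x ∈ l, IsUnit x) → IsUnit l.prod := fun l hl => by
    induction l with
    | nil => rw [List.prod_nil]; exact isUnit_one
    | cons x l ih =>
      rw [List.prod_cons]
      exact (hl x (List.mem_cons_self ..)).mul (ih fun y hy => hl y (List.mem_cons_of_mem _ hy))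
  refine h _ fun x hx => ?_
  obtain ⟨j, rfl⟩ := (List.mem_ofFn' _ _).1 hx
  have h1 := ((cycAlg q κ Q n).Xu j j.2).isUnit
  rw [HCAlg.val_Xu] at h1
  have h2 : (cycAlg q κ Q n).X j = gen q κ Q (Gen.X j) := cycSys_X q κ Q j.2
  rwa [h2] at h1

end Cyclotomic

end HeckeClifford

end

theorem theorem1p2 {R : Type*} [CommRing R] [IsDomain R] (hR : ringChar R ≠ 2)
    (q : Rˣ) (hq : IsUnit ((q : R) + ((q⁻¹ : Rˣ) : R))) (m : ℕ) (Q : Fin m → Rˣ) (n : ℕ) :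
    -- the Mackey decompositions, on which the form `tau` rests, exist and are unique
    (∀ (κ : Kind) (k : ℕ) (h : Cyc q κ Q (k + 1)), ∃! p, IsMackey q κ Q h p) ∧
    -- type `0`
    (∃ t : Cyc q Kind.zero Q n →ₗ[R] R,
      (∀ x, t x = tau q Kind.zero Q n (x * prodX q Kind.zero Q n ^ m)) ∧
      IsSupersymmetrizingForm (parityPart q Kind.zero Q n) t) ∧
    -- type `s`
    (∃ t : Cyc q Kind.s Q n →ₗ[R] R,
      (∀ x, t x = tau q Kind.s Q n (x * (prodX q Kind.s Q n ^ m * prodOneAddX q Kind.s Q n))) ∧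
      (∀ x y, t (x * y) = t (y * x)) ∧
      (IsUnit (prodOneAddX q Kind.s Q n) →
        IsSymmetrizingForm (parityPart q Kind.s Q n) t)) := by
  refine ⟨fun κ k h => existsUnique_isMackey q Q hR h, ?_, ?_⟩
  · obtain ⟨t, h1, h2, h3⟩ := exists_cycForm q Kind.zero Q hR n
    exact ⟨t, h1, isSupersymmetrizingForm hR (fun i x hx => parityHom_of_mem q Kind.zero Q hx)
      (cycAlg q Kind.zero Q n).σ_σ h2.σ h2.trace (h3 ((isUnit_prodX q Q n).pow m))⟩
  · obtain ⟨t, h1, h2, h3⟩ := exists_cycForm q Kind.s Q hR n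
    exact ⟨t, h1, h2.trace, fun hu => isSymmetrizingForm hR
      (fun i x hx => parityHom_of_mem q Kind.s Q hx) h2.σ h2.trace
      (h3 (((isUnit_prodX q Q n).pow m).mul hu))⟩
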